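/- All Hopf algebras are finite-dimensional over $\mathbb{C}$, all modules are finite-dimensional left modules, and $\Delta(x)=\sum x_{(1)}\otimes x_{(2)}$ denotes the coproduct. For a semisimple Hopf algebra $A$ let $\Lambda\in A$ be its normalized integral, i.e. the unique element with $a\Lambda=\varepsilon(a)\Lambda=\Lambda a$ for all $a\in A$ and $\varepsilon(\Lambda)=1$. For $n\ge 1$, the $n$-th Frobenius–Schur indicator of an $A$-module $M$ with character $\chi_M$ is $$\nu_n^A(M)=\chi_M\big(\Lambda^{[n]}\big),\qquad \Lambda^{[n]}=\sum\Lambda_{(1)}\Lambda_{(2)}\cdots\Lambda_{(n)} .$$ For a Hopf algebra $A$, the co-opposite Hopf algebra $A^{\mathrm{cop}}$ is the algebra $A$ with the flipped coproduct. Let $H$ and $K$ be semisimple Hopf algebras over $\mathbb{C}$ and let $\sigma:K^*\otimes H\to\mathbb{C}$ be a Hopf pairing, that is, a bilinear form with $$\sigma(fg,h)=\sum\sigma(f,h_{(1)})\,\sigma(g,h_{(2)}),\quad \sigma(f,hh')=\sum\sigma(f_{(1)},h)\,\sigma(f_{(2)},h'),\quad \sigma(1,h)=\varepsilon(h),\quad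 \sigma(f,1)=\varepsilon(f)$$ for all $f,g\in K^*$ and $h,h'\in H$, where $K^*$ is the dual Hopf algebra. Let $\sigma_r:H\to K$ be the Hopf algebra map determined by $f(\sigma_r(h))=\sigma(f,h)$ for all $f\in K^*$. For an $H$-module $V$ let $K^{*\mathrm{cop}}\bowtie_\sigma V$ be the vector space $K^*\otimes V$, with elements $f\otimes v$ written $f\bowtie v$. The generalized quantum double $K^{*\mathrm{cop}}\bowtie_\sigma H$ is the Hopf algebra whose coalgebra is the tensor product coalgebra $K^{*\mathrm{cop}}\otimes H$ and whose product is given by the following formula with $V=H$; the same formula makes $K^{*\mathrm{cop}}\bowtie_\sigma V$ a module over it: $$(f\bowtie h)\cdot(l\bowtie v)=\sum\sigma(l_{(3)},h_{(1)})\,(f\,l_{(2)}\bowtie h_{(2)}v)\,\sigma(S^{-1}(l_{(1)}),h_{(3)}),$$ where the coproducts of $l$ and the inverse antipode $S^{-1}$ are those of $K^*$. For a $K$-module $W$, let $V\otimes W$ be the $H$-module with the diagonal action $$h\,(v\otimes w)=\sum h_{(1)}v\otimes\sigma_r(h_{(2)})\,w .$$ Then $K^{*\mathrm{cop}}\bowtie_\sigma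 H$ is semisimple, and for every $H$-module $V$ and every $n\ge 1$ $$\nu_n^{K^{*\mathrm{cop}}\bowtie_\sigma H}\big(K^{*\mathrm{cop}}\bowtie_\sigma V\big)=\sum_{W\in\mathrm{Irr}(K)}\nu_n^{H}(V\otimes W)\;\nu_n^{K^{\mathrm{cop}}}(W),$$ where $\mathrm{Irr}(K)$ is the finite set of isomorphism classes of irreducible $K$-modules, and $W$ is regarded as a $K^{\mathrm{cop}}$-module through the equality of algebras $K^{\mathrm{cop}}=K$. -/

import Mathlib

/-! Generalized quantum doubles of finite-dimensional Hopf algebras and higher Frobenius-Schur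
indicators of Hopf algebra modules. In comments, `∑ x₍₁₎ ⊗ x₍₂₎` is the coproduct of `x`. -/

namespace HopfDouble
noncomputable section

open scoped TensorProduct
open Coalgebra HopfAlgebra WithConv

set_option linter.unusedSectionVars false
set_option linter.unusedSimpArgs false

/-! ### The antipode of a finite-dimensional Hopf algebra

The antipode is anti-comultiplicative, and it is bijective in finite dimension. -/

section Antipode
variable {k A : Type*} [Field k] [Ring A] [HopfAlgebra k A]

theorem conv_antipode_right {B : Type*} [Ring B] [Algebra k B] (f : A →ₐ[k] B) :
    (toConv f.toLinearMap : WithConv (A →ₗ[k] B)) * toConv (f.toLinearMap ∘ₗ antipode k) = 1 := by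
  have h := LinearMap.algHom_comp_convMul_distrib f (toConv LinearMap.id)
    (toConv (antipode k (A := A)))
  rw [LinearMap.id_mul_antipode] at h
  apply WithConv.ext
  simp only [LinearMap.comp_id] at h
  rw [← h]
  ext x
  simp [LinearMap.convOne_def]

theorem conv_antipode_left {B : Type*} [Ring B] [Algebra k B] (f : A →ₐ[k] B) :
    (toConv (f.toLinearMap ∘ₗ antipode k) : WithConv (A →ₗ[k] B)) * toConv f.toLinearMap = 1 := by
  have h := LinearMap.algHom_comp_convMul_distrib f (toConv (antipode k (A := A)))
    (toConv LinearMap.id)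
  rw [LinearMap.antipode_mul_id] at h
  apply WithConv.ext
  simp only [LinearMap.comp_id] at h
  rw [← h]
  ext x
  simp [LinearMap.convOne_def]

theorem comul_antipode :
    comul ∘ₗ antipode k (A := A) =
      TensorProduct.map (antipode k) (antipode k) ∘ₗ (TensorProduct.comm k A A).toLinearMap ∘ₗ
        comul := by
  let iL : A →ₐ[k] A ⊗[k] A := Algebra.TensorProduct.includeLeft
  let iR : A →ₐ[k] A ⊗[k] A := Algebra.TensorProduct.includeRight
  have h1 : (toConv (Bialgebra.comulAlgHom k A).toLinearMap : WithConv (A →ₗ[k] A ⊗[k] A)) =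
      toConv iL.toLinearMap * toConv iR.toLinearMap := by
    ext x
    rw [(ℛ k x).convMul_apply]
    simp [iL, iR, (ℛ k x).eq]
  have h2 : (toConv (TensorProduct.map (antipode k) (antipode k) ∘ₗ
      (TensorProduct.comm k A A).toLinearMap ∘ₗ comul) : WithConv (A →ₗ[k] A ⊗[k] A)) =
      toConv (iR.toLinearMap ∘ₗ antipode k) * toConv (iL.toLinearMap ∘ₗ antipode k) := by
    ext x
    rw [(ℛ k x).convMul_apply]
    simp [iL, iR, ← (ℛ k x).eq]
  have h3 := conv_antipode_left (Bialgebra.comulAlgHom k A)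
  have h4 : (toConv (Bialgebra.comulAlgHom k A).toLinearMap : WithConv (A →ₗ[k] A ⊗[k] A)) *
      toConv (TensorProduct.map (antipode k) (antipode k) ∘ₗ
      (TensorProduct.comm k A A).toLinearMap ∘ₗ comul) = 1 := by
    rw [h1, h2, mul_assoc, ← mul_assoc (toConv iR.toLinearMap), conv_antipode_right iR, one_mul,
      conv_antipode_right iL]
  have := left_inv_eq_right_inv h3 h4
  simpa using congrArg WithConv.ofConv this

theorem antipode_sq_mul_antipode (a : A) :
    ∑ i ∈ (ℛ k a).index, antipode k (antipode k ((ℛ k a).right i)) * antipode k ((ℛ k a).left i) =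
      counit (R := k) a • 1 := by
  simp_rw [← HopfAlgebra.antipode_mul_antidistrib, ← map_sum]
  rw [HopfAlgebra.sum_mul_antipode_eq_smul]
  simp

theorem mulLeft_conv (a : A) (f g : WithConv (A →ₗ[k] A)) :
    toConv (LinearMap.mulLeft k a ∘ₗ f.ofConv) * g =
      toConv (LinearMap.mulLeft k a ∘ₗ (f * g).ofConv) := by
  ext q
  simp only [(ℛ k q).convMul_apply, LinearMap.comp_apply, LinearMap.mulLeft_apply,
    Finset.mul_sum, mul_assoc]

theorem integral_shift (l : A →ₗ[k] k)
    (hl : ∀ x : A, TensorProduct.rid k A (LinearMap.lTensor A l (comul x)) = l x • 1) (x p : A) :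
    TensorProduct.lid k A (LinearMap.rTensor A (l ∘ₗ LinearMap.mulLeft k x ∘ₗ antipode k)
      (comul p)) =
    TensorProduct.rid k A (LinearMap.lTensor A (l ∘ₗ LinearMap.mulRight k (antipode k p))
      (comul x)) := by
  let j (y : A) : WithConv (A →ₗ[k] A) :=
    toConv (Algebra.linearMap k A ∘ₗ l ∘ₗ LinearMap.mulLeft k y ∘ₗ antipode k)
  have h1 : j x = ∑ i ∈ (ℛ k x).index,
      toConv (LinearMap.mulLeft k ((ℛ k x).left i) ∘ₗ
        (j ((ℛ k x).right i) * toConv (antipode k)).ofConv) := by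
    ext p
    have h := hl (x * antipode k p)
    have h2 := LinearMap.congr_fun (comul_antipode (k := k) (A := A)) p
    simp only [LinearMap.comp_apply] at h2
    rw [Bialgebra.comul_mul, h2, ← (ℛ k x).eq, ← (ℛ k p).eq] at h
    simp only [map_sum, Finset.sum_mul, Finset.mul_sum, LinearEquiv.coe_coe,
      TensorProduct.comm_tmul, TensorProduct.map_tmul, Algebra.TensorProduct.tmul_mul_tmul,
      LinearMap.lTensor_tmul, TensorProduct.rid_tmul] at h
    simp only [j, WithConv.ofConv_sum, LinearMap.sum_apply, LinearMap.comp_apply,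
      (ℛ k p).convMul_apply, LinearMap.mulLeft_apply, Finset.mul_sum, Algebra.linearMap_apply,
      Algebra.algebraMap_eq_smul_one, smul_mul_assoc, one_mul, mul_smul_comm]
    rw [Finset.sum_comm]
    exact h.symm
  have h2 : j x * toConv LinearMap.id = ∑ i ∈ (ℛ k x).index,
      toConv (LinearMap.mulLeft k ((ℛ k x).left i) ∘ₗ (j ((ℛ k x).right i)).ofConv) := by
    rw [h1, Finset.sum_mul]
    refine Finset.sum_congr rfl fun i _ => ?_
    rw [mulLeft_conv, mul_assoc, LinearMap.antipode_mul_id, mul_one]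
  have h3 := LinearMap.congr_fun (congrArg WithConv.ofConv h2) p
  simp only [WithConv.ofConv_sum, LinearMap.sum_apply, (ℛ k p).convMul_apply] at h3
  rw [← (ℛ k p).eq, ← (ℛ k x).eq]
  simpa [j, Algebra.algebraMap_eq_smul_one] using h3

variable [FiniteDimensional k A]

theorem antipode_injective_of_integral (l : A →ₗ[k] k) (hl0 : l ≠ 0)
    (hl : ∀ x : A, TensorProduct.rid k A (LinearMap.lTensor A l (comul x)) = l x • 1) :
    Function.Injective (antipode k (A := A)) := by
  rw [← LinearMap.ker_eq_bot, LinearMap.ker_eq_bot']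
  intro p hp
  have h1 : ∀ x : A, TensorProduct.lid k A
      (LinearMap.rTensor A (l ∘ₗ LinearMap.mulLeft k x ∘ₗ antipode k) (comul p)) = 0 := by
    intro x
    rw [integral_shift l hl, hp]
    simp
  let Th : A →ₗ[k] Module.Dual k A := (LinearMap.llcomp k A A k l) ∘ₗ (LinearMap.mul k A).flip ∘ₗ antipode k
  have h2 : LinearMap.rTensor A Th (comul p) = 0 := by
    apply (dualTensorHomEquiv k A A).injective
    ext y
    rw [map_zero, LinearMap.zero_apply, ← h1 y, ← (ℛ k p).eq]
    simp [Th, dualTensorHomEquiv]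
  obtain ⟨x, hx⟩ : ∃ x, l x ≠ 0 := by
    by_contra! h
    exact hl0 (LinearMap.ext h)
  let M' : Module.Dual k A ⊗[k] (A ⊗[k] A) →ₗ[k] A :=
    (TensorProduct.lid k A).toLinearMap ∘ₗ LinearMap.rTensor A (TensorProduct.lift
      (LinearMap.flip (LinearMap.llcomp k A A k ) (LinearMap.mulLeft k x ∘ₗ antipode k ∘ₗ antipode k))) ∘ₗ
      (TensorProduct.assoc k _ _ _).symm.toLinearMap
  have h3 : M' (LinearMap.lTensor _ comul (LinearMap.rTensor A Th (comul p))) = l x • p := by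
    have e : M' ∘ₗ LinearMap.lTensor _ comul ∘ₗ LinearMap.rTensor A Th =
      (TensorProduct.lid k A).toLinearMap ∘ₗ LinearMap.rTensor A (TensorProduct.lift
       (((LinearMap.mul k A).flip.compl₁₂ (antipode k) (antipode k ∘ₗ antipode k)).compr₂
        (l ∘ₗ LinearMap.mulLeft k x))) ∘ₗ (TensorProduct.assoc k _ _ _).symm.toLinearMap ∘ₗ
        LinearMap.lTensor _ comul := by
      apply TensorProduct.ext'
      intro a b
      simp only [LinearMap.comp_apply, LinearMap.rTensor_tmul, LinearMap.lTensor_tmul]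
      rw [← (ℛ k b).eq]
      simp [M', Th, TensorProduct.tmul_sum, mul_assoc]
    have e' := LinearMap.congr_fun e (comul p)
    simp only [LinearMap.comp_apply, LinearEquiv.coe_coe, Coalgebra.coassoc_symm_apply] at e'
    rw [e', ← LinearMap.rTensor_comp_apply]
    have e2 : TensorProduct.lift
       (((LinearMap.mul k A).flip.compl₁₂ (antipode k) (antipode k ∘ₗ antipode k)).compr₂
        (l ∘ₗ LinearMap.mulLeft k x)) ∘ₗ comul = l x • counit := by
      ext a
      rw [LinearMap.comp_apply, ← (ℛ k a).eq]
      have := antipode_sq_mul_antipode (k := k) a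
      have := congrArg (fun y => l (x * y)) this
      simpa [Finset.mul_sum, mul_comm] using this
    rw [e2, LinearMap.rTensor_smul]
    simp
  rw [h2] at h3
  simpa [hx] using h3.symm

/-- `y ↦ y₍₁₎ f(y₍₂₎)` -/
def hitLeft (f : A →ₗ[k] k) : A →ₗ[k] A :=
  (TensorProduct.rid k A).toLinearMap ∘ₗ LinearMap.lTensor A f ∘ₗ comul

theorem trace_aux (g : A →ₗ[k] k) (Y : A →ₗ[k] A) :
    LinearMap.trace k A ((TensorProduct.lid k A).toLinearMap ∘ₗ
      LinearMap.rTensor A (TensorProduct.lift (((LinearMap.mul k A).flip.compl₁₂ (antipode k)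
        LinearMap.id).compr₂ g)) ∘ₗ (TensorProduct.assoc k A A A).symm.toLinearMap ∘ₗ
      LinearMap.lTensor A (comul ∘ₗ Y) ∘ₗ comul) = g 1 * LinearMap.trace k A Y := by
  obtain ⟨Y, rfl⟩ := (dualTensorHomEquiv k A A).surjective Y
  induction Y with
  | zero => simp
  | add x y hx hy =>
    simp only [map_add, LinearMap.comp_add, LinearMap.lTensor_add, LinearMap.add_comp, mul_add,
      hx, hy]
  | tmul φ z =>
    have : (TensorProduct.lid k A).toLinearMap ∘ₗ
      LinearMap.rTensor A (TensorProduct.lift (((LinearMap.mul k A).flip.compl₁₂ (antipode k)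
        LinearMap.id).compr₂ g)) ∘ₗ (TensorProduct.assoc k A A A).symm.toLinearMap ∘ₗ
      LinearMap.lTensor A (comul ∘ₗ dualTensorHomEquiv k A A (φ ⊗ₜ z)) ∘ₗ comul =
       ∑ i ∈ (ℛ k z).index, dualTensorHom k A A
         ((toConv (g ∘ₗ LinearMap.mulLeft k ((ℛ k z).left i) ∘ₗ antipode k) * toConv φ).ofConv
          ⊗ₜ (ℛ k z).right i) := by
      ext a
      simp only [LinearMap.comp_apply, LinearMap.sum_apply, dualTensorHom_apply,
        (ℛ k a).convMul_apply]
      rw [← (ℛ k a).eq]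
      simp [dualTensorHomEquiv, ← (ℛ k z).eq, TensorProduct.tmul_sum, Finset.smul_sum,
        Finset.sum_smul, smul_smul]
      rw [Finset.sum_comm]
      simp [mul_comm]
    rw [this, map_sum]
    simp only [LinearMap.trace_eq_contract_apply, contractLeft_apply]
    have e2 : (g ∘ₗ TensorProduct.lift ((LinearMap.mul k A).compl₂ (antipode k))) ∘ₗ comul =
        g 1 • counit := by
      ext a
      rw [LinearMap.comp_apply, ← (ℛ k a).eq]
      have := congrArg g (sum_mul_antipode_eq_smul (ℛ k a))
      simpa [mul_comm] using this
    have e : (LinearMap.mul' k k ∘ₗ TensorProduct.map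
        (g ∘ₗ TensorProduct.lift ((LinearMap.mul k A).compl₂ (antipode k))) φ ∘ₗ
        (TensorProduct.assoc k A A A).symm.toLinearMap) (LinearMap.lTensor A comul (comul z)) =
        g 1 * φ z := by
      simp only [LinearMap.comp_apply, LinearEquiv.coe_coe, Coalgebra.coassoc_symm_apply]
      rw [← LinearMap.comp_apply (TensorProduct.map _ _), LinearMap.map_comp_rTensor, e2,
        ← (ℛ k z).eq]
      have := congrArg φ (sum_counit_smul (ℛ k z))
      simpa [mul_assoc, ← Finset.mul_sum] using Or.inl this
    have e3 : LinearMap.trace k A (dualTensorHomEquiv k A A (φ ⊗ₜ z)) = φ z := by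
      simp [dualTensorHomEquiv, LinearMap.trace_eq_contract_apply]
    rw [e3, ← e, ← (ℛ k z).eq]
    simp only [map_sum, LinearMap.lTensor_tmul]
    refine Finset.sum_congr rfl fun i _ => ?_
    rw [(ℛ k ((ℛ k z).right i)).convMul_apply, ← (ℛ k ((ℛ k z).right i)).eq]
    simp [TensorProduct.tmul_sum]

theorem trace_aux2 (N : A ⊗[k] A →ₗ[k] A) {ι : Type*} [Fintype ι] (b : Module.Basis ι k A) :
    ∑ j, LinearMap.trace k A (hitLeft (b.coord j) ∘ₗ N ∘ₗ (TensorProduct.mk k A A).flip (b j)) =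
      LinearMap.trace k A (N ∘ₗ comul) := by
  obtain ⟨N, rfl⟩ := (dualTensorHomEquiv k (A ⊗[k] A) A).surjective N
  induction N with
  | zero => simp
  | add x y hx hy =>
    simp only [map_add, LinearMap.comp_add, LinearMap.add_comp, Finset.sum_add_distrib, hx, hy]
  | tmul φ z =>
    have h1 : ∀ j, hitLeft (b.coord j) ∘ₗ dualTensorHomEquiv k (A ⊗[k] A) A (φ ⊗ₜ z) ∘ₗ
        (TensorProduct.mk k A A).flip (b j) = dualTensorHom k A A
          ((φ ∘ₗ (TensorProduct.mk k A A).flip (b j)) ⊗ₜ hitLeft (b.coord j) z) := by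
      intro j
      ext a
      simp [dualTensorHomEquiv]
    have h2 : dualTensorHomEquiv k (A ⊗[k] A) A (φ ⊗ₜ z) ∘ₗ comul = dualTensorHom k A A
          ((φ ∘ₗ comul) ⊗ₜ z) := by
      ext a
      simp [dualTensorHomEquiv]
    simp only [h1, h2, LinearMap.trace_eq_contract_apply, contractLeft_apply, LinearMap.comp_apply]
    rw [← map_sum]
    congr 1
    rw [← (ℛ k z).eq]
    simp only [hitLeft, LinearMap.comp_apply, ← (ℛ k z).eq, map_sum, LinearMap.lTensor_tmul,
      LinearEquiv.coe_coe, TensorProduct.rid_tmul, LinearMap.flip_apply, TensorProduct.mk_apply,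
      TensorProduct.sum_tmul]
    rw [Finset.sum_comm]
    refine Finset.sum_congr rfl fun i _ => ?_
    conv_rhs => rw [← b.sum_repr ((ℛ k z).right i), TensorProduct.tmul_sum]
    simp [TensorProduct.smul_tmul]

theorem comul_hitLeft (f : A →ₗ[k] k) (y : A) :
    comul (hitLeft f y) = LinearMap.lTensor A (hitLeft f) (comul (R := k) y) := by
  have h : ∀ w : A ⊗[k] A, comul (TensorProduct.rid k A (LinearMap.lTensor A f w)) =
      LinearMap.lTensor A ((TensorProduct.rid k A).toLinearMap ∘ₗ LinearMap.lTensor A f)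
        (TensorProduct.assoc k A A A (LinearMap.rTensor A comul w)) := by
    intro w
    induction w with
    | zero => simp
    | add x y hx hy => simp only [map_add, hx, hy]
    | tmul p q =>
      simp only [LinearMap.lTensor_tmul, TensorProduct.rid_tmul, LinearMap.rTensor_tmul, map_smul]
      rw [← (ℛ k p).eq]
      simp [TensorProduct.sum_tmul, Finset.smul_sum]
  simp only [hitLeft, LinearMap.comp_apply, LinearEquiv.coe_coe, h, Coalgebra.coassoc_apply]
  rw [← LinearMap.lTensor_comp_apply]
  rfl

/-- `x ↦ tr(y ↦ f ⇀ (x S²(y)))`, an integral on `A`. -/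
def traceIntegral (f : A →ₗ[k] k) : A →ₗ[k] k :=
  LinearMap.trace k A ∘ₗ LinearMap.llcomp k A A A (hitLeft f) ∘ₗ
    (LinearMap.mul k A).compl₂ (antipode k ∘ₗ antipode k)

theorem traceIntegral_integral (f : A →ₗ[k] k) (x : A) :
    TensorProduct.rid k A (LinearMap.lTensor A (traceIntegral f) (comul x)) =
      traceIntegral f x • 1 := by
  rw [← sub_eq_zero, ← Module.forall_dual_apply_eq_zero_iff k]
  intro g
  rw [map_sub, sub_eq_zero]
  let S2 : A →ₗ[k] A := antipode k ∘ₗ antipode k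
  let Y (x : A) : A →ₗ[k] A := hitLeft f ∘ₗ LinearMap.mulLeft k x ∘ₗ S2
  have hY : ∀ x, traceIntegral f x = LinearMap.trace k A (Y x) := by
    intro x
    simp only [traceIntegral, LinearMap.comp_apply]
    congr 1
  have hS2 : ∀ q : A, comul (S2 q) = TensorProduct.map S2 S2 (comul (R := k) q) := by
    intro q
    have h := fun q => LinearMap.congr_fun (comul_antipode (k := k) (A := A)) q
    simp only [LinearMap.comp_apply] at h
    simp only [S2, LinearMap.comp_apply, h]
    rw [← (ℛ k q).eq]
    simp
  have h := trace_aux g (Y x)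
  have h2 : (TensorProduct.lid k A).toLinearMap ∘ₗ
      LinearMap.rTensor A (TensorProduct.lift (((LinearMap.mul k A).flip.compl₁₂ (antipode k)
        LinearMap.id).compr₂ g)) ∘ₗ (TensorProduct.assoc k A A A).symm.toLinearMap ∘ₗ
      LinearMap.lTensor A (comul ∘ₗ Y x) ∘ₗ comul =
      ∑ i ∈ (ℛ k x).index, g ((ℛ k x).left i) • Y ((ℛ k x).right i) := by
    let Q (u v : A) : A ⊗[k] (A ⊗[k] A) →ₗ[k] A :=
      (TensorProduct.lid k A).toLinearMap ∘ₗ TensorProduct.map (g ∘ₗ LinearMap.mulLeft k u ∘ₗ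
        TensorProduct.lift ((LinearMap.mul k A).flip.compl₁₂ (antipode k) S2)) (Y v) ∘ₗ
        (TensorProduct.assoc k A A A).symm.toLinearMap
    have h3 : (TensorProduct.lid k A).toLinearMap ∘ₗ
      LinearMap.rTensor A (TensorProduct.lift (((LinearMap.mul k A).flip.compl₁₂ (antipode k)
        LinearMap.id).compr₂ g)) ∘ₗ (TensorProduct.assoc k A A A).symm.toLinearMap ∘ₗ
      LinearMap.lTensor A (comul ∘ₗ Y x) = ∑ i ∈ (ℛ k x).index,
        Q ((ℛ k x).left i) ((ℛ k x).right i) ∘ₗ LinearMap.lTensor A comul := by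
      apply TensorProduct.ext'
      intro p q
      simp only [LinearMap.comp_apply, LinearMap.lTensor_tmul, LinearMap.sum_apply]
      rw [show comul (Y x q) = LinearMap.lTensor A (hitLeft f)
          (comul x * TensorProduct.map S2 S2 (comul (R := k) q)) by
        rw [← hS2, ← Bialgebra.comul_mul, ← comul_hitLeft]; rfl]
      rw [← (ℛ k x).eq, ← (ℛ k q).eq]
      simp [Q, Y, TensorProduct.tmul_sum, Finset.sum_mul, Finset.mul_sum, mul_assoc]
      try rw [Finset.sum_comm]
    ext a
    have h4 := LinearMap.congr_fun h3 (comul a)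
    simp only [LinearMap.comp_apply, LinearMap.sum_apply, LinearMap.smul_apply] at h4 ⊢
    rw [h4]
    refine Finset.sum_congr rfl fun i _ => ?_
    have e2 : ∀ u : A, (g ∘ₗ LinearMap.mulLeft k u ∘ₗ
        TensorProduct.lift ((LinearMap.mul k A).flip.compl₁₂ (antipode k) S2)) ∘ₗ comul =
        g u • counit := by
      intro u
      ext a
      rw [LinearMap.comp_apply, ← (ℛ k a).eq]
      have := congrArg (fun y => g (u * y)) (antipode_sq_mul_antipode (k := k) a)
      simpa [Finset.mul_sum, mul_comm, S2] using this
    simp only [Q, LinearMap.comp_apply, LinearEquiv.coe_coe, Coalgebra.coassoc_symm_apply]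
    rw [← LinearMap.comp_apply (TensorProduct.map _ _), LinearMap.map_comp_rTensor]
    have e3 := e2 ((ℛ k x).left i)
    simp only [LinearMap.comp_assoc] at e3 ⊢
    rw [e3, ← (ℛ k a).eq]
    have := congrArg (fun y => g ((ℛ k x).left i) • Y ((ℛ k x).right i) y)
      (sum_counit_smul (ℛ k a))
    simpa [Y, Finset.smul_sum, smul_smul] using this
  rw [h2] at h
  simp only [map_sum, map_smul, ← hY] at h
  rw [← (ℛ k x).eq]
  simpa [mul_comm] using h

theorem exists_traceIntegral_ne_zero : ∃ f : A →ₗ[k] k, traceIntegral f ≠ 0 := by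
  by_contra! h
  let b := Module.finBasis k A
  let N : A ⊗[k] A →ₗ[k] A :=
    TensorProduct.lift ((LinearMap.mul k A).flip.compl₁₂ (antipode k ∘ₗ antipode k) (antipode k))
  have h1 := trace_aux2 N b
  have h2 : ∀ j, LinearMap.trace k A
      (hitLeft (b.coord j) ∘ₗ N ∘ₗ (TensorProduct.mk k A A).flip (b j)) = 0 := by
    intro j
    have := LinearMap.congr_fun (h (b.coord j)) (antipode k (b j))
    rw [LinearMap.zero_apply] at this
    rw [← this]
    simp only [traceIntegral, LinearMap.comp_apply]
    congr 1
  have h3 : N ∘ₗ comul = dualTensorHom k A A (counit ⊗ₜ 1) := by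
    ext a
    rw [LinearMap.comp_apply, ← (ℛ k a).eq]
    have := congrArg (antipode k) (HopfAlgebra.sum_antipode_mul_eq_smul (ℛ k a))
    simpa [N, HopfAlgebra.antipode_mul_antidistrib] using this
  rw [h3, LinearMap.trace_eq_contract_apply, contractLeft_apply, Bialgebra.counit_one,
    Finset.sum_eq_zero fun j _ => h2 j] at h1
  exact zero_ne_one h1

variable (k A) in
theorem antipode_bijective : Function.Bijective (antipode k (A := A)) := by
  obtain ⟨f, hf⟩ := exists_traceIntegral_ne_zero (k := k) (A := A)
  have := antipode_injective_of_integral _ hf (traceIntegral_integral f)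
  exact ⟨this, LinearMap.surjective_of_injective this⟩

end Antipode

/-! ### The co-opposite and the dual Hopf algebra -/

section Cop
variable {k A : Type*} [Field k]

/-- The co-opposite `A^cop`: the algebra `A` with the flipped comultiplication. -/
def Cop (A : Type*) : Type _ := A

instance [Ring A] : Ring (Cop A) := inferInstanceAs (Ring A)
instance [Ring A] [Algebra k A] : Algebra k (Cop A) := inferInstanceAs (Algebra k A)

variable (k A) in
/-- The identity map `A → A^cop`. -/
def toCop [Ring A] [Algebra k A] : A ≃ₐ[k] Cop A :=
  AlgEquiv.refl

variable [Ring A] [Bialgebra k A]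

instance : CoalgebraStruct k (Cop A) where
  comul := TensorProduct.map (toCop k A).toLinearMap (toCop k A).toLinearMap ∘ₗ
    (TensorProduct.comm k A A).toLinearMap ∘ₗ comul ∘ₗ (toCop k A).symm.toLinearMap
  counit := counit ∘ₗ (toCop k A).symm.toLinearMap

theorem Cop.comul_apply (a : A) : comul (R := k) (toCop k A a) =
    TensorProduct.map (toCop k A).toLinearMap (toCop k A).toLinearMap
      (TensorProduct.comm k A A (comul a)) := rfl

@[simp] theorem Cop.counit_apply (a : A) : counit (R := k) (toCop k A a) = counit (R := k) a := rfl

instance : Coalgebra k (Cop A) where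
  coassoc := by
    ext a
    obtain ⟨a, rfl⟩ := (toCop k A).surjective a
    let P : A ⊗[k] (A ⊗[k] A) →ₗ[k] Cop A ⊗[k] (Cop A ⊗[k] Cop A) :=
      TensorProduct.map (toCop k A).toLinearMap
        (TensorProduct.map (toCop k A).toLinearMap (toCop k A).toLinearMap) ∘ₗ
      (TensorProduct.assoc k A A A).toLinearMap ∘ₗ
      LinearMap.rTensor A (TensorProduct.comm k A A).toLinearMap ∘ₗ
      (TensorProduct.comm k A (A ⊗[k] A)).toLinearMap
    have h1 : ∀ w : A ⊗[k] A, TensorProduct.assoc k (Cop A) (Cop A) (Cop A)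
        (LinearMap.rTensor (Cop A) comul (TensorProduct.map (toCop k A).toLinearMap
          (toCop k A).toLinearMap (TensorProduct.comm k A A w))) =
        P (LinearMap.lTensor A comul w) := by
      intro w
      induction w with
      | zero => simp
      | add x y hx hy => simp only [map_add, hx, hy]
      | tmul p q =>
        simp only [TensorProduct.comm_tmul, TensorProduct.map_tmul, LinearMap.rTensor_tmul,
          LinearMap.lTensor_tmul, AlgEquiv.toLinearMap_apply, Cop.comul_apply]
        rw [← (ℛ k q).eq]
        simp [P, TensorProduct.sum_tmul, TensorProduct.tmul_sum]
    have h2 : ∀ w : A ⊗[k] A,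
        (LinearMap.lTensor (Cop A) comul (TensorProduct.map (toCop k A).toLinearMap
          (toCop k A).toLinearMap (TensorProduct.comm k A A w))) =
        P (TensorProduct.assoc k A A A (LinearMap.rTensor A comul w)) := by
      intro w
      induction w with
      | zero => simp
      | add x y hx hy => simp only [map_add, hx, hy]
      | tmul p q =>
        simp only [TensorProduct.comm_tmul, TensorProduct.map_tmul, LinearMap.rTensor_tmul,
          LinearMap.lTensor_tmul, AlgEquiv.toLinearMap_apply, Cop.comul_apply]
        rw [← (ℛ k p).eq]
        simp [P, TensorProduct.sum_tmul, TensorProduct.tmul_sum]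
    simp only [LinearMap.comp_apply, LinearEquiv.coe_coe, Cop.comul_apply, h1, h2,
      Coalgebra.coassoc_apply]
  rTensor_counit_comp_comul := by
    ext a
    obtain ⟨a, rfl⟩ := (toCop k A).surjective a
    simp only [LinearMap.comp_apply, Cop.comul_apply]
    have := congrArg (TensorProduct.map LinearMap.id (toCop k A).toLinearMap)
      (congrArg (TensorProduct.comm k A k) (Coalgebra.lTensor_counit_comul (R := k) a))
    rw [← (ℛ k a).eq] at this ⊢
    simpa [-sum_tmul_counit_eq, -sum_counit_tmul_eq] using this
  lTensor_counit_comp_comul := by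
    ext a
    obtain ⟨a, rfl⟩ := (toCop k A).surjective a
    simp only [LinearMap.comp_apply, Cop.comul_apply]
    have := congrArg (TensorProduct.map (toCop k A).toLinearMap LinearMap.id)
      (congrArg (TensorProduct.comm k k A) (Coalgebra.rTensor_counit_comul (R := k) a))
    rw [← (ℛ k a).eq] at this ⊢
    simpa [-sum_tmul_counit_eq, -sum_counit_tmul_eq] using this

instance : Bialgebra k (Cop A) :=
  Bialgebra.mk' k (Cop A)
    (by rw [← map_one (toCop k A), Cop.counit_apply, Bialgebra.counit_one])
    (by
      intro a b
      obtain ⟨a, rfl⟩ := (toCop k A).surjective a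
      obtain ⟨b, rfl⟩ := (toCop k A).surjective b
      rw [← map_mul, Cop.counit_apply, Cop.counit_apply, Cop.counit_apply, Bialgebra.counit_mul])
    (by
      rw [← map_one (toCop k A), Cop.comul_apply, Bialgebra.comul_one]
      simp [Algebra.TensorProduct.one_def])
    (by
      intro a b
      obtain ⟨a, rfl⟩ := (toCop k A).surjective a
      obtain ⟨b, rfl⟩ := (toCop k A).surjective b
      rw [← map_mul, Cop.comul_apply, Cop.comul_apply, Cop.comul_apply, Bialgebra.comul_mul]
      rw [← (ℛ k a).eq, ← (ℛ k b).eq]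
      simp [Finset.sum_mul, Finset.mul_sum])

end Cop

section Dual
variable {k K : Type*} [Field k]

/-- The dual `K*` of a finite-dimensional Hopf algebra: linear forms on `K`, with the convolution
product `(f g)(x) = ∑ f(x₍₁₎) g(x₍₂₎)` and the coproduct dual to the product of `K`. -/
def HopfDual (k K : Type*) [Field k] [AddCommGroup K] [Module k K] : Type _ :=
  WithConv (K →ₗ[k] k)

namespace HopfDual

section Coalg
variable [AddCommGroup K] [Module k K] [Coalgebra k K]

instance : Ring (HopfDual k K) := inferInstanceAs (Ring (WithConv (K →ₗ[k] k)))
instance : Algebra k (HopfDual k K) := inferInstanceAs (Algebra k (WithConv (K →ₗ[k] k)))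

variable (k K) in
/-- The underlying linear forms. -/
def toDual : HopfDual k K ≃ₗ[k] Module.Dual k K := WithConv.linearEquiv k (K →ₗ[k] k)

instance : FunLike (HopfDual k K) K k where
  coe f := toDual k K f
  coe_injective _ _ h := (toDual k K).injective (DFunLike.coe_injective h)

@[ext] theorem ext {f g : HopfDual k K} (h : ∀ x, f x = g x) : f = g := DFunLike.ext _ _ h

@[simp] theorem toDual_apply (f : HopfDual k K) (x : K) : toDual k K f x = f x := rfl
@[simp] theorem toDual_symm_apply (f : Module.Dual k K) (x : K) :
  (toDual k K).symm f x = f x := rfl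
@[simp] theorem zero_apply (x : K) : (0 : HopfDual k K) x = 0 := rfl
@[simp] theorem add_apply (f g : HopfDual k K) (x : K) : (f + g) x = f x + g x := rfl
@[simp] theorem smul_apply (c : k) (f : HopfDual k K) (x : K) : (c • f) x = c * f x := rfl
@[simp] theorem one_apply (x : K) : (1 : HopfDual k K) x = counit (R := k) x := rfl
@[simp] theorem algebraMap_apply (c : k) (x : K) :
    (algebraMap k (HopfDual k K) c) x = c * counit (R := k) x := rfl

/-- `(f g)(x) = ∑ f(x₍₁₎) g(x₍₂₎)` -/
theorem mul_apply {ι : Type*} (f g : HopfDual k K) {x : K} (r : Coalgebra.Repr k x ι) :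
    (f * g) x = ∑ i ∈ r.index, f (r.left i) * g (r.right i) :=
  r.convMul_apply (A := k) f g

end Coalg

section Hopf
variable [Ring K] [HopfAlgebra k K] [FiniteDimensional k K]

variable (k K) in
/-- The canonical isomorphism `K* ⊗ K* ≅ (K ⊗ K)*`. -/
def tensorEquiv : HopfDual k K ⊗[k] HopfDual k K ≃ₗ[k] HopfDual k (K ⊗[k] K) :=
  TensorProduct.congr (toDual k K) (toDual k K) ≪≫ₗ
    TensorProduct.dualDistribEquiv k K K ≪≫ₗ (toDual k (K ⊗[k] K)).symm

@[simp] theorem tensorEquiv_tmul (f g : HopfDual k K) (x y : K) :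
    tensorEquiv k K (f ⊗ₜ g) (x ⊗ₜ y) = f x * g y := by
  simp [tensorEquiv, TensorProduct.dualDistribEquiv, TensorProduct.dualDistribEquivOfBasis]

theorem ext_tensor {u v : HopfDual k (K ⊗[k] K)} (h : ∀ x y, u (x ⊗ₜ y) = v (x ⊗ₜ y)) : u = v :=
  (toDual k _).injective (TensorProduct.ext' h)

instance : CoalgebraStruct k (HopfDual k K) where
  comul := (tensorEquiv k K).symm.toLinearMap ∘ₗ (toDual k (K ⊗[k] K)).symm.toLinearMap ∘ₗ
    Module.Dual.transpose (LinearMap.mul' k K) ∘ₗ (toDual k K).toLinearMap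
  counit := LinearMap.applyₗ 1 ∘ₗ (toDual k K).toLinearMap

/-- The comultiplication of `K*` is dual to the multiplication of `K`. -/
@[simp] theorem tensorEquiv_comul (f : HopfDual k K) (x y : K) :
    tensorEquiv k K (comul f) (x ⊗ₜ y) = f (x * y) := by
  simp [comul]
  rfl

@[simp] theorem counit_apply (f : HopfDual k K) : counit (R := k) f = f 1 := rfl

instance : Coalgebra k (HopfDual k K) where
  coassoc := by
    let E : HopfDual k K ⊗[k] (HopfDual k K ⊗[k] HopfDual k K) ≃ₗ[k]
        Module.Dual k (K ⊗[k] (K ⊗[k] K)) :=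
      TensorProduct.congr (toDual k K) (tensorEquiv k K ≪≫ₗ toDual k (K ⊗[k] K)) ≪≫ₗ
        TensorProduct.dualDistribEquiv k K (K ⊗[k] K)
    have hE : ∀ f w x y, E (f ⊗ₜ w) (x ⊗ₜ y) = f x * tensorEquiv k K w y := by
      intro f w x y
      simp [E, TensorProduct.dualDistribEquiv, TensorProduct.dualDistribEquivOfBasis]
    refine LinearMap.ext fun f => E.injective ?_
    ext x y z
    simp only [LinearMap.comp_apply, LinearEquiv.coe_coe, TensorProduct.AlgebraTensorModule.curry_apply,
      TensorProduct.curry_apply, LinearMap.coe_restrictScalars]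
    have h1 : ∀ w : HopfDual k K ⊗[k] HopfDual k K,
        E (TensorProduct.assoc k _ _ _ (LinearMap.rTensor _ comul w)) (x ⊗ₜ (y ⊗ₜ z)) =
        tensorEquiv k K w ((x * y) ⊗ₜ z) := by
      intro w
      induction w with
      | zero => simp
      | add x y hx hy => simp only [map_add, LinearMap.add_apply, add_apply, hx, hy]
      | tmul f g =>
        have h2 : ∀ u : HopfDual k K ⊗[k] HopfDual k K,
            E (TensorProduct.assoc k _ _ _ (u ⊗ₜ g)) (x ⊗ₜ (y ⊗ₜ z)) =
            tensorEquiv k K u (x ⊗ₜ y) * g z := by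
          intro u
          induction u with
          | zero => simp
          | add x y hx hy =>
            simp only [TensorProduct.add_tmul, map_add, LinearMap.add_apply, add_apply, hx, hy,
              add_mul]
          | tmul f g => simp [hE, mul_assoc]
        simp [h2]
    have h3 : ∀ w : HopfDual k K ⊗[k] HopfDual k K,
        E (LinearMap.lTensor _ comul w) (x ⊗ₜ (y ⊗ₜ z)) =
        tensorEquiv k K w (x ⊗ₜ (y * z)) := by
      intro w
      induction w with
      | zero => simp
      | add x y hx hy => simp only [map_add, LinearMap.add_apply, add_apply, hx, hy]
      | tmul f g => simp [hE]
    rw [h1, h3]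
    simp [mul_assoc]
  rTensor_counit_comp_comul := by
    refine LinearMap.ext fun f => (TensorProduct.lid k _).injective ?_
    have h : ∀ w : HopfDual k K ⊗[k] HopfDual k K, ∀ x,
        TensorProduct.lid k _ (LinearMap.rTensor _ counit w) x =
        tensorEquiv k K w (1 ⊗ₜ x) := by
      intro w x
      induction w with
      | zero => simp
      | add x y hx hy => simp_all
      | tmul f g => simp
    ext x
    simp only [LinearMap.comp_apply, h]
    simp
  lTensor_counit_comp_comul := by
    refine LinearMap.ext fun f => (TensorProduct.rid k _).injective ?_
    have h : ∀ w : HopfDual k K ⊗[k] HopfDual k K, ∀ x,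
        TensorProduct.rid k _ (LinearMap.lTensor _ counit w) x =
        tensorEquiv k K w (x ⊗ₜ 1) := by
      intro w x
      induction w with
      | zero => simp
      | add x y hx hy => simp_all
      | tmul f g => simp [mul_comm]
    ext x
    simp only [LinearMap.comp_apply, h]
    simp

theorem tensorEquiv_mul (u v : HopfDual k K ⊗[k] HopfDual k K) :
    tensorEquiv k K (u * v) = tensorEquiv k K u * tensorEquiv k K v := by
  induction u with
  | zero => simp
  | add x y hx hy => simp only [add_mul, map_add, hx, hy]
  | tmul f g =>
    induction v with
    | zero => simp
    | add x y hx hy => simp only [mul_add, map_add, hx, hy]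
    | tmul f' g' =>
      refine ext_tensor fun x y => ?_
      simp only [Algebra.TensorProduct.tmul_mul_tmul, tensorEquiv_tmul]
      rw [mul_apply _ _ ((ℛ k x).tmul (ℛ k y)), mul_apply _ _ (ℛ k x), mul_apply _ _ (ℛ k y)]
      simp only [Repr.tmul, Finset.sum_product, Finset.sum_mul_sum, tensorEquiv_tmul]
      refine Finset.sum_congr rfl fun i _ => Finset.sum_congr rfl fun j _ => ?_
      ring

instance : Bialgebra k (HopfDual k K) :=
  Bialgebra.mk' k _ (by simp)
    (by
      intro f g
      rw [counit_apply, mul_apply _ _ (⟨{()}, fun _ => 1, fun _ => 1, by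
        simp [Algebra.TensorProduct.one_def]⟩ : Coalgebra.Repr k (1 : K) Unit)]
      simp)
    (by
      apply (tensorEquiv k K).injective
      refine ext_tensor fun x y => ?_
      simp [Algebra.TensorProduct.one_def])
    (by
      intro f g
      apply (tensorEquiv k K).injective
      rw [tensorEquiv_mul]
      refine ext_tensor fun x y => ?_
      rw [tensorEquiv_comul, mul_apply _ _ ((ℛ k x).tmul (ℛ k y)),
        mul_apply _ _ ((ℛ k x).mul (ℛ k y))]
      simp [Repr.tmul, Repr.mul])

/-- The antipode of `K*` is the transpose of the antipode of `K`. -/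
def dualAntipode : HopfDual k K →ₗ[k] HopfDual k K :=
  (toDual k K).symm.toLinearMap ∘ₗ Module.Dual.transpose (antipode k) ∘ₗ (toDual k K).toLinearMap

@[simp] theorem dualAntipode_apply (f : HopfDual k K) (x : K) :
    dualAntipode f x = f (antipode k x) := rfl

instance : HopfAlgebra k (HopfDual k K) where
  antipode := dualAntipode
  mul_antipode_rTensor_comul := by
    have h : ∀ w : HopfDual k K ⊗[k] HopfDual k K, ∀ x,
        (LinearMap.mul' k (HopfDual k K) (LinearMap.rTensor (HopfDual k K) dualAntipode w)) x =
        ∑ i ∈ (ℛ k x).index,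
          tensorEquiv k K w (antipode k ((ℛ k x).left i) ⊗ₜ (ℛ k x).right i) := by
      intro w x
      induction w with
      | zero => simp
      | add x y hx hy => simp only [map_add, add_apply, hx, hy, Finset.sum_add_distrib]
      | tmul f g =>
        simp only [LinearMap.rTensor_tmul, LinearMap.mul'_apply]
        rw [mul_apply _ _ (ℛ k x)]
        simp
    ext f x
    have := congrArg (toDual k K f) (HopfAlgebra.sum_antipode_mul_eq_smul (ℛ k x))
    simp only [LinearMap.comp_apply, h]
    simpa [mul_comm] using this
  mul_antipode_lTensor_comul := by
    have h : ∀ w : HopfDual k K ⊗[k] HopfDual k K, ∀ x,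
        (LinearMap.mul' k (HopfDual k K) (LinearMap.lTensor (HopfDual k K) dualAntipode w)) x =
        ∑ i ∈ (ℛ k x).index,
          tensorEquiv k K w ((ℛ k x).left i ⊗ₜ antipode k ((ℛ k x).right i)) := by
      intro w x
      induction w with
      | zero => simp
      | add x y hx hy => simp only [map_add, add_apply, hx, hy, Finset.sum_add_distrib]
      | tmul f g =>
        simp only [LinearMap.lTensor_tmul, LinearMap.mul'_apply]
        rw [mul_apply _ _ (ℛ k x)]
        simp
    ext f x
    have := congrArg (toDual k K f) (HopfAlgebra.sum_mul_antipode_eq_smul (ℛ k x))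
    simp only [LinearMap.comp_apply, h]
    simpa [mul_comm] using this

instance : FiniteDimensional k (HopfDual k K) := Module.Finite.equiv (toDual k K).symm

end Hopf
end HopfDual

end Dual

/-! ### Convolution and skew pairings -/

section Hit
variable {k C : Type*} [Field k] [AddCommGroup C] [Module k C] [Coalgebra k C]

/-- `x ↦ f(x₍₁₎) x₍₂₎`. -/
def lhit (f : C →ₗ[k] k) : C →ₗ[k] C :=
  (TensorProduct.lid k C).toLinearMap ∘ₗ LinearMap.rTensor C f ∘ₗ comul

/-- `x ↦ x₍₁₎ f(x₍₂₎)`. -/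
def rhit (f : C →ₗ[k] k) : C →ₗ[k] C :=
  (TensorProduct.rid k C).toLinearMap ∘ₗ LinearMap.lTensor C f ∘ₗ comul

theorem lhit_apply {ι : Type*} (f : C →ₗ[k] k) {x : C} (r : Coalgebra.Repr k x ι) :
    lhit f x = ∑ i ∈ r.index, f (r.left i) • r.right i := by
  simp [lhit, ← r.eq]

theorem rhit_apply {ι : Type*} (f : C →ₗ[k] k) {x : C} (r : Coalgebra.Repr k x ι) :
    rhit f x = ∑ i ∈ r.index, f (r.right i) • r.left i := by
  simp [rhit, ← r.eq]

theorem sum_smul_counit {ι : Type*} {x : C} (r : Coalgebra.Repr k x ι) :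
    ∑ i ∈ r.index, counit (R := k) (r.right i) • r.left i = x := by
  simpa only [map_sum, TensorProduct.rid_tmul, one_smul] using
    congrArg (TensorProduct.rid k C) (sum_tmul_counit_eq r)

/-- `lhit` as a linear map in the functional. -/
def lhitLin : (C →ₗ[k] k) →ₗ[k] C →ₗ[k] C where
  toFun f := lhit f
  map_add' f g := by
    ext x
    simp [lhit_apply _ (ℛ k x), add_smul, Finset.sum_add_distrib]
  map_smul' c f := by
    ext x
    simp [lhit_apply _ (ℛ k x), Finset.smul_sum, smul_smul]

/-- `rhit` as a linear map in the functional. -/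
def rhitLin : (C →ₗ[k] k) →ₗ[k] C →ₗ[k] C where
  toFun f := rhit f
  map_add' f g := by
    ext x
    simp [rhit_apply _ (ℛ k x), add_smul, Finset.sum_add_distrib]
  map_smul' c f := by
    ext x
    simp [rhit_apply _ (ℛ k x), Finset.smul_sum, smul_smul]

theorem lhitLin_apply (f : C →ₗ[k] k) : lhitLin f = lhit f := rfl
theorem rhitLin_apply (f : C →ₗ[k] k) : rhitLin f = rhit f := rfl

/-- A presentation of the coproduct of a product. -/
def mulRepr {A : Type*} [Ring A] [Bialgebra k A] {ι κ : Type*} {a b : A}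
    (r : Coalgebra.Repr k a ι) (s : Coalgebra.Repr k b κ) : Coalgebra.Repr k (a * b) (ι × κ) where
  index := r.index ×ˢ s.index
  left i := r.left i.1 * s.left i.2
  right i := r.right i.1 * s.right i.2
  eq := by
    rw [Bialgebra.comul_mul, ← r.eq, ← s.eq]
    simp [Finset.sum_product, Finset.sum_mul_sum]

variable {B : Type*} [Semiring B] [Algebra k B]

/-- The convolution product of two commuting algebra maps. -/
def convAlg {A : Type*} [Ring A] [Bialgebra k A] (f g : A →ₐ[k] B)
    (h : ∀ x y, Commute (f x) (g y)) : A →ₐ[k] B :=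
  (Algebra.TensorProduct.lift f g h).comp (Bialgebra.comulAlgHom k A)

theorem convAlg_apply {A : Type*} [Ring A] [Bialgebra k A] (f g : A →ₐ[k] B)
    (h : ∀ x y, Commute (f x) (g y)) {ι : Type*} {x : A} (r : Coalgebra.Repr k x ι) :
    convAlg f g h x = ∑ i ∈ r.index, f (r.left i) * g (r.right i) := by
  simp [convAlg, ← r.eq]

/-- A functional regarded as a `B`-valued map. -/
def scal (f : C →ₗ[k] k) : WithConv (C →ₗ[k] B) := toConv (Algebra.linearMap k B ∘ₗ f)

theorem scal_mul_eq (f : C →ₗ[k] k) (F : C →ₗ[k] B) :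
    (scal f * toConv F : WithConv (C →ₗ[k] B)) = toConv (F ∘ₗ lhit f) := by
  ext x
  simp [(ℛ k x).convMul_apply, scal, lhit_apply f (ℛ k x), Algebra.smul_def]

theorem mul_scal_eq (f : C →ₗ[k] k) (F : C →ₗ[k] B) :
    (toConv F * scal f : WithConv (C →ₗ[k] B)) = toConv (F ∘ₗ rhit f) := by
  ext x
  simp [(ℛ k x).convMul_apply, scal, rhit_apply f (ℛ k x), Algebra.smul_def, Algebra.commutes]

theorem scal_mul_scal {f g : C →ₗ[k] k} (h : (toConv f * toConv g : WithConv (C →ₗ[k] k)) = 1) :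
    (scal f * scal g : WithConv (C →ₗ[k] B)) = 1 := by
  have h2 := LinearMap.algHom_comp_convMul_distrib (Algebra.ofId k B) (toConv f) (toConv g)
  rw [h] at h2
  apply WithConv.ext
  exact h2.symm.trans (by ext x; simp)

theorem lhit_one : lhit (counit : C →ₗ[k] k) = LinearMap.id := by
  ext x; simp [lhit_apply _ (ℛ k x), sum_counit_smul]

theorem rhit_one : rhit (counit : C →ₗ[k] k) = LinearMap.id := by
  ext x; simp [rhit]

theorem lhit_lhit (f g : C →ₗ[k] k) :
    lhit f ∘ₗ lhit g = lhit (toConv g * toConv f : WithConv (C →ₗ[k] k)).ofConv := by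
  have h : ∀ w : C ⊗[k] C, lhit f (TensorProduct.lid k C (LinearMap.rTensor C g w)) =
    (TensorProduct.lid k C).toLinearMap (LinearMap.rTensor C (LinearMap.mul' k k ∘ₗ TensorProduct.map g f)
      ((TensorProduct.assoc k C C C).symm (LinearMap.lTensor C comul w))) := by
    intro w
    induction w with
    | zero => simp
    | add x y hx hy => simp only [map_add, hx, hy]
    | tmul p q =>
      simp only [LinearMap.rTensor_tmul, TensorProduct.lid_tmul, map_smul, LinearMap.lTensor_tmul]
      rw [lhit_apply f (ℛ k q), ← (ℛ k q).eq]
      simp [TensorProduct.tmul_sum, Finset.smul_sum, smul_smul]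
  ext x
  have h2 := h (comul x)
  rw [Coalgebra.coassoc_symm_apply] at h2
  rw [LinearMap.comp_apply]
  refine h2.trans ?_
  rw [← LinearMap.rTensor_comp_apply]
  rfl

theorem rhit_rhit (f g : C →ₗ[k] k) :
    rhit f ∘ₗ rhit g = rhit (toConv f * toConv g : WithConv (C →ₗ[k] k)).ofConv := by
  have h : ∀ w : C ⊗[k] C, rhit f (TensorProduct.rid k C (LinearMap.lTensor C g w)) =
    (TensorProduct.rid k C).toLinearMap (LinearMap.lTensor C (LinearMap.mul' k k ∘ₗ TensorProduct.map f g)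
      ((TensorProduct.assoc k C C C) (LinearMap.rTensor C comul w))) := by
    intro w
    induction w with
    | zero => simp
    | add x y hx hy => simp only [map_add, hx, hy]
    | tmul p q =>
      simp only [LinearMap.rTensor_tmul, TensorProduct.rid_tmul, map_smul, LinearMap.lTensor_tmul]
      rw [rhit_apply f (ℛ k p), ← (ℛ k p).eq]
      simp [TensorProduct.sum_tmul, Finset.smul_sum, smul_smul, mul_comm]
  ext x
  have h2 := h (comul x)
  rw [Coalgebra.coassoc_apply] at h2
  rw [LinearMap.comp_apply]
  refine h2.trans ?_
  rw [← LinearMap.lTensor_comp_apply]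
  rfl

theorem lhit_rhit (f g : C →ₗ[k] k) : lhit f ∘ₗ rhit g = rhit g ∘ₗ lhit f := by
  have h : ∀ w : C ⊗[k] C, lhit f (TensorProduct.rid k C (LinearMap.lTensor C g w)) =
    (TensorProduct.lid k C).toLinearMap (TensorProduct.map f ((TensorProduct.rid k C).toLinearMap ∘ₗ
      LinearMap.lTensor C g)
      ((TensorProduct.assoc k C C C) (LinearMap.rTensor C comul w))) := by
    intro w
    induction w with
    | zero => simp
    | add x y hx hy => simp only [map_add, hx, hy]
    | tmul p q =>
      simp only [LinearMap.rTensor_tmul, TensorProduct.rid_tmul, map_smul, LinearMap.lTensor_tmul]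
      rw [lhit_apply f (ℛ k p), ← (ℛ k p).eq]
      simp [TensorProduct.sum_tmul, Finset.smul_sum, smul_smul, mul_comm]
  have h' : ∀ w : C ⊗[k] C, rhit g (TensorProduct.lid k C (LinearMap.rTensor C f w)) =
    (TensorProduct.lid k C).toLinearMap (TensorProduct.map f ((TensorProduct.rid k C).toLinearMap ∘ₗ
      LinearMap.lTensor C g) (LinearMap.lTensor C comul w)) := by
    intro w
    induction w with
    | zero => simp
    | add x y hx hy => simp only [map_add, hx, hy]
    | tmul p q =>
      simp only [LinearMap.rTensor_tmul, TensorProduct.lid_tmul, map_smul, LinearMap.lTensor_tmul]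
      rw [rhit_apply g (ℛ k q), ← (ℛ k q).eq]
      simp [TensorProduct.tmul_sum, Finset.smul_sum, smul_smul, mul_comm]
  ext x
  have h2 := h (comul x)
  rw [Coalgebra.coassoc_apply] at h2
  exact h2.trans (h' (comul x)).symm

end Hit

section Tensor
/-! Convolution on `P ⊗ H`. -/
variable {k P H B : Type*} [Field k] [Ring P] [Bialgebra k P]
  [Ring H] [Bialgebra k H] [Semiring B] [Algebra k B]

/-- `b ⊗ h ↦ ε(h) c(b)` -/
def convL (c : P →ₗ[k] B) : WithConv (P ⊗[k] H →ₗ[k] B) :=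
  toConv (c ∘ₗ (TensorProduct.rid k P).toLinearMap ∘ₗ LinearMap.lTensor P counit)

/-- `b ⊗ h ↦ ε(b) u(h)` -/
def convR (u : H →ₗ[k] B) : WithConv (P ⊗[k] H →ₗ[k] B) :=
  toConv (u ∘ₗ (TensorProduct.lid k H).toLinearMap ∘ₗ LinearMap.rTensor H counit)

@[simp] theorem convL_apply (c : P →ₗ[k] B) (b : P) (h : H) :
    (convL c : WithConv (P ⊗[k] H →ₗ[k] B)) (b ⊗ₜ h) = counit (R := k) h • c b := by
  simp [convL]

@[simp] theorem convR_apply (u : H →ₗ[k] B) (b : P) (h : H) :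
    (convR u : WithConv (P ⊗[k] H →ₗ[k] B)) (b ⊗ₜ h) = counit (R := k) b • u h := by
  simp [convR]

theorem convL_mul_apply (c : P →ₗ[k] B) (F : WithConv (P ⊗[k] H →ₗ[k] B)) (b : P) (h : H)
    {ι : Type*} (r : Coalgebra.Repr k b ι) :
    (convL c * F : WithConv (P ⊗[k] H →ₗ[k] B)) (b ⊗ₜ h) = ∑ i ∈ r.index, c (r.left i) * F (r.right i ⊗ₜ h) := by
  rw [(r.tmul (ℛ k h)).convMul_apply]
  simp only [Repr.tmul, Finset.sum_product, convL_apply]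
  refine Finset.sum_congr rfl fun i _ => ?_
  conv_rhs => rw [← sum_counit_smul (ℛ k h)]
  simp [TensorProduct.tmul_sum, Finset.mul_sum]

theorem mul_convR_apply (u : H →ₗ[k] B) (F : WithConv (P ⊗[k] H →ₗ[k] B)) (b : P) (h : H)
    {ι : Type*} (r : Coalgebra.Repr k h ι) :
    (F * convR u : WithConv (P ⊗[k] H →ₗ[k] B)) (b ⊗ₜ h) = ∑ i ∈ r.index, F (b ⊗ₜ r.left i) * u (r.right i) := by
  rw [((ℛ k b).tmul r).convMul_apply]
  simp only [Repr.tmul, Finset.sum_product_right, convR_apply]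
  refine Finset.sum_congr rfl fun i _ => ?_
  conv_rhs => rw [← sum_smul_counit (ℛ k b)]
  simp [TensorProduct.sum_tmul, Finset.sum_mul, ← TensorProduct.smul_tmul']

theorem convL_mul_convR_apply (c : P →ₗ[k] B) (u : H →ₗ[k] B) (b : P) (h : H) :
    (convL c * convR u : WithConv (P ⊗[k] H →ₗ[k] B)) (b ⊗ₜ h) = c b * u h := by
  rw [convL_mul_apply _ _ _ _ (ℛ k b)]
  conv_rhs => rw [← sum_smul_counit (ℛ k b)]
  simp [Finset.sum_mul]

theorem convR_mul_convL_apply (c : P →ₗ[k] B) (u : H →ₗ[k] B) (b : P) (h : H) :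
    (convR u * convL c : WithConv (P ⊗[k] H →ₗ[k] B)) (b ⊗ₜ h) = u h * c b := by
  rw [((ℛ k b).tmul (ℛ k h)).convMul_apply]
  simp only [Repr.tmul, Finset.sum_product, convL_apply, convR_apply]
  conv_rhs => rw [← sum_counit_smul (ℛ k b)]
  conv_rhs => rw [← sum_smul_counit (ℛ k h)]
  simp only [map_sum, map_smul, Finset.sum_mul, Finset.mul_sum, smul_mul_assoc, mul_smul_comm,
    smul_smul, Finset.smul_sum]
  refine Finset.sum_congr rfl fun i _ => ?_
  refine Finset.sum_congr rfl fun j _ => ?_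
  congr 1
  exact mul_comm _ _

theorem conv_comm {c : P →ₗ[k] B} {u : H →ₗ[k] B} (h : ∀ b x, u x * c b = c b * u x) :
    (convR u * convL c : WithConv (P ⊗[k] H →ₗ[k] B)) = convL c * convR u := by
  apply WithConv.ext
  apply TensorProduct.ext'
  intro b x
  rw [convR_mul_convL_apply, convL_mul_convR_apply, h]

theorem convL_mul (c d : WithConv (P →ₗ[k] B)) :
    (convL (c * d).ofConv : WithConv (P ⊗[k] H →ₗ[k] B)) = convL c.ofConv * convL d.ofConv := by
  apply WithConv.ext
  apply TensorProduct.ext'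
  intro b x
  rw [convL_mul_apply _ _ _ _ (ℛ k b)]
  simp [(ℛ k b).convMul_apply, Finset.smul_sum]

theorem convR_mul (c d : WithConv (H →ₗ[k] B)) :
    (convR (c * d).ofConv : WithConv (P ⊗[k] H →ₗ[k] B)) = convR c.ofConv * convR d.ofConv := by
  apply WithConv.ext
  apply TensorProduct.ext'
  intro b x
  rw [mul_convR_apply _ _ _ _ (ℛ k x)]
  simp [(ℛ k x).convMul_apply, Finset.smul_sum]

theorem convL_one : (convL (1 : WithConv (P →ₗ[k] B)).ofConv : WithConv (P ⊗[k] H →ₗ[k] B)) = 1 := by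
  apply WithConv.ext
  apply TensorProduct.ext'
  intro b x
  simp [Algebra.smul_def]

theorem convR_one : (convR (1 : WithConv (H →ₗ[k] B)).ofConv : WithConv (P ⊗[k] H →ₗ[k] B)) = 1 := by
  apply WithConv.ext
  apply TensorProduct.ext'
  intro b x
  simp [Algebra.smul_def, ← map_mul, mul_comm]

end Tensor

section Skew

/-- A skew pairing `P ⊗ H → k`: a bilinear form `τ` with `τ(1, h) = ε(h)`, `τ(a, 1) = ε(a)`,
`τ(a b, h) = ∑ τ(a, h₍₁₎) τ(b, h₍₂₎)` and `τ(a, h g) = ∑ τ(a₍₁₎, g) τ(a₍₂₎, h)`. -/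
structure SkewPairing (k P H : Type*) [Field k] [Ring P] [Bialgebra k P] [Ring H]
    [Bialgebra k H] where
  /-- The bilinear form. -/
  toLin : P →ₗ[k] H →ₗ[k] k
  map_one_left : ∀ h, toLin 1 h = counit h
  map_one_right : ∀ b, toLin b 1 = counit b
  map_mul_left : ∀ a b h, toLin (a * b) h =
    TensorProduct.dualDistrib k H H (toLin a ⊗ₜ toLin b) (comul h)
  map_mul_right : ∀ a h g, toLin a (h * g) =
    TensorProduct.dualDistrib k P P (toLin.flip g ⊗ₜ toLin.flip h) (comul a)

variable {k P H : Type*} [Field k] [Ring P] [HopfAlgebra k P] [Ring H] [HopfAlgebra k H]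

namespace SkewPairing
variable (τ : SkewPairing k P H)

/-- `b ⊗ h ↦ τ(b, h)` -/
def form : P ⊗[k] H →ₗ[k] k := TensorProduct.lift τ.toLin

/-- `b ⊗ h ↦ τ(S b, h)` -/
def formInv : P ⊗[k] H →ₗ[k] k := TensorProduct.lift (τ.toLin ∘ₗ antipode k)

@[simp] theorem form_tmul (b : P) (h : H) : τ.form (b ⊗ₜ h) = τ.toLin b h := by simp [form]
@[simp] theorem formInv_tmul (b : P) (h : H) :
    τ.formInv (b ⊗ₜ h) = τ.toLin (antipode k b) h := by simp [formInv]

theorem mul_left_apply {ι : Type*} (a b : P) {h : H} (r : Coalgebra.Repr k h ι) :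
    τ.toLin (a * b) h = ∑ i ∈ r.index, τ.toLin a (r.left i) * τ.toLin b (r.right i) := by
  simp [τ.map_mul_left, ← r.eq]

theorem mul_right_apply {ι : Type*} {a : P} (g h : H) (r : Coalgebra.Repr k a ι) :
    τ.toLin a (h * g) = ∑ i ∈ r.index, τ.toLin (r.left i) g * τ.toLin (r.right i) h := by
  simp [τ.map_mul_right, ← r.eq]

theorem form_mul_formInv :
    (toConv τ.form * toConv τ.formInv : WithConv (P ⊗[k] H →ₗ[k] k)) = 1 := by
  apply WithConv.ext
  apply TensorProduct.ext'
  intro b h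
  rw [((ℛ k b).tmul (ℛ k h)).convMul_apply]
  have := congrArg (fun x => τ.toLin x h) (sum_mul_antipode_eq_smul (ℛ k b))
  simp only [map_sum, LinearMap.sum_apply, τ.mul_left_apply _ _ (ℛ k h), map_smul,
    LinearMap.smul_apply, τ.map_one_left] at this
  simpa [Repr.tmul, Finset.sum_product, mul_comm] using this

theorem formInv_mul_form :
    (toConv τ.formInv * toConv τ.form : WithConv (P ⊗[k] H →ₗ[k] k)) = 1 := by
  apply WithConv.ext
  apply TensorProduct.ext'
  intro b h
  rw [((ℛ k b).tmul (ℛ k h)).convMul_apply]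
  have := congrArg (fun x => τ.toLin x h) (sum_antipode_mul_eq_smul (ℛ k b))
  simp only [map_sum, LinearMap.sum_apply, τ.mul_left_apply _ _ (ℛ k h), map_smul,
    LinearMap.smul_apply, τ.map_one_left] at this
  simpa [Repr.tmul, Finset.sum_product, mul_comm] using this

/-- `b ⊗ h ↦ τ(b₍₁₎, h₍₁₎) (b₍₂₎ ⊗ h₍₂₎) τ(S b₍₃₎, h₍₃₎)` -/
def straighten : P ⊗[k] H →ₗ[k] P ⊗[k] H := lhit τ.form ∘ₗ rhit τ.formInv

theorem comp_straighten {B : Type*} [Semiring B] [Algebra k B] (F : P ⊗[k] H →ₗ[k] B) :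
    toConv (F ∘ₗ τ.straighten) = (scal τ.form * toConv F * scal τ.formInv : WithConv _) := by
  rw [scal_mul_eq, mul_scal_eq, straighten, LinearMap.comp_assoc]

theorem lhit_mul (h g : H) : lhit (τ.toLin.flip (h * g)) =
    lhit (τ.toLin.flip h) ∘ₗ lhit (τ.toLin.flip g) := by
  rw [lhit_lhit]
  congr 1
  ext b
  rw [(ℛ k b).convMul_apply]
  simp [τ.mul_right_apply _ _ (ℛ k b)]

theorem rhit_mul (h g : H) : rhit (τ.toLin.flip (h * g) ∘ₗ antipode k) =
    rhit (τ.toLin.flip h ∘ₗ antipode k) ∘ₗ rhit (τ.toLin.flip g ∘ₗ antipode k) := by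
  rw [rhit_rhit]
  congr 1
  ext b
  rw [(ℛ k b).convMul_apply]
  have h2 := LinearMap.congr_fun (comul_antipode (k := k) (A := P)) b
  simp only [LinearMap.comp_apply] at h2
  simp only [LinearMap.comp_apply, LinearMap.flip_apply, τ.map_mul_right, h2]
  rw [← (ℛ k b).eq]
  simp [mul_comm]

/-- `h ↦ (b ↦ τ(b₍₁₎, h) b₍₂₎)`, an action of `H` on `P`. -/
def leftHit : H →ₐ[k] Module.End k P :=
  AlgHom.ofLinearMap (lhitLin ∘ₗ τ.toLin.flip)
    (by
      have : τ.toLin.flip 1 = counit := by ext b; simp [τ.map_one_right]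
      simp only [LinearMap.comp_apply, lhitLin_apply, this, lhit_one]; rfl)
    (τ.lhit_mul)

/-- `h ↦ (b ↦ b₍₁₎ τ(S b₍₂₎, h))`, an action of `H` on `P`. -/
def rightHit : H →ₐ[k] Module.End k P :=
  AlgHom.ofLinearMap (rhitLin ∘ₗ (LinearMap.lcomp k k (antipode k)) ∘ₗ τ.toLin.flip)
    (by
      have : τ.toLin.flip 1 ∘ₗ antipode k = counit := by ext b; simp [τ.map_one_right]
      simp only [LinearMap.comp_apply, rhitLin_apply, LinearMap.lcomp_apply', this, rhit_one]; rfl)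
    (τ.rhit_mul)

theorem hit_comm (h g : H) : Commute (τ.leftHit h) (τ.rightHit g) := lhit_rhit _ _

end SkewPairing
end Skew

/-! ### The double of two skew-paired Hopf algebras -/

section Double
variable {k P H : Type*} [Field k] [Ring P] [HopfAlgebra k P] [Ring H] [HopfAlgebra k H]

namespace SkewPairing
variable (τ : SkewPairing k P H)

theorem leftHit_mul (h : H) (b x : P) : τ.leftHit h (b * x) =
    ∑ i ∈ (ℛ k b).index, ∑ j ∈ (ℛ k h).index, τ.toLin ((ℛ k b).left i) ((ℛ k h).left j) •
      ((ℛ k b).right i * τ.leftHit ((ℛ k h).right j) x) := by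
  have e : ∀ h y, τ.leftHit h y = lhit (τ.toLin.flip h) y := fun _ _ => rfl
  simp only [e]
  rw [lhit_apply _ (mulRepr (ℛ k b) (ℛ k x))]
  simp only [mulRepr, Finset.sum_product, LinearMap.flip_apply, lhit_apply _ (ℛ k x),
    τ.mul_left_apply _ _ (ℛ k h), Finset.mul_sum, Finset.smul_sum, Finset.sum_smul, mul_smul_comm,
    smul_smul]
  refine Finset.sum_congr rfl fun i _ => ?_
  rw [Finset.sum_comm]

theorem rightHit_mul (h : H) (b x : P) : τ.rightHit h (b * x) =
    ∑ i ∈ (ℛ k b).index, ∑ j ∈ (ℛ k h).index,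
      τ.toLin (antipode k ((ℛ k b).right i)) ((ℛ k h).right j) •
      ((ℛ k b).left i * τ.rightHit ((ℛ k h).left j) x) := by
  have e : ∀ h y, τ.rightHit h y = rhit (τ.toLin.flip h ∘ₗ antipode k) y := fun _ _ => rfl
  simp only [e]
  rw [rhit_apply _ (mulRepr (ℛ k b) (ℛ k x))]
  simp only [mulRepr, Finset.sum_product, LinearMap.flip_apply, rhit_apply _ (ℛ k x),
    LinearMap.comp_apply, HopfAlgebra.antipode_mul_antidistrib,
    τ.mul_left_apply _ _ (ℛ k h), Finset.mul_sum, Finset.smul_sum, Finset.sum_smul, mul_smul_comm,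
    smul_smul]
  refine Finset.sum_congr rfl fun i _ => ?_
  rw [Finset.sum_comm]
  simp only [mul_comm]

/-- The map `straighten` written out in terms of presentations of the iterated coproducts. -/
theorem straighten_tmul {ι κ : Type*} {ι' : ι → Type*} {κ' : κ → Type*} {b : P} {h : H}
    (r : Coalgebra.Repr k b ι) (s : Coalgebra.Repr k h κ)
    (r' : ∀ i, Coalgebra.Repr k (r.left i) (ι' i)) (s' : ∀ j, Coalgebra.Repr k (s.left j) (κ' j)) :
    τ.straighten (b ⊗ₜ h) = ∑ i ∈ r.index, ∑ j ∈ s.index, ∑ p ∈ (r' i).index, ∑ q ∈ (s' j).index,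
      (τ.toLin ((r' i).left p) ((s' j).left q) * τ.toLin (antipode k (r.right i)) (s.right j)) •
        ((r' i).right p ⊗ₜ (s' j).right q) := by
  rw [straighten, LinearMap.comp_apply, rhit_apply _ (r.tmul s), map_sum]
  simp only [Repr.tmul, Finset.sum_product, map_smul, formInv_tmul]
  refine Finset.sum_congr rfl fun i _ => ?_
  refine Finset.sum_congr rfl fun j _ => ?_
  rw [lhit_apply _ ((r' i).tmul (s' j))]
  simp only [Repr.tmul, Finset.sum_product, Finset.smul_sum, smul_smul, form_tmul, mul_comm]

section Exchange
variable {B : Type*} [Semiring B] [Algebra k B]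

/-- The map `a ⊗ h ↦ c(a) u(h)`. -/
def glue (c : P →ₗ[k] B) (u : H →ₗ[k] B) : P ⊗[k] H →ₗ[k] B :=
  TensorProduct.lift ((LinearMap.mul k B).compl₁₂ c u)

@[simp] theorem glue_tmul (c : P →ₗ[k] B) (u : H →ₗ[k] B) (b : P) (h : H) :
    glue c u (b ⊗ₜ h) = c b * u h := rfl

theorem convL_mul_convR (c : P →ₗ[k] B) (u : H →ₗ[k] B) :
    (convL c * convR u : WithConv (P ⊗[k] H →ₗ[k] B)) = toConv (glue c u) := by
  apply WithConv.ext
  apply TensorProduct.ext'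
  intro b h
  rw [convL_mul_convR_apply]
  rfl

/-- The exchange relation `u(h) c(b) = ∑ τ(b₍₁₎, h₍₁₎) c(b₍₂₎) u(h₍₂₎) τ(S b₍₃₎, h₍₃₎)` between
two maps `c : P → B` and `u : H → B`. -/
def Exchange (c : P →ₗ[k] B) (u : H →ₗ[k] B) : Prop :=
  (convR u * convL c : WithConv (P ⊗[k] H →ₗ[k] B)) =
    scal τ.form * (convL c * convR u) * scal τ.formInv

theorem scal_cancel : (scal τ.formInv * scal τ.form : WithConv (P ⊗[k] H →ₗ[k] B)) = 1 :=
  scal_mul_scal τ.formInv_mul_form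

theorem exchange_apply {c : P →ₗ[k] B} {u : H →ₗ[k] B} (hcu : τ.Exchange c u) (b : P) (h : H) :
    u h * c b = (convL c * convR u : WithConv (P ⊗[k] H →ₗ[k] B)).ofConv
      (τ.straighten (b ⊗ₜ h)) := by
  have h1 := hcu
  rw [Exchange, ← toConv_ofConv (convL c * convR u), ← comp_straighten] at h1
  rw [← convR_mul_convL_apply, h1]
  rfl

theorem exchange_leftHit (φ : Module.End k P →ₐ[k] B) :
    (convR (φ.toLinearMap ∘ₗ τ.leftHit.toLinearMap) *
      convL (φ.toLinearMap ∘ₗ (Algebra.lmul k P).toLinearMap) : WithConv (P ⊗[k] H →ₗ[k] B)) =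
    scal τ.form * (convL (φ.toLinearMap ∘ₗ (Algebra.lmul k P).toLinearMap) *
      convR (φ.toLinearMap ∘ₗ τ.leftHit.toLinearMap)) := by
  rw [convL_mul_convR, scal_mul_eq]
  apply WithConv.ext
  apply TensorProduct.ext'
  intro b h
  rw [convR_mul_convL_apply, ofConv_toConv]
  refine Eq.trans ?_ (LinearMap.comp_apply _ _ _).symm
  rw [lhit_apply _ ((ℛ k b).tmul (ℛ k h)), map_sum]
  simp only [Repr.tmul, Finset.sum_product, map_smul, LinearMap.comp_apply,
    AlgHom.toLinearMap_apply, form_tmul]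
  have e : τ.leftHit h * Algebra.lmul k P b = ∑ i ∈ (ℛ k b).index, ∑ j ∈ (ℛ k h).index,
      τ.toLin ((ℛ k b).left i) ((ℛ k h).left j) •
      (Algebra.lmul k P ((ℛ k b).right i) * τ.leftHit ((ℛ k h).right j)) := by
    ext x
    simpa using τ.leftHit_mul h b x
  rw [← map_mul, e]
  simp only [map_sum, map_smul, map_mul]
  refine Finset.sum_congr rfl fun i _ => ?_
  refine Finset.sum_congr rfl fun j _ => ?_
  congr 1

theorem exchange_rightHit (φ : Module.End k P →ₐ[k] B) :
    (convR (φ.toLinearMap ∘ₗ τ.rightHit.toLinearMap) *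
      convL (φ.toLinearMap ∘ₗ (Algebra.lmul k P).toLinearMap) : WithConv (P ⊗[k] H →ₗ[k] B)) =
    convL (φ.toLinearMap ∘ₗ (Algebra.lmul k P).toLinearMap) *
      convR (φ.toLinearMap ∘ₗ τ.rightHit.toLinearMap) * scal τ.formInv := by
  rw [convL_mul_convR, mul_scal_eq]
  apply WithConv.ext
  apply TensorProduct.ext'
  intro b h
  rw [convR_mul_convL_apply, ofConv_toConv]
  refine Eq.trans ?_ (LinearMap.comp_apply _ _ _).symm
  rw [rhit_apply _ ((ℛ k b).tmul (ℛ k h)), map_sum]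
  simp only [Repr.tmul, Finset.sum_product, map_smul, LinearMap.comp_apply,
    AlgHom.toLinearMap_apply, formInv_tmul]
  have e : τ.rightHit h * Algebra.lmul k P b = ∑ i ∈ (ℛ k b).index, ∑ j ∈ (ℛ k h).index,
      τ.toLin (antipode k ((ℛ k b).right i)) ((ℛ k h).right j) •
      (Algebra.lmul k P ((ℛ k b).left i) * τ.rightHit ((ℛ k h).left j)) := by
    ext x
    simpa using τ.rightHit_mul h b x
  rw [← map_mul, e]
  simp only [map_sum, map_smul, map_mul]
  refine Finset.sum_congr rfl fun i _ => ?_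
  refine Finset.sum_congr rfl fun j _ => ?_
  congr 1

end Exchange

section Act
variable (V : Type*) [AddCommGroup V] [Module k V] [Module H V] [IsScalarTower k H V]

/-- Endomorphisms of `P` acting on `P ⊗ V`. -/
def onLeft (V : Type*) [AddCommGroup V] [Module k V] :
    Module.End k P →ₐ[k] Module.End k (P ⊗[k] V) := Module.End.rTensorAlgHom k P V

/-- Endomorphisms of `V` acting on `P ⊗ V`. -/
def onRight (V : Type*) [AddCommGroup V] [Module k V] :
    Module.End k V →ₐ[k] Module.End k (P ⊗[k] V) := Module.End.lTensorAlgHom k V P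

@[simp] theorem onLeft_tmul (V : Type*) [AddCommGroup V] [Module k V] (f : Module.End k P)
    (b : P) (v : V) : onLeft V f (b ⊗ₜ v) = f b ⊗ₜ v := rfl

@[simp] theorem onRight_tmul (V : Type*) [AddCommGroup V] [Module k V] (f : Module.End k V)
    (b : P) (v : V) : onRight V f (b ⊗ₜ v) = b ⊗ₜ f v := rfl

/-- `P` acts on `P ⊗ V` by left multiplication on `P`. -/
def actL : P →ₐ[k] Module.End k (P ⊗[k] V) :=
  (onLeft V).comp (Algebra.lmul k P)

theorem act_commute (x y : H) : Commute ((onRight (P := P) V).comp (Algebra.lsmul k k V) x)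
    ((onLeft V).comp τ.rightHit y) :=
  TensorProduct.ext' fun b v => by simp

/-- Two of the three commuting actions of `H` on `P ⊗ V`. -/
def actMid : H →ₐ[k] Module.End k (P ⊗[k] V) :=
  convAlg ((onRight V).comp (Algebra.lsmul k k V)) ((onLeft V).comp τ.rightHit) (τ.act_commute V)

theorem act_commute_mid (x y : H) : Commute ((onLeft V).comp τ.leftHit x) (τ.actMid V y) := by
  rw [actMid, convAlg_apply _ _ _ (ℛ k y)]
  refine Commute.sum_right _ _ _ fun i _ => ?_
  refine TensorProduct.ext' fun b v => ?_
  have := LinearMap.congr_fun (τ.hit_comm x ((ℛ k y).right i)) b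
  simp only [Module.End.mul_apply] at this
  simp [this]

/-- `H` acts on `P ⊗ V` by
`h (b ⊗ v) = ∑ τ(b₍₁₎, h₍₁₎) (b₍₂₎ ⊗ h₍₂₎ v) τ(S b₍₃₎, h₍₃₎)`,
the product of three commuting actions of `H`. -/
def actR : H →ₐ[k] Module.End k (P ⊗[k] V) :=
  convAlg ((onLeft V).comp τ.leftHit) (τ.actMid V) (τ.act_commute_mid V)

@[simp] theorem actL_tmul (a b : P) (v : V) :
    actL (k := k) V a (b ⊗ₜ v) = (a * b) ⊗ₜ v := by
  simp [actL]

theorem actR_eq (h : H) : τ.actR V h = ∑ i ∈ (ℛ k h).index,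
    onLeft V (τ.leftHit ((ℛ k h).left i)) *
      ∑ j ∈ (ℛ k ((ℛ k h).right i)).index,
        onRight V (Algebra.lsmul k k V ((ℛ k ((ℛ k h).right i)).left j)) *
        onLeft V (τ.rightHit ((ℛ k ((ℛ k h).right i)).right j)) := by
  rw [actR, convAlg_apply _ _ _ (ℛ k h)]
  refine Finset.sum_congr rfl fun i _ => ?_
  rw [actMid, convAlg_apply _ _ _ (ℛ k _)]
  rfl

theorem toConv_actR : (toConv (τ.actR V).toLinearMap : WithConv (H →ₗ[k] _)) =
    toConv ((onLeft V).toLinearMap ∘ₗ τ.leftHit.toLinearMap) *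
      (toConv ((onRight V).toLinearMap ∘ₗ (Algebra.lsmul k k V).toLinearMap) *
        toConv ((onLeft V).toLinearMap ∘ₗ τ.rightHit.toLinearMap)) := by
  ext1
  refine LinearMap.ext fun h => ?_
  rw [(ℛ k h).convMul_apply]
  simp only [(ℛ k _).convMul_apply]
  exact τ.actR_eq V h

theorem exchange_act : τ.Exchange (actL V).toLinearMap (τ.actR V).toLinearMap := by
  have h := τ.toConv_actR V
  have h1 := exchange_leftHit τ (onLeft V)
  have h3 := exchange_rightHit τ (onLeft V)
  set S := (onLeft (P := P) V).toLinearMap ∘ₗ τ.leftHit.toLinearMap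
  set R := (onRight (P := P) V).toLinearMap ∘ₗ (Algebra.lsmul k k (A := H) V).toLinearMap with hR
  set T := (onLeft V).toLinearMap ∘ₗ τ.rightHit.toLinearMap
  have hL : (actL (k := k) (P := P) V).toLinearMap =
    (onLeft V).toLinearMap ∘ₗ (Algebra.lmul k P).toLinearMap := rfl
  rw [← hL] at h1 h3
  set L := (actL (k := k) (P := P) V).toLinearMap with hL'
  have h2 : (convR R * convL L : WithConv (P ⊗[k] H →ₗ[k] _)) = convL L * convR R := by
    apply conv_comm
    intro b x
    refine TensorProduct.ext' fun b v => ?_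
    simp [hL', hR]
  have hT : (τ.actR V).toLinearMap = (toConv S * (toConv R * toConv T)).ofConv := by
    rw [← h]
  rw [Exchange, hT, convR_mul, ← toConv_ofConv (toConv R * toConv T), ofConv_toConv, convR_mul]
  simp only [ofConv_toConv]
  simp only [mul_assoc] at h1 h2 h3 ⊢
  rw [h3, ← mul_assoc (convR R), h2]
  simp only [mul_assoc]
  rw [← mul_assoc (convR S), h1]
  simp only [mul_assoc]

theorem actR_one_tmul (h : H) (v : V) : τ.actR V h (1 ⊗ₜ v) = 1 ⊗ₜ (h • v) := by
  have e1 : ∀ g, τ.leftHit g 1 = counit (R := k) g • 1 := by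
    intro g
    have : τ.leftHit g 1 = lhit (τ.toLin.flip g) 1 := rfl
    rw [this, lhit]
    simp [Algebra.TensorProduct.one_def, τ.map_one_left]
  have e2 : ∀ g, τ.rightHit g 1 = counit (R := k) g • 1 := by
    intro g
    have : τ.rightHit g 1 = rhit (τ.toLin.flip g ∘ₗ antipode k) 1 := rfl
    rw [this, rhit]
    simp [Algebra.TensorProduct.one_def, τ.map_one_left]
  have e3 : ∀ g : H, ∑ j ∈ (ℛ k g).index, counit (R := k) ((ℛ k g).right j) •
      (1 : P) ⊗ₜ[k] ((ℛ k g).left j • v) = 1 ⊗ₜ (g • v) := by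
    intro g
    conv_rhs => rw [← sum_smul_counit (ℛ k g)]
    simp [Finset.sum_smul, TensorProduct.tmul_sum]
  rw [actR_eq]
  have e4 : ∀ g : H, (∑ j ∈ (ℛ k g).index, onRight V (Algebra.lsmul k k V ((ℛ k g).left j)) *
        onLeft V (τ.rightHit ((ℛ k g).right j)) : Module.End k (P ⊗[k] V)) (1 ⊗ₜ v) = 1 ⊗ₜ (g • v) := by
    intro g
    rw [← e3]
    simp [e2, ← TensorProduct.smul_tmul']
  rw [LinearMap.sum_apply]
  conv_rhs => rw [← sum_counit_smul (ℛ k h)]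
  rw [Finset.sum_smul, TensorProduct.tmul_sum]
  refine Finset.sum_congr rfl fun i _ => ?_
  rw [Module.End.mul_apply, e4]
  simp [e1, ← TensorProduct.smul_tmul']

/-- The action of `P ⊗ H` on `P ⊗ V`: `a ⊗ h` acts as `h` followed by left multiplication
by `a`. -/
def act : P ⊗[k] H →ₗ[k] Module.End k (P ⊗[k] V) :=
  glue (actL V).toLinearMap (τ.actR V).toLinearMap

theorem act_tmul (a : P) (h : H) : τ.act V (a ⊗ₜ h) = actL V a * τ.actR V h := rfl

/-- Evaluation of `H` at `v`. -/
def evalAt (v : V) : P ⊗[k] H →ₗ[k] P ⊗[k] V :=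
  LinearMap.lTensor P ((LinearMap.toSpanSingleton H V v).restrictScalars k)

@[simp] theorem evalAt_tmul (v : V) (b : P) (h : H) :
    evalAt (k := k) V v (b ⊗ₜ h) = b ⊗ₜ (h • v) := rfl

theorem act_one_tmul (x : P ⊗[k] H) (v : V) : τ.act V x (1 ⊗ₜ v) = evalAt V v x := by
  induction x with
  | zero => simp
  | add x y hx hy => simp only [map_add, LinearMap.add_apply, hx, hy]
  | tmul a h => simp [act_tmul, actR_one_tmul]

theorem actR_mul_actL (h : H) (b : P) :
    τ.actR V h * actL V b = τ.act V (τ.straighten (b ⊗ₜ h)) := by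
  have := τ.exchange_apply (τ.exchange_act V) b h
  rw [convL_mul_convR] at this
  exact this

/-- The action written out:
`(a ⊗ h)(b ⊗ v) = ∑ τ(b₍₁₎, h₍₁₎) (a b₍₂₎ ⊗ h₍₂₎ v) τ(S b₍₃₎, h₍₃₎)`. -/
theorem act_tmul_tmul (a : P) (h : H) (b : P) (v : V) :
    τ.act V (a ⊗ₜ h) (b ⊗ₜ v) =
      LinearMap.rTensor V (LinearMap.mulLeft k a) (evalAt V v (τ.straighten (b ⊗ₜ h))) := by
  have h1 : (b ⊗ₜ[k] v : P ⊗[k] V) = actL V b (1 ⊗ₜ v) := by simp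
  rw [act_tmul, h1, ← Module.End.mul_apply, mul_assoc, actR_mul_actL, Module.End.mul_apply,
    act_one_tmul]
  rfl

theorem actR_act (g h : H) (b : P) : τ.actR H g (b ⊗ₜ h) =
    LinearMap.lTensor P (LinearMap.mulRight k h) (τ.straighten (b ⊗ₜ g)) := by
  have := τ.act_tmul_tmul H 1 g b h
  rw [act_tmul] at this
  simp only [map_one, one_mul, LinearMap.mulLeft_one, LinearMap.rTensor_id, LinearMap.id_coe, id] at this
  rw [this]
  rfl

/-- Gluing is multiplicative when the exchange relation holds. -/
theorem glue_act {B : Type*} [Semiring B] [Algebra k B] (c : P →ₐ[k] B) (u : H →ₐ[k] B)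
    (hcu : τ.Exchange c.toLinearMap u.toLinearMap) (x y : P ⊗[k] H) :
    glue c.toLinearMap u.toLinearMap (τ.act H x y) =
      glue c.toLinearMap u.toLinearMap x * glue c.toLinearMap u.toLinearMap y := by
  induction x with
  | zero => simp
  | add x x' hx hx' => simp only [map_add, LinearMap.add_apply, add_mul, hx, hx']
  | tmul a g =>
    induction y with
    | zero => simp
    | add y y' hy hy' => simp only [map_add, mul_add, hy, hy']
    | tmul b h =>
      rw [act_tmul, Module.End.mul_apply, actR_act]
      have h1 : ∀ w, glue c.toLinearMap u.toLinearMap (actL H a w) =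
          c a * glue c.toLinearMap u.toLinearMap w := by
        intro w
        induction w with
        | zero => simp
        | add y y' hy hy' => simp only [map_add, mul_add, hy, hy']
        | tmul b h => simp [mul_assoc]
      have h2 : ∀ w, glue c.toLinearMap u.toLinearMap
          (LinearMap.lTensor P (LinearMap.mulRight k h) w) =
          glue c.toLinearMap u.toLinearMap w * u h := by
        intro w
        induction w with
        | zero => simp
        | add y y' hy hy' => simp only [map_add, add_mul, hy, hy']
        | tmul b h => simp [mul_assoc]
      have h3 := τ.exchange_apply hcu b g
      rw [convL_mul_convR, ofConv_toConv] at h3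
      rw [h1, h2, ← h3]
      simp [mul_assoc]

theorem act_act (x y : P ⊗[k] H) : τ.act V (τ.act H x y) = τ.act V x * τ.act V y :=
  τ.glue_act (actL V) (τ.actR V) (τ.exchange_act V) x y

theorem act_one : τ.act V (1 ⊗ₜ 1) = 1 := by simp [act_tmul]

end Act

/-- The double of `P` and `H` along `τ`: the space `P ⊗ H` with the tensor product coalgebra and
the twisted multiplication
`(a ⊗ g)(b ⊗ h) = ∑ τ(b₍₁₎, g₍₁₎) (a b₍₂₎ ⊗ g₍₂₎ h) τ(S b₍₃₎, g₍₃₎)`. -/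
def Double (_τ : SkewPairing k P H) : Type _ := P ⊗[k] H

namespace Double

instance : AddCommGroup τ.Double := inferInstanceAs (AddCommGroup (P ⊗[k] H))
instance : Module k τ.Double := inferInstanceAs (Module k (P ⊗[k] H))

/-- The identity map from `P ⊗ H`. -/
def of : P ⊗[k] H ≃ₗ[k] τ.Double := LinearEquiv.refl k _

instance : Ring τ.Double where
  __ := (inferInstance : AddCommGroup τ.Double)
  mul x y := of τ (τ.act H ((of τ).symm x) ((of τ).symm y))
  one := of τ (1 ⊗ₜ 1)
  mul_assoc x y z := (LinearMap.congr_fun (τ.act_act H x y) z)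
  one_mul x := LinearMap.congr_fun (τ.act_one H) x
  mul_one x := by
    refine (τ.act_one_tmul H x 1).trans ?_
    have : evalAt H (1 : H) = LinearMap.id (R := k) (M := P ⊗[k] H) :=
      TensorProduct.ext' fun b h => by simp
    rw [this]
    rfl
  left_distrib x y z := map_add (τ.act H x) y z
  right_distrib x y z := by
    refine (LinearMap.congr_fun (map_add (τ.act H) x y) z)
  zero_mul x := by
    refine (LinearMap.congr_fun (map_zero (τ.act H)) x)
  mul_zero x := map_zero (τ.act H x)

theorem of_mul_of (x y : P ⊗[k] H) : of τ x * of τ y = of τ (τ.act H x y) := rfl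
theorem one_def : (1 : τ.Double) = of τ (1 ⊗ₜ 1) := rfl

/-- The product written out. -/
theorem of_tmul_mul_of_tmul (a b : P) (g h : H) : of τ (a ⊗ₜ g) * of τ (b ⊗ₜ h) =
    of τ (TensorProduct.map (LinearMap.mulLeft k a) (LinearMap.mulRight k h)
      (τ.straighten (b ⊗ₜ g))) := by
  rw [of_mul_of, act_tmul_tmul, ← LinearMap.rTensor_comp_lTensor]
  rfl

instance : Algebra k τ.Double :=
  Algebra.ofModule
    (fun r x y => LinearMap.congr_fun (map_smul (τ.act H) r x) y)
    (fun r x y => map_smul (τ.act H x) r y)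

instance : Coalgebra k τ.Double := inferInstanceAs (Coalgebra k (P ⊗[k] H))

instance [FiniteDimensional k P] [FiniteDimensional k H] : FiniteDimensional k τ.Double :=
  inferInstanceAs (FiniteDimensional k (P ⊗[k] H))

theorem counit_of (a : P) (h : H) : counit (R := k) (of τ (a ⊗ₜ h)) =
    counit (R := k) a * counit (R := k) h := by
  refine (TensorProduct.counit_tmul (R := k) (S := k) a h).trans ?_
  simp [mul_comm]

/-- An algebra map out of the double, from algebra maps on `P` and `H` satisfying the exchange
relation. -/
def lift {B : Type*} [Semiring B] [Algebra k B] (c : P →ₐ[k] B) (u : H →ₐ[k] B)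
    (hcu : τ.Exchange c.toLinearMap u.toLinearMap) : τ.Double →ₐ[k] B :=
  AlgHom.ofLinearMap (glue c.toLinearMap u.toLinearMap ∘ₗ (of τ).symm.toLinearMap)
    (by simp [one_def])
    (fun x y => τ.glue_act c u hcu x y)

@[simp] theorem lift_of {B : Type*} [Semiring B] [Algebra k B] (c : P →ₐ[k] B) (u : H →ₐ[k] B)
    (hcu : τ.Exchange c.toLinearMap u.toLinearMap) (b : P) (h : H) :
    lift τ c u hcu (of τ (b ⊗ₜ h)) = c b * u h := rfl

/-- The module `P ⊗ V` over the double. -/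
def rep (V : Type*) [AddCommGroup V] [Module k V] [Module H V] [IsScalarTower k H V] :
    τ.Double →ₐ[k] Module.End k (P ⊗[k] V) :=
  lift τ (actL V) (τ.actR V) (τ.exchange_act V)

theorem rep_of (V : Type*) [AddCommGroup V] [Module k V] [Module H V] [IsScalarTower k H V]
    (x : P ⊗[k] H) : rep τ V (of τ x) = τ.act V x := rfl

/-- The inclusion of `P`. -/
def inclP : P →ₐ[k] τ.Double :=
  AlgHom.ofLinearMap ((of τ).toLinearMap ∘ₗ (TensorProduct.mk k P H).flip 1) rfl
    (fun a b => by
      simp [of_mul_of, act_tmul])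

/-- The inclusion of `H`. -/
def inclH : H →ₐ[k] τ.Double :=
  AlgHom.ofLinearMap ((of τ).toLinearMap ∘ₗ TensorProduct.mk k P H 1) rfl
    (fun a b => by
      simp [of_mul_of, act_tmul, actR_one_tmul])

theorem inclP_apply (b : P) : inclP τ b = of τ (b ⊗ₜ 1) := rfl
theorem inclH_apply (h : H) : inclH τ h = of τ (1 ⊗ₜ h) := rfl

@[simp] theorem inclP_mul_inclH (b : P) (h : H) : inclP τ b * inclH τ h = of τ (b ⊗ₜ h) := by
  simp [inclP_apply, inclH_apply, of_mul_of, act_tmul, actR_one_tmul]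

theorem glue_incl : glue (inclP τ).toLinearMap (inclH τ).toLinearMap = (of τ).toLinearMap :=
  TensorProduct.ext' fun b h => by simp

theorem exchange_incl : τ.Exchange (inclP τ).toLinearMap (inclH τ).toLinearMap := by
  rw [Exchange, convL_mul_convR, glue_incl, ← comp_straighten]
  apply WithConv.ext
  apply TensorProduct.ext'
  intro b h
  rw [convR_mul_convL_apply]
  simp only [AlgHom.toLinearMap_apply, inclP_apply, inclH_apply, of_tmul_mul_of_tmul,
    LinearMap.mulLeft_one, LinearMap.mulRight_one, TensorProduct.map_id]
  rfl

theorem exchange_map {B E : Type*} [Semiring B] [Algebra k B] [Semiring E] [Algebra k E] (φ : B →ₐ[k] E)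
    {c : P →ₗ[k] B} {u : H →ₗ[k] B} (hcu : τ.Exchange c u) :
    τ.Exchange (φ.toLinearMap ∘ₗ c) (φ.toLinearMap ∘ₗ u) := by
  rw [Exchange, convL_mul_convR, ← comp_straighten] at hcu ⊢
  have e : φ.toLinearMap ∘ₗ glue c u = glue (φ.toLinearMap ∘ₗ c) (φ.toLinearMap ∘ₗ u) :=
    TensorProduct.ext' fun b h => by simp
  apply WithConv.ext
  apply TensorProduct.ext'
  intro b h
  have h1 := convR_mul_convL_apply c u b h
  rw [hcu] at h1
  have h2 : glue c u (τ.straighten (b ⊗ₜ h)) = u h * c b := h1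
  rw [convR_mul_convL_apply, ← e]
  refine Eq.trans ?_ (congrArg φ h2).symm
  simp

/-- Exchange relations multiply. -/
theorem exchange_mul {B : Type*} [Semiring B] [Algebra k B] {c1 c2 : P →ₗ[k] B} {u1 u2 : H →ₗ[k] B}
    (h1 : τ.Exchange c1 u1) (h2 : τ.Exchange c2 u2)
    (h12 : ∀ b x, u1 x * c2 b = c2 b * u1 x) (h21 : ∀ b x, u2 x * c1 b = c1 b * u2 x) :
    τ.Exchange (toConv c1 * toConv c2 : WithConv (P →ₗ[k] B)).ofConv
      (toConv u1 * toConv u2 : WithConv (H →ₗ[k] B)).ofConv := by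
  have h3 := conv_comm h12
  have h4 := conv_comm h21
  rw [Exchange] at *
  rw [convL_mul, convR_mul]
  simp only [ofConv_toConv]
  calc (convR u1 * convR u2 * (convL c1 * convL c2) : WithConv (P ⊗[k] H →ₗ[k] B))
      = convR u1 * (convR u2 * convL c1) * convL c2 := by simp only [mul_assoc]
    _ = (convR u1 * convL c1) * (convR u2 * convL c2) := by rw [h4]; simp only [mul_assoc]
    _ = scal τ.form * (convL c1 * convR u1) * (scal τ.formInv * scal τ.form) *
          (convL c2 * convR u2) * scal τ.formInv := by rw [h1, h2]; simp only [mul_assoc]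
    _ = scal τ.form * (convL c1 * (convR u1 * convL c2) * convR u2) * scal τ.formInv := by
          rw [scal_cancel]; simp only [mul_assoc, mul_one]
    _ = _ := by rw [h3]; simp only [mul_assoc]

/-- The comultiplication of the double as an algebra map. -/
theorem comul_mul (x y : τ.Double) : comul (R := k) (x * y) = comul (R := k) x * comul (R := k) y := by
  let iL : τ.Double →ₐ[k] τ.Double ⊗[k] τ.Double := Algebra.TensorProduct.includeLeft
  let iR : τ.Double →ₐ[k] τ.Double ⊗[k] τ.Double := Algebra.TensorProduct.includeRight
  have h := exchange_mul τ (exchange_map τ iL (exchange_incl τ))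
    (exchange_map τ iR (exchange_incl τ)) (by intros; simp [iL, iR]) (by intros; simp [iL, iR])
  let c : P →ₐ[k] τ.Double ⊗[k] τ.Double :=
    (Algebra.TensorProduct.map (inclP τ) (inclP τ)).comp (Bialgebra.comulAlgHom k P)
  let u : H →ₐ[k] τ.Double ⊗[k] τ.Double :=
    (Algebra.TensorProduct.map (inclH τ) (inclH τ)).comp (Bialgebra.comulAlgHom k H)
  have hc : (toConv (iL.toLinearMap ∘ₗ (inclP τ).toLinearMap) *
      toConv (iR.toLinearMap ∘ₗ (inclP τ).toLinearMap) : WithConv (P →ₗ[k] _)).ofConv =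
      c.toLinearMap := by
    refine LinearMap.ext fun b => ?_
    rw [(ℛ k b).convMul_apply]
    simp [c, iL, iR, ← (ℛ k b).eq]
  have hu : (toConv (iL.toLinearMap ∘ₗ (inclH τ).toLinearMap) *
      toConv (iR.toLinearMap ∘ₗ (inclH τ).toLinearMap) : WithConv (H →ₗ[k] _)).ofConv =
      u.toLinearMap := by
    refine LinearMap.ext fun b => ?_
    rw [(ℛ k b).convMul_apply]
    simp [u, iL, iR, ← (ℛ k b).eq]
  rw [hc, hu] at h
  have e : (comul : τ.Double →ₗ[k] _) = (lift τ c u h).toLinearMap := by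
    refine TensorProduct.ext' fun b g => ?_
    refine (TensorProduct.comul_tmul (R := k) (S := k) b g).trans ?_
    refine Eq.trans ?_ (lift_of τ c u h b g).symm
    simp only [c, u, AlgHom.comp_apply, Bialgebra.comulAlgHom_apply]
    rw [← (ℛ k b).eq, ← (ℛ k g).eq]
    simp only [map_sum, TensorProduct.sum_tmul, TensorProduct.tmul_sum, Finset.sum_mul,
      Finset.mul_sum, Algebra.TensorProduct.map_tmul, Algebra.TensorProduct.tmul_mul_tmul,
      inclP_mul_inclH]
    rfl
  have := map_mul (lift τ c u h) x y
  rwa [← AlgHom.toLinearMap_apply, ← AlgHom.toLinearMap_apply, ← AlgHom.toLinearMap_apply, ← e] at this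

theorem counit_mul (x y : τ.Double) :
    counit (R := k) (x * y) = counit (R := k) x * counit (R := k) y := by
  have h : τ.Exchange (Bialgebra.counitAlgHom k P).toLinearMap
      (Bialgebra.counitAlgHom k H).toLinearMap := by
    have hR : (convR (Bialgebra.counitAlgHom k H).toLinearMap : WithConv (P ⊗[k] H →ₗ[k] k)) = 1 :=
      convR_one
    have hL : (convL (Bialgebra.counitAlgHom k P).toLinearMap : WithConv (P ⊗[k] H →ₗ[k] k)) = 1 :=
      convL_one
    rw [Exchange, hR, hL, mul_one, mul_one, scal_mul_scal τ.form_mul_formInv]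
  have e : (counit : τ.Double →ₗ[k] k) = (lift τ _ _ h).toLinearMap := by
    refine TensorProduct.ext' fun b h => ?_
    exact counit_of τ b h
  have := map_mul (lift τ _ _ h) x y
  rwa [← AlgHom.toLinearMap_apply, ← AlgHom.toLinearMap_apply, ← AlgHom.toLinearMap_apply, ← e] at this

instance : Bialgebra k τ.Double :=
  Bialgebra.mk' k _
    (by simp [one_def, counit_of])
    (counit_mul τ _ _)
    (by
      refine (TensorProduct.comul_tmul (R := k) (S := k) (1 : P) (1 : H)).trans ?_
      simp [Algebra.TensorProduct.one_def]
      rfl)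
    (comul_mul τ _ _)

/-- The antipode of the double. -/
def doubleAntipode : τ.Double →ₗ[k] τ.Double :=
  (convR ((inclH τ).toLinearMap ∘ₗ antipode k) * convL ((inclP τ).toLinearMap ∘ₗ antipode k) :
    WithConv (P ⊗[k] H →ₗ[k] τ.Double)).ofConv ∘ₗ (of τ).symm.toLinearMap

instance : HopfAlgebra k τ.Double :=
  HopfAlgebra.ofConvInverse (doubleAntipode τ)
    (by
      have h : (convR ((inclH τ).toLinearMap ∘ₗ antipode k) *
          convL ((inclP τ).toLinearMap ∘ₗ antipode k) * (convL (inclP τ).toLinearMap *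
          convR (inclH τ).toLinearMap) : WithConv (P ⊗[k] H →ₗ[k] τ.Double)) = 1 := by
        rw [mul_assoc, ← mul_assoc (convL _)]
        have h1 := convL_mul (H := H) (toConv ((inclP τ).toLinearMap ∘ₗ antipode k))
          (toConv (inclP τ).toLinearMap)
        rw [conv_antipode_left, convL_one] at h1
        have h2 := convR_mul (P := P) (toConv ((inclH τ).toLinearMap ∘ₗ antipode k))
          (toConv (inclH τ).toLinearMap)
        rw [conv_antipode_left, convR_one] at h2
        simp only [ofConv_toConv] at h1 h2
        rw [← h1, one_mul, ← h2]
      rw [convL_mul_convR, glue_incl] at h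
      exact h)
    (by
      have h : (convL (inclP τ).toLinearMap * convR (inclH τ).toLinearMap *
          (convR ((inclH τ).toLinearMap ∘ₗ antipode k) *
          convL ((inclP τ).toLinearMap ∘ₗ antipode k)) :
          WithConv (P ⊗[k] H →ₗ[k] τ.Double)) = 1 := by
        rw [mul_assoc, ← mul_assoc (convR _)]
        have h1 := convL_mul (H := H) (toConv (inclP τ).toLinearMap)
          (toConv ((inclP τ).toLinearMap ∘ₗ antipode k))
        rw [conv_antipode_right, convL_one] at h1
        have h2 := convR_mul (P := P) (toConv (inclH τ).toLinearMap)
          (toConv ((inclH τ).toLinearMap ∘ₗ antipode k))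
        rw [conv_antipode_right, convR_one] at h2
        simp only [ofConv_toConv] at h1 h2
        rw [← h2, one_mul, ← h1]
      rw [convL_mul_convR, glue_incl] at h
      exact h)

end Double
end SkewPairing
end Double

/-! ### Hopf pairings, the generalized quantum double, and indicators -/

section CopHopf
variable (k A : Type*) [Field k] [Ring A] [HopfAlgebra k A] [FiniteDimensional k A]

/-- The inverse of the antipode of a finite-dimensional Hopf algebra. -/
def antipodeInv : A →ₗ[k] A :=
  (LinearEquiv.ofBijective (antipode k) (antipode_bijective k A)).symm.toLinearMap

@[simp] theorem antipode_antipodeInv (a : A) : antipode k (antipodeInv k A a) = a :=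
  (LinearEquiv.ofBijective (antipode k) (antipode_bijective k A)).apply_symm_apply a

instance : FiniteDimensional k (Cop A) := Module.Finite.equiv (toCop k A).toLinearEquiv

/-- The antipode of `A^cop` is the inverse of the antipode of `A`. -/
instance : HopfAlgebra k (Cop A) :=
  HopfAlgebra.ofConvInverse
    ((toCop k A).toLinearMap ∘ₗ antipodeInv k A ∘ₗ (toCop k A).symm.toLinearMap)
    (by
      ext a
      obtain ⟨a, rfl⟩ := (toCop k A).surjective a
      apply (toCop k A).symm.injective
      apply (antipode_bijective k A).injective
      have h := HopfAlgebra.sum_antipode_mul_eq_smul (ℛ k a)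
      rw [LinearMap.convMul_apply, Cop.comul_apply, ← (ℛ k a).eq]
      simpa [HopfAlgebra.antipode_mul_antidistrib, Algebra.algebraMap_eq_smul_one] using h)
    (by
      ext a
      obtain ⟨a, rfl⟩ := (toCop k A).surjective a
      apply (toCop k A).symm.injective
      apply (antipode_bijective k A).injective
      have h := HopfAlgebra.sum_mul_antipode_eq_smul (ℛ k a)
      rw [LinearMap.convMul_apply, Cop.comul_apply, ← (ℛ k a).eq]
      simpa [HopfAlgebra.antipode_mul_antidistrib, Algebra.algebraMap_eq_smul_one] using h)

theorem Cop.antipode_apply (a : A) :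
    antipode k (toCop k A a) = toCop k A (antipodeInv k A a) := rfl

variable {k A} in
/-- A presentation of the coproduct of `A` gives one of the coproduct of `A^cop`. -/
def copRepr {ι : Type*} {a : A} (r : Coalgebra.Repr k a ι) : Coalgebra.Repr k (toCop k A a) ι where
  index := r.index
  left i := toCop k A (r.right i)
  right i := toCop k A (r.left i)
  eq := by simp [Cop.comul_apply, ← r.eq]

end CopHopf

section Pairing

/-- A Hopf pairing `A ⊗ H → k`: a bilinear form `σ` with
`σ(1, h) = ε(h)`, `σ(a, 1) = ε(a)`,
`σ(a b, h) = ∑ σ(a, h₍₁₎) σ(b, h₍₂₎)` and `σ(a, h g) = ∑ σ(a₍₁₎, h) σ(a₍₂₎, g)`. -/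
structure HopfPairing (k A H : Type*) [Field k] [Ring A] [HopfAlgebra k A] [Ring H]
    [HopfAlgebra k H] where
  /-- The bilinear form. -/
  toLin : A →ₗ[k] H →ₗ[k] k
  map_one_left : ∀ h, toLin 1 h = counit h
  map_one_right : ∀ a, toLin a 1 = counit a
  map_mul_left : ∀ a b h, toLin (a * b) h =
    TensorProduct.dualDistrib k H H (toLin a ⊗ₜ toLin b) (comul h)
  map_mul_right : ∀ a h g, toLin a (h * g) =
    TensorProduct.dualDistrib k A A (toLin.flip h ⊗ₜ toLin.flip g) (comul a)

namespace HopfPairing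
variable {k A H : Type*} [Field k] [Ring A] [HopfAlgebra k A] [FiniteDimensional k A] [Ring H]
  [HopfAlgebra k H]

/-- A Hopf pairing of `A` and `H` as a skew pairing of `A^cop` and `H`. -/
def toSkew (σ : HopfPairing k A H) : SkewPairing k (Cop A) H where
  toLin := σ.toLin ∘ₗ (toCop k A).symm.toLinearMap
  map_one_left h := by simp [σ.map_one_left]
  map_one_right b := by
    obtain ⟨a, rfl⟩ := (toCop k A).surjective b
    simp [σ.map_one_right]
  map_mul_left a b h := by simp [σ.map_mul_left]
  map_mul_right a h g := by
    obtain ⟨a, rfl⟩ := (toCop k A).surjective a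
    simp only [LinearMap.comp_apply, AlgEquiv.toLinearMap_apply, AlgEquiv.symm_apply_apply,
      σ.map_mul_right, Cop.comul_apply]
    rw [← (ℛ k a).eq]
    simp [mul_comm]

variable {K : Type*} [Ring K] [HopfAlgebra k K] [FiniteDimensional k K]
  (σ : HopfPairing k (HopfDual k K) H)

/-- The generalized quantum double `K^{*cop} ⋈_σ H`. -/
abbrev QuantumDouble : Type _ := σ.toSkew.Double

/-- The module `K^{*cop} ⋈_σ V` over the generalized quantum double, for an `H`-module `V`. -/
def doubleRep (V : Type*) [AddCommGroup V] [Module k V] [Module H V] [IsScalarTower k H V] :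
    σ.QuantumDouble →ₐ[k] Module.End k (Cop (HopfDual k K) ⊗[k] V) :=
  SkewPairing.Double.rep σ.toSkew V

/-- The module structure of `K^{*cop} ⋈_σ V` written out:
`(f ⋈ h)(l ⋈ v) = ∑ σ(l₍₃₎, h₍₁₎) (f l₍₂₎ ⋈ h₍₂₎ v) σ(S⁻¹(l₍₁₎), h₍₃₎)`, where the coproducts of `l`
are those of `K*`. For `V = H` this is the product of `K^{*cop} ⋈_σ H`. -/
theorem doubleRep_of_tmul (V : Type*) [AddCommGroup V] [Module k V] [Module H V]
    [IsScalarTower k H V] (f l : HopfDual k K) (h : H) (v : V) :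
    σ.doubleRep V (SkewPairing.Double.of σ.toSkew (toCop k _ f ⊗ₜ h)) (toCop k _ l ⊗ₜ v) =
      ∑ i ∈ (ℛ k l).index, ∑ j ∈ (ℛ k h).index,
      ∑ p ∈ (ℛ k ((ℛ k l).right i)).index, ∑ q ∈ (ℛ k ((ℛ k h).left j)).index,
        (σ.toLin ((ℛ k ((ℛ k l).right i)).right p) ((ℛ k ((ℛ k h).left j)).left q) *
          σ.toLin (antipodeInv k _ ((ℛ k l).left i)) ((ℛ k h).right j)) •
        (toCop k _ (f * (ℛ k ((ℛ k l).right i)).left p) ⊗ₜ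
          ((ℛ k ((ℛ k h).left j)).right q • v)) := by
  rw [doubleRep, SkewPairing.Double.rep_of, SkewPairing.act_tmul_tmul,
    σ.toSkew.straighten_tmul (copRepr (ℛ k l)) (ℛ k h) (fun i => copRepr (ℛ k ((ℛ k l).right i)))
      (fun j => ℛ k ((ℛ k h).left j))]
  simp only [map_sum, map_smul, SkewPairing.evalAt_tmul, LinearMap.rTensor_tmul,
    LinearMap.mulLeft_apply, map_mul]
  rfl

theorem of_mul_of_eq_doubleRep (x y : Cop (HopfDual k K) ⊗[k] H) :
    SkewPairing.Double.of σ.toSkew x * SkewPairing.Double.of σ.toSkew y =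
      SkewPairing.Double.of σ.toSkew
        (σ.doubleRep H (SkewPairing.Double.of σ.toSkew x) y) := rfl

/-- The element `σ_r(h)` of `K` representing the functional `σ(-, h)` on `K*`. -/
def rightLin : H →ₗ[k] K :=
  (Module.evalEquiv k K).symm.toLinearMap ∘ₗ
    LinearMap.lcomp k k (HopfDual.toDual k K).symm.toLinearMap ∘ₗ σ.toLin.flip

@[simp] theorem apply_rightLin (f : HopfDual k K) (h : H) : f (σ.rightLin h) = σ.toLin f h := by
  exact Module.apply_evalEquiv_symm_apply k K (HopfDual.toDual k K f)
    ((LinearMap.lcomp k k (HopfDual.toDual k K).symm.toLinearMap ∘ₗ σ.toLin.flip) h)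

theorem ext_dual {x y : K} (h : ∀ f : HopfDual k K, f x = f y) : x = y := by
  rw [← sub_eq_zero, ← Module.forall_dual_apply_eq_zero_iff k]
  intro f
  have := h ((HopfDual.toDual k K).symm f)
  simpa [sub_eq_zero] using this

/-- The map `σ_r : H → K`, `h ↦ σ(-, h)`. -/
def right : H →ₐ[k] K :=
  AlgHom.ofLinearMap σ.rightLin
    (ext_dual (k := k) fun f => by
      rw [apply_rightLin, σ.map_one_right, HopfDual.counit_apply])
    (fun h g => ext_dual (k := k) fun f => by
      have h1 : ∀ w : HopfDual k K ⊗[k] HopfDual k K,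
          TensorProduct.dualDistrib k _ _ (σ.toLin.flip h ⊗ₜ σ.toLin.flip g) w =
          HopfDual.tensorEquiv k K w (σ.rightLin h ⊗ₜ σ.rightLin g) := by
        intro w
        induction w with
        | zero => simp only [map_zero, HopfDual.zero_apply]
        | add x y hx hy => simp only [map_add, HopfDual.add_apply, hx, hy]
        | tmul a b => simp
      rw [apply_rightLin, σ.map_mul_right, h1, HopfDual.tensorEquiv_comul])

theorem apply_right (f : HopfDual k K) (h : H) : f (σ.right h) = σ.toLin f h :=
  σ.apply_rightLin f h

variable (V W : Type*) [AddCommGroup V] [Module k V] [Module H V] [IsScalarTower k H V]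
  [AddCommGroup W] [Module k W] [Module K W] [IsScalarTower k K W]

/-- The diagonal action of `H` on `V ⊗ W`, `h (v ⊗ w) = ∑ h₍₁₎ v ⊗ σ_r(h₍₂₎) w`, for an
`H`-module `V` and a `K`-module `W`. -/
def tensorRep : H →ₐ[k] Module.End k (V ⊗[k] W) :=
  (Module.endTensorEndAlgHom).comp
    ((Algebra.TensorProduct.map (Algebra.lsmul k k V) ((Algebra.lsmul k k W).comp σ.right)).comp
      (Bialgebra.comulAlgHom k H))

theorem tensorRep_tmul {ι : Type*} {h : H} (r : Coalgebra.Repr k h ι) (v : V) (w : W) :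
    σ.tensorRep V W h (v ⊗ₜ w) = ∑ i ∈ r.index, (r.left i • v) ⊗ₜ (σ.right (r.right i) • w) := by
  simp only [tensorRep, AlgHom.comp_apply, Bialgebra.comulAlgHom_apply, ← r.eq, map_sum,
    LinearMap.sum_apply]
  rfl

end HopfPairing
end Pairing

section Indicator
variable {k A : Type*} [Field k] [Ring A] [Bialgebra k A]

/-- The action of `A^cop` on an `A`-module `W` (as an algebra, `A^cop` is `A`). -/
def copRep (k A W : Type*) [Field k] [Ring A] [Algebra k A] [AddCommGroup W] [Module k W]
    [Module A W] [IsScalarTower k A W] : Cop A →ₐ[k] Module.End k W :=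
  (Algebra.lsmul k k W).comp (toCop k A).symm.toAlgHom

theorem copRep_apply (k A W : Type*) [Field k] [Ring A] [Algebra k A] [AddCommGroup W]
    [Module k W] [Module A W] [IsScalarTower k A W] (a : A) (w : W) :
    copRep k A W (toCop k A a) w = a • w := rfl

variable (k) in
/-- A two-sided integral `Λ` normalized by `ε(Λ) = 1`. -/
structure IsNormalizedIntegral (Λ : A) : Prop where
  mul_left : ∀ a, a * Λ = counit (R := k) a • Λ
  mul_right : ∀ a, Λ * a = counit (R := k) a • Λ
  counit_eq : counit (R := k) Λ = 1

theorem IsNormalizedIntegral.eq {Λ Λ' : A} (h : IsNormalizedIntegral k Λ)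
    (h' : IsNormalizedIntegral k Λ') : Λ = Λ' := by
  have h1 := h'.mul_left Λ
  rw [h.mul_right, h.counit_eq, h'.counit_eq, one_smul, one_smul] at h1
  exact h1

variable (k) in
/-- The Sweedler power `a ↦ a^{[n]} = ∑ a₍₁₎ a₍₂₎ ⋯ a₍ₙ₎`, the `n`-fold convolution power of the
identity. -/
def sweedlerPow (n : ℕ) : A →ₗ[k] A :=
  ((toConv LinearMap.id : WithConv (A →ₗ[k] A)) ^ n).ofConv

open scoped Classical in
/-- The `n`-th Frobenius–Schur indicator `χ(Λ^{[n]})` of a representation `ρ` with character `χ`,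
where `Λ` is the normalized integral. (The value is `0` if there is no normalized integral; every
semisimple Hopf algebra has a unique one.) -/
def indicator {M : Type*} [AddCommGroup M] [Module k M] (n : ℕ) (ρ : A →ₐ[k] Module.End k M) : k :=
  if h : ∃ Λ : A, IsNormalizedIntegral k Λ then
    LinearMap.trace k M (ρ (sweedlerPow k n h.choose))
  else 0

theorem indicator_eq {M : Type*} [AddCommGroup M] [Module k M] (n : ℕ)
    (ρ : A →ₐ[k] Module.End k M) {Λ : A} (h : IsNormalizedIntegral k Λ) :
    indicator n ρ = LinearMap.trace k M (ρ (sweedlerPow k n Λ)) := by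
  have h' : ∃ Λ : A, IsNormalizedIntegral k Λ := ⟨Λ, h⟩
  rw [indicator, dif_pos h', h'.choose_spec.eq h]

end Indicator

end
end HopfDouble

universe u

namespace HopfDouble
noncomputable section

open scoped TensorProduct
open Coalgebra HopfAlgebra WithConv

set_option linter.unusedSectionVars false

/-! ### Integrals -/

section Integral
variable {k A : Type*} [Field k] [Ring A] [HopfAlgebra k A]

/-! The proof has two halves: `S² = id` for semisimple complex Hopf algebras, and a trace
computation that cyclicity makes short.

Larson–Radford. Let `t` be the normalized integral of `A` and `λ(x) = tr(y ↦ x S²(y))`, an integral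
in the dual. Moving elements across `Δ(t)` gives the Nakayama relation `λ(yx) = λ(x S²(y))` and a
group-like `a = λ(t₍₁₎) t₍₂₎` with `x a = a S⁴(x)`. Since `a` has finite order, so has `S²`. In `A ≅
∏ End(Vᵢ)` the functional `λ` is the trace form against some `g` that implements `S²` by
conjugation. A unitarity argument makes every `tr(gᵢ)` positive, so `λ(1) ≠ 0`
(`dualIntegral_one_ne_zero`). This forces `S⁴ = id`, and counting eigenvalues of the involution `S²`
yields `S² = id` (`antipode_antipode`).

Consequences. When `S² = id`, the integral satisfies `dim A · f(t) = tr(lhit f)` for every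
functional `f`. Cyclicity of the trace then makes `Δ(t)` symmetric. The formula involves only the
coalgebra, so the integral of the double is `l ⊗ t`, with `l` the integral of `P = K^{*cop}`
(`isNormalizedIntegral_double`).

The indicator of the double is the trace at `l ⊗ t` of an `n`-th convolution power of functions on
`P ⊗ H`. Functions `P → End M` act multiplicatively on `Hom(K, M)`, and the trace of that action is
`dim K` times the trace of the value at `l` (`dualAct_mul`, `trace_dualAct`). With `P ⊗ V ≅ Hom(K,
V)`, everything becomes operators on functions `φ(b, x)` from `K ⊗ K` to `V`. The element to be
raised to the `n`-th power is `C X v J`, a convolution product of functions of `h ∈ H`. With `g =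
σ_r(h)`, these send `φ` to `φ(x₍₁₎ b, x₍₂₎)`, `φ(b, x g)`, `h φ(b, x)` and `φ(b, S(g) x)`
respectively.

Since `t` is cocommutative, `F ↦ tr F(t)` is unchanged by rotation and conjugation. Rotating `J` to
the front and conjugating by `theta` turns `J C X` into `N Y`, where `N φ = φ(b x₍₂₎, x₍₁₎)` and `Y
φ = φ(S(g) b, x)` (`link`). Now `N` is constant and commutes with `v Y`, which is an action of the
algebra `H`. The power therefore splits as `Nⁿ` times the action of `t^{[n]}` (`trace_pow_eq`). Its
trace is `dim K · ∑ χ_V(h₍₁₎) tr_K(L_c R_{σ_r(h₍₂₎)})`, with `h = t^{[n]}` and `c` the Sweedler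
power of the integral of `K^cop` (`trace_pre_pow_mul_actVB`). The decomposition `K ≅ ∏ End(W)` gives
`tr_K(L_c R_g) = ∑ χ_W(c) χ_W(g)`, and the sum is the right-hand side. -/

/-- Each inclusion has a convolution inverse, its composite with the antipode, so either factor can
be cancelled. This gives the next two identities. -/
theorem comul_eq_convMul : (toConv comul : WithConv (A →ₗ[k] A ⊗[k] A)) =
    toConv (Algebra.TensorProduct.includeLeft : A →ₐ[k] A ⊗[k] A).toLinearMap *
      toConv (Algebra.TensorProduct.includeRight : A →ₐ[k] A ⊗[k] A).toLinearMap := by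
  ext x
  rw [(ℛ k x).convMul_apply]
  simp [(ℛ k x).eq]

theorem sum_antipode_tmul_one_mul_comul (x : A) :
    ∑ i ∈ (ℛ k x).index, (antipode k ((ℛ k x).left i) ⊗ₜ[k] (1 : A)) *
      comul (R := k) ((ℛ k x).right i) = 1 ⊗ₜ x := by
  have h := conv_antipode_left (k := k)
    (Algebra.TensorProduct.includeLeft : A →ₐ[k] A ⊗[k] A)
  have h2 := congrArg (· * toConv
    (Algebra.TensorProduct.includeRight : A →ₐ[k] A ⊗[k] A).toLinearMap) h
  simp only [mul_assoc, ← comul_eq_convMul, one_mul] at h2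
  have h3 := LinearMap.congr_fun (congrArg WithConv.ofConv h2) x
  rw [(ℛ k x).convMul_apply] at h3
  simpa using h3

theorem sum_comul_mul_one_tmul_antipode (x : A) :
    ∑ i ∈ (ℛ k x).index, comul (R := k) ((ℛ k x).left i) *
      ((1 : A) ⊗ₜ[k] antipode k ((ℛ k x).right i)) = x ⊗ₜ 1 := by
  have h := conv_antipode_right (k := k)
    (Algebra.TensorProduct.includeRight : A →ₐ[k] A ⊗[k] A)
  have h2 := congrArg (toConv
    (Algebra.TensorProduct.includeLeft : A →ₐ[k] A ⊗[k] A).toLinearMap * ·) h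
  simp only [← mul_assoc, ← comul_eq_convMul, mul_one] at h2
  have h3 := LinearMap.congr_fun (congrArg WithConv.ofConv h2) x
  rw [(ℛ k x).convMul_apply] at h3
  simpa using h3

/-- Expand `1 ⊗ x` as `∑ (S(x₍₁₎) ⊗ 1) Δ(x₍₂₎)`. Multiplicativity of the coproduct lets the integral
absorb `x₍₂₎`. -/
theorem antipode_tmul_one_mul_comul {t : A} (ht : ∀ a, a * t = counit (R := k) a • t) (x : A) :
    (antipode k x ⊗ₜ[k] (1 : A)) * comul (R := k) t = (1 ⊗ₜ x) * comul (R := k) t := by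
  rw [← sum_antipode_tmul_one_mul_comul, Finset.sum_mul]
  simp only [mul_assoc, ← Bialgebra.comul_mul, ht, map_smul]
  conv_lhs => rw [← sum_smul_counit (ℛ k x)]
  simp [TensorProduct.sum_tmul, Finset.sum_mul, ← TensorProduct.smul_tmul']

theorem comul_mul_tmul_one {t : A} (ht : ∀ a, t * a = counit (R := k) a • t) (x : A) :
    comul (R := k) t * (x ⊗ₜ[k] (1 : A)) = comul (R := k) t * (1 ⊗ₜ antipode k x) := by
  rw [← sum_comul_mul_one_tmul_antipode, Finset.mul_sum]
  simp only [← mul_assoc, ← Bialgebra.comul_mul, ht, map_smul]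
  conv_rhs => rw [← sum_counit_smul (ℛ k x)]
  simp [TensorProduct.tmul_sum, Finset.mul_sum]

/-- The integral is the component of `1` in a left ideal complementary to the augmentation ideal.
There `(a - ε(a)) t` lies in both ideals, hence vanishes. -/
theorem exists_isNormalizedIntegral_left [IsSemisimpleRing A] :
    ∃ t : A, (∀ a, a * t = counit (R := k) a • t) ∧ counit (R := k) t = 1 := by
  let I : Submodule A A :=
    { carrier := {x | counit (R := k) x = 0}
      add_mem' := by intro a b ha hb; simp_all
      zero_mem' := by simp
      smul_mem' := by intro a b hb; simp_all }
  obtain ⟨J, hJ⟩ := exists_isCompl I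
  obtain ⟨e, he, t, ht, het⟩ := Submodule.mem_sup.1
    (show (1 : A) ∈ I ⊔ J by rw [hJ.sup_eq_top]; trivial)
  have h1 : counit (R := k) t = 1 := by
    have := congrArg (counit (R := k)) het
    rwa [map_add, show counit (R := k) e = 0 from he, zero_add, Bialgebra.counit_one] at this
  refine ⟨t, fun a => ?_, h1⟩
  have h2 : (a - algebraMap k A (counit (R := k) a)) * t ∈ I ⊓ J := by
    refine ⟨?_, J.smul_mem _ ht⟩
    change counit (R := k) _ = 0
    simp
  rw [hJ.inf_eq_bot, Submodule.mem_bot, sub_mul, sub_eq_zero] at h2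
  rw [h2, Algebra.smul_def]

section FiniteDimensional
variable [FiniteDimensional k A]

/-- `S(t)` is a right integral, so the product `S(t) t` equals both `S(t)` and `t`. -/
theorem antipode_eq_self_of_integral {t : A} (ht : ∀ a, a * t = counit (R := k) a • t)
    (h1 : counit (R := k) t = 1) : antipode k t = t := by
  have h2 : ∀ b, antipode k t * b = counit (R := k) b • antipode k t := by
    intro b
    obtain ⟨a, rfl⟩ := (antipode_bijective k A).surjective b
    rw [← HopfAlgebra.antipode_mul_antidistrib, ht, map_smul, HopfAlgebra.counit_antipode]
  have h3 := h2 t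
  rw [ht, HopfAlgebra.counit_antipode, h1, one_smul, one_smul] at h3
  exact h3.symm

theorem IsNormalizedIntegral.of_left {t : A} (ht : ∀ a, a * t = counit (R := k) a • t)
    (h1 : counit (R := k) t = 1) : IsNormalizedIntegral k t := by
  refine ⟨ht, fun b => ?_, h1⟩
  obtain ⟨a, rfl⟩ := (antipode_bijective k A).surjective b
  rw [← antipode_eq_self_of_integral ht h1, ← HopfAlgebra.antipode_mul_antidistrib, ht, map_smul,
    HopfAlgebra.counit_antipode]

variable (k A) in
theorem exists_isNormalizedIntegral [IsSemisimpleRing A] : ∃ t : A, IsNormalizedIntegral k t := by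
  obtain ⟨t, ht, h1⟩ := exists_isNormalizedIntegral_left (k := k) (A := A)
  exact ⟨t, .of_left ht h1⟩

/-- Maschke's theorem. -/
theorem IsNormalizedIntegral.isSemisimpleRing {t : A} (ht : IsNormalizedIntegral k t) :
    IsSemisimpleRing A := by
  refine (isSemisimpleModule_iff A A).2 ⟨fun N => ?_⟩
  obtain ⟨p, hp⟩ := (N.restrictScalars k).subtype.exists_leftInverse_of_injective
    (LinearMap.ker_eq_bot.2 Subtype.val_injective)
  let q : A →ₗ[k] A := (N.restrictScalars k).subtype ∘ₗ p
  have hq : ∀ x ∈ N, q x = x := fun x hx =>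
    congrArg Subtype.val (LinearMap.congr_fun hp ⟨x, hx⟩)
  have hqN : ∀ x, q x ∈ N := fun x => (p x).2
  let r := ℛ k t
  -- Average the linear projection `q` into `m ↦ ∑ t₍₁₎ q(S(t₍₂₎) m)`. Linearity over `A` is checked
  -- on scalars of the form `S(a)`, which are all of `A`, by moving `S(a)` across `Δ(t)`.
  let F (m : A) : A ⊗[k] A →ₗ[k] A :=
    TensorProduct.lift ((LinearMap.mul k A).compl₂ (q ∘ₗ LinearMap.mulRight k m ∘ₗ antipode k))
  have hF : ∀ m a b, F m (a ⊗ₜ b) = a * q (antipode k b * m) := by intros; simp [F]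
  let Q : A →ₗ[A] A :=
    { toFun := fun m => F m (comul t)
      map_add' := by
        intro x y
        rw [← r.eq]
        simp [hF, mul_add, Finset.sum_add_distrib]
      map_smul' := by
        intro a m
        obtain ⟨a, rfl⟩ := (antipode_bijective k A).surjective a
        have h := congrArg (F m) (antipode_tmul_one_mul_comul ht.mul_left a)
        rw [← r.eq] at h ⊢
        simp only [Finset.mul_sum, map_sum, Algebra.TensorProduct.tmul_mul_tmul, one_mul, hF,
          HopfAlgebra.antipode_mul_antidistrib] at h
        simp only [map_sum, hF, smul_eq_mul, Finset.mul_sum, RingHom.id_apply, ← mul_assoc]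
        simpa only [mul_assoc] using h.symm }
  have hQ : ∀ m, Q m = ∑ i ∈ r.index, r.left i * q (antipode k (r.right i) * m) := by
    intro m
    change F m (comul t) = _
    rw [← r.eq]
    simp [hF]
  have hQN : ∀ m, Q m ∈ N := fun m => by
    rw [hQ]
    exact N.sum_mem fun i _ => N.smul_mem _ (hqN _)
  have hQ1 : ∀ m ∈ N, Q m = m := fun m hm => by
    rw [hQ, Finset.sum_congr rfl fun i _ => by
      rw [hq (antipode k (r.right i) * m) (N.smul_mem _ hm), ← mul_assoc]]
    rw [← Finset.sum_mul, HopfAlgebra.sum_mul_antipode_eq_smul, ht.counit_eq, one_smul, one_mul]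
  exact ⟨LinearMap.ker (Q.codRestrict N hQN), LinearMap.isCompl_of_proj fun x =>
    Subtype.ext (hQ1 x x.2)⟩

theorem hitLeft_counit : hitLeft (counit : A →ₗ[k] k) = LinearMap.id := rhit_one

theorem traceIntegral_counit_apply (x : A) : traceIntegral (counit : A →ₗ[k] k) x =
    LinearMap.trace k A (LinearMap.mulLeft k x ∘ₗ antipode k ∘ₗ antipode k) := by
  simp only [traceIntegral, LinearMap.comp_apply, hitLeft_counit]
  congr 1

/-- A Hopf algebra with `S² = id` in characteristic zero has a normalized integral, given by the
regular character of the dual. -/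
theorem exists_isNormalizedIntegral_of_involutive [CharZero k]
    (hS : ∀ a : A, antipode k (antipode k a) = a) :
    ∃ t : A, IsNormalizedIntegral k t ∧
      ∀ f : A →ₗ[k] k, (Module.finrank k A : k) * f t = LinearMap.trace k A (lhit f) := by
  let l := traceIntegral (counit : HopfDual k A →ₗ[k] k)
  obtain ⟨x, hx⟩ : ∃ x : A, ∀ f : HopfDual k A, f x = l f := by
    obtain ⟨x, hx⟩ := (Module.evalEquiv k A).surjective (l ∘ₗ (HopfDual.toDual k A).symm.toLinearMap)
    refine ⟨x, fun f => ?_⟩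
    have := LinearMap.congr_fun hx (HopfDual.toDual k A f)
    simpa using this
  -- As `S² = id`, the value `l f` is the trace of left multiplication by `f` on the dual, which is
  -- the transpose of `lhit f`.
  have hl : ∀ f, l f = LinearMap.trace k A (lhit (HopfDual.toDual k A f)) := by
    intro f
    rw [← LinearMap.trace_transpose']
    change traceIntegral (counit : HopfDual k A →ₗ[k] k) f = _
    rw [traceIntegral_counit_apply, ← LinearMap.trace_conj' _ (HopfDual.toDual k A)]
    congr 1
    ext q y
    obtain ⟨q, rfl⟩ := (HopfDual.toDual k A).surjective q
    have h2 : antipode k (antipode k q) = q := by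
      ext z
      exact congrArg q (hS z)
    simp only [LinearEquiv.conj_apply, LinearMap.comp_apply, LinearEquiv.coe_coe,
      LinearEquiv.symm_apply_apply, h2, LinearMap.mulLeft_apply, Module.Dual.transpose_apply,
      HopfDual.toDual_apply]
    rw [HopfDual.mul_apply _ _ (ℛ k y), lhit_apply _ (ℛ k y),
      ← HopfDual.toDual_apply q (∑ _ ∈ _, _), map_sum]
    simp
  have hn : (Module.finrank k A : k) ≠ 0 := by
    have : Nontrivial A := by
      refine ⟨1, 0, fun h => ?_⟩
      have := congrArg (counit (R := k)) h
      simp at this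
    exact Nat.cast_ne_zero.2 Module.finrank_pos.ne'
  have hε : counit (R := k) x = Module.finrank k A := by
    have := hx 1
    rw [hl] at this
    have h1 : HopfDual.toDual k A 1 = counit := rfl
    rw [h1, lhit_one, LinearMap.trace_id] at this
    exact this
  -- The integral property of `l` on the dual, evaluated at `a`, says that `f(a x) = ε(a) f(x)` for
  -- every `f`.
  have hleft : ∀ a, a * x = counit (R := k) a • x := by
    intro a
    refine HopfPairing.ext_dual (k := k) fun f => ?_
    have h := traceIntegral_integral (counit : HopfDual k A →ₗ[k] k) f
    have h2 : ∀ w : HopfDual k A ⊗[k] HopfDual k A,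
        (TensorProduct.rid k (HopfDual k A) (LinearMap.lTensor (HopfDual k A) l w)) a =
          HopfDual.tensorEquiv k A w (a ⊗ₜ x) := by
      intro w
      induction w with
      | zero => simp
      | add x y hx hy => simp only [map_add, HopfDual.add_apply, hx, hy]
      | tmul p q => simp [hx, mul_comm]
    have h3 := congrArg (fun p : HopfDual k A => p a) h
    rw [h2, HopfDual.tensorEquiv_comul] at h3
    rw [h3]
    have h4 : f (counit (R := k) a • x) = counit (R := k) a * f x :=
      map_smul (HopfDual.toDual k A f) _ _
    rw [h4, hx, HopfDual.smul_apply, HopfDual.one_apply, mul_comm]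
  refine ⟨(Module.finrank k A : k)⁻¹ • x, .of_left (fun a => ?_) ?_, fun f => ?_⟩
  · rw [mul_smul_comm, hleft, smul_comm]
  · rw [map_smul, hε, smul_eq_mul, inv_mul_cancel₀ hn]
  · have := hx ((HopfDual.toDual k A).symm f)
    rw [hl, LinearEquiv.apply_symm_apply] at this
    rw [← this, map_smul, smul_eq_mul, mul_inv_cancel_left₀ hn]
    rfl

/-- The coproduct of the integral is symmetric. -/
theorem comm_comul_of_trace [CharZero k] {t : A} (ht : ∀ f : A →ₗ[k] k,
    (Module.finrank k A : k) * f t = LinearMap.trace k A (lhit f)) :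
    TensorProduct.comm k A A (comul t) = comul t := by
  have hn : (Module.finrank k A : k) ≠ 0 := by
    have : Nontrivial A := by
      refine ⟨1, 0, fun h => ?_⟩
      have := congrArg (counit (R := k)) h
      simp at this
    exact Nat.cast_ne_zero.2 Module.finrank_pos.ne'
  -- A convolution product of functionals acts through `lhit` as a composite, and the trace of a
  -- composite does not depend on the order.
  have h1 : ∀ f g : A →ₗ[k] k, (toConv f * toConv g : WithConv (A →ₗ[k] k)) t =
      (toConv g * toConv f : WithConv (A →ₗ[k] k)) t := by
    intro f g
    apply mul_left_cancel₀ hn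
    refine (ht (toConv f * toConv g : WithConv (A →ₗ[k] k)).ofConv).trans
      (Eq.trans ?_ (ht (toConv g * toConv f : WithConv (A →ₗ[k] k)).ofConv).symm)
    rw [← lhit_lhit, ← lhit_lhit]
    exact LinearMap.trace_mul_comm k _ _
  rw [← sub_eq_zero, ← Module.forall_dual_apply_eq_zero_iff k]
  intro φ
  obtain ⟨φ, rfl⟩ := (TensorProduct.dualDistribEquiv k A A).surjective φ
  rw [map_sub, sub_eq_zero]
  have h2 : ∀ φ, TensorProduct.dualDistribEquiv k A A φ = TensorProduct.dualDistrib k A A φ := by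
    intro φ
    simp [TensorProduct.dualDistribEquiv, TensorProduct.dualDistribEquivOfBasis]
  rw [h2]
  induction φ with
  | zero => simp
  | add x y hx hy => simp only [map_add, LinearMap.add_apply, hx, hy]
  | tmul f g =>
    have := h1 g f
    rw [(ℛ k t).convMul_apply, (ℛ k t).convMul_apply] at this
    rw [← (ℛ k t).eq]
    simpa [mul_comm] using this

end FiniteDimensional
end Integral

/-! ### The Nakayama automorphism and the fourth power of the antipode -/

section Nakayama
variable {k A : Type*} [Field k] [Ring A] [HopfAlgebra k A]

theorem comul_lhit (f : A →ₗ[k] k) (y : A) :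
    comul (lhit f y) = LinearMap.rTensor A (lhit f) (comul (R := k) y) := by
  have h : ∀ w : A ⊗[k] A, comul (TensorProduct.lid k A (LinearMap.rTensor A f w)) =
      LinearMap.rTensor A ((TensorProduct.lid k A).toLinearMap ∘ₗ LinearMap.rTensor A f)
        ((TensorProduct.assoc k A A A).symm (LinearMap.lTensor A comul w)) := by
    intro w
    induction w with
    | zero => simp
    | add x y hx hy => simp only [map_add, hx, hy]
    | tmul p q =>
      simp only [LinearMap.rTensor_tmul, TensorProduct.lid_tmul, LinearMap.lTensor_tmul, map_smul]
      rw [← (ℛ k q).eq]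
      simp [TensorProduct.tmul_sum, Finset.smul_sum, TensorProduct.smul_tmul']
  simp only [lhit, LinearMap.comp_apply, LinearEquiv.coe_coe, h, Coalgebra.coassoc_symm_apply]
  rw [← LinearMap.rTensor_comp_apply]
  rfl

variable [FiniteDimensional k A]

variable (k A) in
/-- The integral `x ↦ tr(y ↦ x S²(y))` of the dual. -/
def dualIntegral : A →ₗ[k] k := traceIntegral counit

theorem dualIntegral_apply (x : A) : dualIntegral k A x =
    LinearMap.trace k A (LinearMap.mulLeft k x ∘ₗ antipode k ∘ₗ antipode k) :=
  traceIntegral_counit_apply x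

theorem rhit_dualIntegral (x : A) : rhit (dualIntegral k A) x = dualIntegral k A x • 1 :=
  traceIntegral_integral counit x

variable {t : A} (ht : IsNormalizedIntegral k t)
include ht

/-- Because `t` is a right integral, `y ↦ t S²(y)` is the rank one map `ε ⊗ t`, of trace `ε(t)`. -/
theorem dualIntegral_integral : dualIntegral k A t = 1 := by
  have h : LinearMap.mulLeft k t ∘ₗ antipode k ∘ₗ antipode k =
      dualTensorHom k A A (counit ⊗ₜ t) := by
    ext x
    simp [ht.mul_right]
  rw [dualIntegral_apply, h, LinearMap.trace_eq_contract_apply, contractLeft_apply, ht.counit_eq]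

/-- Moving `x` across `Δ(t)` gives `∑ t₍₁₎ l(x t₍₂₎) = S(x) ∑ t₍₁₎ l(t₍₂₎)`. -/
theorem rhit_mulLeft_integral {l : A →ₗ[k] k} (hl : ∀ x, rhit l x = l x • 1) (x : A) :
    rhit (l ∘ₗ LinearMap.mulLeft k x) t = l t • antipode k x := by
  have h := congrArg (fun w => TensorProduct.rid k A (LinearMap.lTensor A l w))
    (antipode_tmul_one_mul_comul ht.mul_left x)
  have h2 := congrArg (antipode k x * ·) (hl t)
  simp only [rhit, LinearMap.comp_apply, ← (ℛ k t).eq] at h h2 ⊢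
  simp only [Finset.mul_sum, map_sum, Algebra.TensorProduct.tmul_mul_tmul, one_mul,
    LinearMap.lTensor_tmul, LinearEquiv.coe_coe, TensorProduct.rid_tmul, mul_smul_comm, mul_one,
    LinearMap.comp_apply, LinearMap.mulLeft_apply] at h h2 ⊢
  rw [← h, h2]

theorem rhit_mulRight_integral (x : A) :
    rhit (dualIntegral k A ∘ₗ LinearMap.mulRight k (antipode k x)) t = x := by
  have h := congrArg (fun w => TensorProduct.rid k A (LinearMap.lTensor A (dualIntegral k A) w))
    (comul_mul_tmul_one ht.mul_right x)
  have h2 := congrArg (· * x) (rhit_dualIntegral (k := k) t)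
  simp only [rhit, LinearMap.comp_apply, ← (ℛ k t).eq] at h h2 ⊢
  simp only [Finset.sum_mul, map_sum, Algebra.TensorProduct.tmul_mul_tmul, mul_one,
    LinearMap.lTensor_tmul, LinearEquiv.coe_coe, TensorProduct.rid_tmul, smul_mul_assoc, one_mul,
    LinearMap.comp_apply, LinearMap.mulRight_apply, dualIntegral_integral ht, one_smul] at h h2 ⊢
  rw [← h, h2]

/-- The map from the dual to `A` is surjective by `rhit_mulRight_integral` and the dimensions agree.
Functionals can therefore be compared by their action on `t`. -/
theorem rhit_integral_injective : Function.Injective fun p : A →ₗ[k] k => rhit p t := by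
  have h : Function.Surjective ((rhitLin (k := k) (C := A)).flip t) := fun x =>
    ⟨_, rhit_mulRight_integral ht x⟩
  exact (LinearMap.injective_iff_surjective_of_finrank_eq_finrank
    (Subspace.dual_finrank_eq (K := k) (V := A))).2 h

/-- Both functionals of `x` carry `t` to `S(y)`. Thus `S²` is the Nakayama automorphism of the
Frobenius form `λ = dualIntegral`. -/
theorem dualIntegral_mul (x y : A) :
    dualIntegral k A (y * x) = dualIntegral k A (x * antipode k (antipode k y)) := by
  have h1 := rhit_mulLeft_integral ht (rhit_dualIntegral (k := k)) y
  have h2 := rhit_mulRight_integral ht (antipode k y)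
  rw [dualIntegral_integral ht, one_smul] at h1
  exact LinearMap.congr_fun (rhit_integral_injective ht (h1.trans h2.symm)) x

theorem dualIntegral_unique {l : A →ₗ[k] k} (hl : ∀ x, rhit l x = l x • 1) (x : A) :
    l x = l t * dualIntegral k A x := by
  have h1 := rhit_mulLeft_integral ht hl
  have h2 := rhit_mulLeft_integral ht (rhit_dualIntegral (k := k))
  have h3 : l ∘ₗ LinearMap.mulLeft k (1 : A) =
      l t • (dualIntegral k A ∘ₗ LinearMap.mulLeft k (1 : A)) := by
    apply rhit_integral_injective ht
    change rhit _ t = rhitLin (l t • _) t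
    rw [map_smul, LinearMap.smul_apply, rhitLin_apply, h1, h2, dualIntegral_integral ht, one_smul]
  simpa using LinearMap.congr_fun h3 x

omit ht in
/-- The distinguished group-like element. -/
def distinguished (t : A) : A := lhit (dualIntegral k A) t

/-- For any functional `p`, the convolution product of `dualIntegral` with `p` is an integral on the
same side, hence a multiple of `dualIntegral`. Evaluation at `t` shows that the factor is `p` of the
distinguished element. -/
theorem lhit_dualIntegral (x : A) :
    lhit (dualIntegral k A) x = dualIntegral k A x • distinguished (k := k) t := by
  rw [← sub_eq_zero, ← Module.forall_dual_apply_eq_zero_iff k]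
  intro p
  rw [map_sub, sub_eq_zero, map_smul]
  let l : A →ₗ[k] k := (toConv (dualIntegral k A) * toConv p : WithConv (A →ₗ[k] k)).ofConv
  have hl1 : ∀ x, l x = p (lhit (dualIntegral k A) x) := by
    intro x
    refine ((ℛ k x).convMul_apply (A := k) (toConv (dualIntegral k A)) (toConv p)).trans ?_
    rw [lhit_apply _ (ℛ k x)]
    simp
  have hl2 : ∀ x, l x = dualIntegral k A (rhit p x) := by
    intro x
    refine ((ℛ k x).convMul_apply (A := k) (toConv (dualIntegral k A)) (toConv p)).trans ?_
    rw [rhit_apply _ (ℛ k x)]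
    simp [mul_comm]
  have hl : ∀ x, rhit l x = l x • 1 := by
    intro x
    have := LinearMap.congr_fun (rhit_rhit (dualIntegral k A) p) x
    rw [hl2, ← rhit_dualIntegral]
    exact this.symm
  rw [← hl1, dualIntegral_unique ht hl, hl1, mul_comm]
  rfl

theorem isGroupLikeElem_distinguished : IsGroupLikeElem k (distinguished (k := k) t) where
  counit_eq_one := by
    rw [distinguished, lhit_apply _ (ℛ k t), ← dualIntegral_integral ht]
    conv_rhs => rw [← sum_smul_counit (ℛ k t)]
    simp [mul_comm]
  comul_eq_tmul_self := by
    conv_lhs => rw [distinguished, comul_lhit, ← (ℛ k t).eq]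
    simp only [map_sum, LinearMap.rTensor_tmul, lhit_dualIntegral ht, TensorProduct.smul_tmul]
    rw [← TensorProduct.tmul_sum, ← lhit_apply]
    rfl

/-- Group-like elements are linearly independent, so there are finitely many and two powers
coincide. The antipode supplies the inverse needed to cancel. -/
theorem exists_distinguished_pow : ∃ m, 0 < m ∧ distinguished (k := k) t ^ m = 1 := by
  have ha := isGroupLikeElem_distinguished ht
  have hfin : {a : A | IsGroupLikeElem k a}.Finite :=
    (linearIndepOn_isGroupLikeElem (R := k) (A := A)).linearIndependent.setFinite
  have : ¬ Function.Injective fun n : ℕ => distinguished (k := k) t ^ n := fun h =>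
    Set.infinite_of_injective_forall_mem h (fun n => ha.pow) hfin
  simp only [Function.Injective, not_forall] at this
  obtain ⟨i, j, hij, hne⟩ := this
  wlog h : i < j generalizing i j
  · exact this j i hij.symm (Ne.symm hne) (by omega)
  have h1 : distinguished (k := k) t * antipode k (distinguished (k := k) t) = 1 := by
    have := HopfAlgebra.mul_antipode_lTensor_comul_apply (R := k) (distinguished (k := k) t)
    rw [ha.comul_eq_tmul_self, ha.counit_eq_one] at this
    simpa using this
  have h2 : antipode k (distinguished (k := k) t) * distinguished (k := k) t = 1 := by
    have := HopfAlgebra.mul_antipode_rTensor_comul_apply (R := k) (distinguished (k := k) t)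
    rw [ha.comul_eq_tmul_self, ha.counit_eq_one] at this
    simpa using this
  let u : Aˣ := ⟨_, _, h1, h2⟩
  refine ⟨j - i, by omega, ?_⟩
  have h3 : u ^ i = u ^ j := Units.ext hij
  have h4 : u ^ (j - i) = 1 := by
    rw [← Nat.sub_add_cancel h.le, pow_add] at h3
    exact right_eq_mul.1 h3
  exact congrArg Units.val h4

/-- With `λ = dualIntegral`, `x` crosses `Δ(t)` to become `S(x)` inside `λ`. The Nakayama relation
turns it into `S³(x)` on the right, and a second crossing takes it out as `S⁴(x)`. -/
theorem mul_distinguished (x : A) : x * distinguished (k := k) t =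
    distinguished (k := k) t * antipode k (antipode k (antipode k (antipode k x))) := by
  have h1 := congrArg (fun w => TensorProduct.lid k A (LinearMap.rTensor A (dualIntegral k A) w))
    (antipode_tmul_one_mul_comul ht.mul_left x)
  have h2 := congrArg (fun w => TensorProduct.lid k A (LinearMap.rTensor A (dualIntegral k A) w))
    (comul_mul_tmul_one ht.mul_right (antipode k (antipode k (antipode k x))))
  rw [distinguished, lhit_apply _ (ℛ k t)]
  rw [← (ℛ k t).eq] at h1 h2
  simp only [Finset.sum_mul, Finset.mul_sum, map_sum,
    Algebra.TensorProduct.tmul_mul_tmul, mul_one, LinearMap.rTensor_tmul, TensorProduct.lid_tmul,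
    one_mul, smul_mul_assoc, mul_smul_comm] at h1 h2 ⊢
  rw [← h1, ← h2]
  refine Finset.sum_congr rfl fun i _ => ?_
  rw [dualIntegral_mul ht]

omit ht in
variable (k A) in
/-- The square of the antipode. -/
def antipodeSq : A →ₐ[k] A :=
  AlgHom.ofLinearMap (antipode k ∘ₗ antipode k) (by simp)
    (fun x y => by simp [HopfAlgebra.antipode_mul_antidistrib])

omit ht in
theorem antipodeSq_apply (x : A) : antipodeSq k A x = antipode k (antipode k x) := rfl

/-- The square of the antipode has finite order. -/
theorem exists_antipodeSq_iterate : ∃ m, 0 < m ∧ ∀ x : A, (antipodeSq k A)^[m] x = x := by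
  obtain ⟨m, hm, ha⟩ := exists_distinguished_pow ht
  refine ⟨2 * m, by omega, fun x => ?_⟩
  have h : ∀ j, x * distinguished (k := k) t ^ j =
      distinguished (k := k) t ^ j * (antipodeSq k A)^[2 * j] x := by
    intro j
    induction j with
    | zero => simp
    | succ j ih =>
      rw [pow_succ, ← mul_assoc, ih, mul_assoc, mul_distinguished ht, ← mul_assoc, ← pow_succ,
        show 2 * (j + 1) = (2 * j).succ.succ by omega, Function.iterate_succ_apply',
        Function.iterate_succ_apply']
      rfl
  have := h m
  rw [ha, one_mul, mul_one] at this
  exact this.symm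

/-- If the dual is unimodular and semisimple then the antipode has order dividing four. -/
theorem antipodeSq_antipodeSq (h0 : dualIntegral k A 1 ≠ 0) (x : A) :
    antipodeSq k A (antipodeSq k A x) = x := by
  -- Composition with the antipode makes `λ = dualIntegral` an integral on the other side.
  have h1 : ∀ x, lhit (dualIntegral k A ∘ₗ antipode k) x = dualIntegral k A (antipode k x) • 1 := by
    intro x
    apply (antipode_bijective k A).injective
    have h2 := LinearMap.congr_fun (comul_antipode (k := k) (A := A)) x
    have h3 := rhit_dualIntegral (k := k) (antipode k x)
    simp only [LinearMap.comp_apply] at h2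
    rw [rhit, LinearMap.comp_apply, LinearMap.comp_apply, h2, ← (ℛ k x).eq] at h3
    simpa [lhit_apply _ (ℛ k x)] using h3
  -- Computing `∑ λ(S(x₍₁₎)) λ(x₍₂₎)` from either side gives `λ(S x) λ(1) = λ(x) λ(1)`, and `λ(1)`
  -- cancels. So `λ` is a two-sided integral, and the distinguished element is `1`.
  have h2 : ∀ x, dualIntegral k A (antipode k x) = dualIntegral k A x := by
    intro x
    have e1 := congrArg (dualIntegral k A) (h1 x)
    have e2 := congrArg (dualIntegral k A ∘ₗ antipode k) (rhit_dualIntegral (k := k) x)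
    rw [lhit_apply _ (ℛ k x)] at e1
    rw [rhit_apply _ (ℛ k x)] at e2
    simp only [map_sum, map_smul, LinearMap.comp_apply, smul_eq_mul, HopfAlgebra.antipode_one]
      at e1 e2
    rw [Finset.sum_congr rfl fun i _ => mul_comm _ _, e1] at e2
    exact mul_right_cancel₀ h0 e2
  have h3 : distinguished (k := k) t = 1 := by
    have h4 : dualIntegral k A ∘ₗ antipode k = dualIntegral k A := LinearMap.ext h2
    have := h1 t
    rwa [h4, h2, dualIntegral_integral ht, one_smul] at this
  have := mul_distinguished ht x
  rw [h3, mul_one, one_mul] at this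
  exact this.symm

end Nakayama

/-! ### Traces of multiplication operators -/

section Trace
variable {k : Type*} [Field k]

/-- On `Hom(X, V) = X* ⊗ V` this operator is the transpose of `a` tensored with `v`. The proof tests
rank one maps. -/
theorem trace_hom {X V : Type*} [AddCommGroup X] [Module k X] [FiniteDimensional k X]
    [AddCommGroup V] [Module k V] [FiniteDimensional k V] (v : V →ₗ[k] V) (a : X →ₗ[k] X) :
    LinearMap.trace k (X →ₗ[k] V) (LinearMap.lcomp k V a ∘ₗ LinearMap.llcomp k X V V v) =
      LinearMap.trace k V v * LinearMap.trace k X a := by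
  obtain ⟨v, rfl⟩ := (dualTensorHomEquiv k V V).surjective v
  obtain ⟨a, rfl⟩ := (dualTensorHomEquiv k X X).surjective a
  induction v with
  | zero => simp
  | add v v' hv hv' => simp only [map_add, LinearMap.comp_add, hv, hv', add_mul]
  | tmul p w =>
    have hadd (a b : X →ₗ[k] X) :
        LinearMap.lcomp k V (a + b) = LinearMap.lcomp k V a + LinearMap.lcomp k V b := by
      ext
      simp
    have hzero : LinearMap.lcomp k V (0 : X →ₗ[k] X) = 0 := by
      ext
      simp
    induction a with
    | zero => simp [hzero]
    | add a a' ha ha' => simp only [map_add, hadd, LinearMap.add_comp, ha, ha', mul_add]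
    | tmul q x =>
      have h : LinearMap.lcomp k V (dualTensorHomEquiv k X X (q ⊗ₜ x)) ∘ₗ
          LinearMap.llcomp k X V V (dualTensorHomEquiv k V V (p ⊗ₜ w)) =
          (p ∘ₗ LinearMap.applyₗ x).smulRight (dualTensorHom k X V (q ⊗ₜ w)) := by
        ext φ y
        simp [dualTensorHomEquiv, smul_smul, mul_comm]
      rw [h, LinearMap.trace_smulRight]
      simp [dualTensorHomEquiv, LinearMap.trace_eq_contract_apply, mul_comm]

theorem trace_pi {ι : Type*} [Fintype ι] {M : ι → Type*} [∀ i, AddCommGroup (M i)]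
    [∀ i, Module k (M i)] [∀ i, FiniteDimensional k (M i)] (f : ∀ i, M i →ₗ[k] M i) :
    LinearMap.trace k (∀ i, M i) (LinearMap.pi fun i => f i ∘ₗ LinearMap.proj i) =
      ∑ i, LinearMap.trace k (M i) (f i) := by
  classical
  have h : (LinearMap.pi fun i => f i ∘ₗ LinearMap.proj i) =
      ∑ i, LinearMap.single k M i ∘ₗ (f i ∘ₗ LinearMap.proj i) := by
    ext x j
    simp [Finset.sum_apply]
  rw [h, map_sum]
  refine Finset.sum_congr rfl fun i _ => ?_
  rw [LinearMap.trace_comp_comm', LinearMap.comp_assoc, LinearMap.proj_comp_single_same,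
    LinearMap.comp_id]

variable {A : Type*} [Ring A] [Algebra k A] {ι : Type*} [Fintype ι] {V : ι → Type*}
  [∀ i, AddCommGroup (V i)] [∀ i, Module k (V i)] [∀ i, FiniteDimensional k (V i)]

theorem trace_mulLeft_mulRight (e : A ≃ₐ[k] ∀ i, Module.End k (V i)) (a b : A) :
    LinearMap.trace k A (LinearMap.mulLeft k a ∘ₗ LinearMap.mulRight k b) =
      ∑ i, LinearMap.trace k (V i) (e a i) * LinearMap.trace k (V i) (e b i) := by
  have h : e.toLinearEquiv.conj (LinearMap.mulLeft k a ∘ₗ LinearMap.mulRight k b) =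
      LinearMap.pi fun i => (LinearMap.lcomp k (V i) (e b i) ∘ₗ
        LinearMap.llcomp k (V i) (V i) (V i) (e a i)) ∘ₗ LinearMap.proj i := by
    ext x i v
    simp [LinearEquiv.conj_apply]
  rw [← LinearMap.trace_conj' _ e.toLinearEquiv, h, trace_pi]
  simp_rw [trace_hom]

/-- The sum of the characters of the factors. -/
def traceSum (e : A ≃ₐ[k] ∀ i, Module.End k (V i)) : A →ₗ[k] k :=
  ∑ i, LinearMap.trace k (V i) ∘ₗ LinearMap.proj i ∘ₗ e.toLinearMap

theorem traceSum_apply (e : A ≃ₐ[k] ∀ i, Module.End k (V i)) (a : A) :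
    traceSum e a = ∑ i, LinearMap.trace k (V i) (e a i) := by
  simp [traceSum]

theorem traceSum_mul_comm (e : A ≃ₐ[k] ∀ i, Module.End k (V i)) (a b : A) :
    traceSum e (a * b) = traceSum e (b * a) := by
  simp_rw [traceSum_apply, map_mul, Pi.mul_apply]
  exact Finset.sum_congr rfl fun i _ => LinearMap.trace_mul_comm _ _ _

/-- The trace form is nondegenerate: testing against the rank one map `p ⊗ v` in block `i` returns
`p(aᵢ v)`. -/
theorem eq_zero_of_traceSum (e : A ≃ₐ[k] ∀ i, Module.End k (V i)) {a : A}
    (h : ∀ x, traceSum e (x * a) = 0) : a = 0 := by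
  classical
  apply e.injective
  rw [map_zero]
  funext i
  ext v
  rw [Pi.zero_apply, LinearMap.zero_apply, ← Module.forall_dual_apply_eq_zero_iff k]
  intro p
  have h1 := h (e.symm (Pi.single i (dualTensorHom k (V i) (V i) (p ⊗ₜ v))))
  rw [traceSum_mul_comm, traceSum_apply, Finset.sum_eq_single i (fun j _ hj => by simp [hj])
    (by simp)] at h1
  have h2 : e a i * dualTensorHom k (V i) (V i) (p ⊗ₜ v) =
      dualTensorHom k (V i) (V i) (p ⊗ₜ (e a i v)) := by
    ext w
    simp
  simpa [h2, LinearMap.trace_eq_contract_apply] using h1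

theorem exists_eq_traceSum (e : A ≃ₐ[k] ∀ i, Module.End k (V i)) [FiniteDimensional k A]
    (l : A →ₗ[k] k) : ∃ g, ∀ x, l x = traceSum e (x * g) := by
  let B : A →ₗ[k] (A →ₗ[k] k) := (LinearMap.mul k A).flip.compr₂ (traceSum e)
  have hB : Function.Injective B := by
    rw [← LinearMap.ker_eq_bot, LinearMap.ker_eq_bot']
    intro a ha
    exact eq_zero_of_traceSum e fun x => LinearMap.congr_fun ha x
  obtain ⟨g, hg⟩ := (LinearMap.injective_iff_surjective_of_finrank_eq_finrank
    (Subspace.dual_finrank_eq (K := k) (V := A)).symm).1 hB l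
  exact ⟨g, fun x => (LinearMap.congr_fun hg x).symm⟩

end Trace

/-! ### The square of the antipode of a semisimple Hopf algebra -/

section LarsonRadford
open scoped ComplexOrder Matrix

/-- Write `G = γ Q` with `γᴺ = c`, so that `Qᴺ = 1` and `Q` is unitary for an averaged form. Hence
the trace of `Q⁻¹ = γ G'` is the conjugate of `tr Q`. Since `tr G' = 1`, it is also `γ`, and `tr G =
γ tr Q = |γ|²`. -/
theorem Matrix.exists_trace_eq_of_pow {n : Type*} [Fintype n] [DecidableEq n] {G G' : Matrix n n ℂ}
    (h : G * G' = 1) {N : ℕ} (hN : 0 < N) {c : ℂ} (hc : G ^ N = c • 1) (ht : G'.trace = 1) :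
    ∃ r : ℝ, 0 < r ∧ G.trace = r := by
  have hne : Nonempty n := by
    by_contra hn
    rw [not_nonempty_iff] at hn
    simp [Matrix.trace] at ht
  have hc0 : c ≠ 0 := by
    rintro rfl
    have h1 : IsUnit (G ^ N) := ((Matrix.isUnit_iff_isUnit_det _).2
      (Matrix.isUnit_det_of_right_inverse h)).pow N
    rw [hc, zero_smul] at h1
    exact not_isUnit_zero h1
  obtain ⟨γ, hγ⟩ := IsAlgClosed.exists_pow_nat_eq c hN
  have hγ0 : γ ≠ 0 := by
    rintro rfl
    rw [zero_pow hN.ne'] at hγ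
    exact hc0 hγ.symm
  let Q : Matrix n n ℂ := γ⁻¹ • G
  have hQN : Q ^ N = 1 := by
    rw [smul_pow, hc, smul_smul, inv_pow, hγ, inv_mul_cancel₀ hc0, one_smul]
  have hQ : Q * (γ • G') = 1 := by
    rw [smul_mul_smul_comm, h, inv_mul_cancel₀ hγ0, one_smul]
  let P : Matrix n n ℂ := ∑ j ∈ Finset.range N, (Q ^ j)ᴴ * Q ^ j
  have hP : P.PosDef := by
    -- The term `j = 0` is the identity and makes the sum definite; the other terms are only
    -- semidefinite.
    obtain ⟨M, rfl⟩ : ∃ M, N = M + 1 := ⟨N - 1, by omega⟩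
    simp only [P, Finset.sum_range_succ']
    rw [pow_zero, Matrix.conjTranspose_one, one_mul]
    exact Matrix.PosDef.posSemidef_add
      (Matrix.posSemidef_sum _ fun j _ => Matrix.posSemidef_conjTranspose_mul_self _)
      Matrix.PosDef.one
  -- Conjugation shifts the index by one, and `Qᴺ = 1` closes the cycle.
  have hQP : Qᴴ * P * Q = P := by
    have h1 : Qᴴ * P * Q = ∑ j ∈ Finset.range N, (Q ^ (j + 1))ᴴ * Q ^ (j + 1) := by
      simp only [P, Finset.mul_sum, Finset.sum_mul]
      refine Finset.sum_congr rfl fun j _ => ?_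
      rw [pow_succ, Matrix.conjTranspose_mul]
      simp only [mul_assoc]
    have h2 := Finset.sum_range_succ (fun j => (Q ^ j)ᴴ * Q ^ j) N
    rw [Finset.sum_range_succ', hQN, pow_zero] at h2
    rw [h1]
    exact add_right_cancel h2
  have hPd := (Matrix.isUnit_iff_isUnit_det _).1 hP.isUnit
  have h3 : γ • G' = P⁻¹ * (Qᴴ * P) := by
    calc γ • G' = P⁻¹ * P * (γ • G') := by rw [Matrix.nonsing_inv_mul _ hPd, one_mul]
      _ = P⁻¹ * (Qᴴ * P * Q) * (γ • G') := by rw [hQP]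
      _ = P⁻¹ * (Qᴴ * P) * (Q * (γ • G')) := by simp only [mul_assoc]
      _ = _ := by rw [hQ, mul_one]
  have h4 : γ = star Q.trace := by
    have := congrArg Matrix.trace h3
    rwa [Matrix.trace_smul, ht, smul_eq_mul, mul_one, Matrix.trace_mul_comm, mul_assoc,
      Matrix.mul_nonsing_inv _ hPd, mul_one, Matrix.trace_conjTranspose] at this
  refine ⟨Complex.normSq γ, Complex.normSq_pos.2 hγ0, ?_⟩
  have h5 : G.trace = γ * Q.trace := by
    rw [Matrix.trace_smul, smul_eq_mul, mul_inv_cancel_left₀ hγ0]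
  have h6 : Q.trace = star γ := by rw [h4, star_star]
  rw [h5, h6, Complex.normSq_eq_conj_mul_self, mul_comm]
  rfl

theorem exists_trace_eq_of_pow {V : Type*} [AddCommGroup V] [Module ℂ V] [FiniteDimensional ℂ V]
    {G G' : Module.End ℂ V} (h : G * G' = 1) {N : ℕ} (hN : 0 < N) {c : ℂ} (hc : G ^ N = c • 1)
    (ht : LinearMap.trace ℂ V G' = 1) : ∃ r : ℝ, 0 < r ∧ LinearMap.trace ℂ V G = r := by
  let b := Module.finBasis ℂ V
  have e (f) : LinearMap.trace ℂ V f = (LinearMap.toMatrixAlgEquiv b f).trace := by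
    rw [LinearMap.trace_eq_matrix_trace ℂ b]
    rfl
  rw [e] at ht ⊢
  exact Matrix.exists_trace_eq_of_pow (c := c) (by rw [← map_mul, h, map_one]) hN
    (by rw [← map_pow, hc, map_smul, map_one]) ht

variable {A : Type*} [Ring A] [HopfAlgebra ℂ A] [FiniteDimensional ℂ A] [IsSemisimpleRing A]

/-- The value in question is the trace of `S²`. It equals `∑ tr(gᵢ)` for an element `g` that
represents the integral and implements `S²`. Each summand is positive because `tr(gᵢ⁻¹) = 1` and
some power of `gᵢ` is scalar. -/
theorem dualIntegral_one_ne_zero : dualIntegral ℂ A 1 ≠ 0 := by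
  classical
  obtain ⟨t, ht⟩ := exists_isNormalizedIntegral ℂ A
  obtain ⟨n, d, hd, ⟨e₀⟩⟩ := IsSemisimpleRing.exists_algEquiv_pi_matrix_of_isAlgClosed ℂ A
  let e : A ≃ₐ[ℂ] ∀ i, Module.End ℂ (Fin (d i) → ℂ) :=
    e₀.trans (AlgEquiv.piCongrRight fun i => Matrix.toLinAlgEquiv')
  obtain ⟨g, hg⟩ := exists_eq_traceSum e (dualIntegral ℂ A)
  -- This is the Nakayama relation read through the nondegenerate trace form.
  have hgs : ∀ y, g * y = antipodeSq ℂ A y * g := by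
    intro y
    rw [← sub_eq_zero]
    refine eq_zero_of_traceSum e fun x => ?_
    have h := dualIntegral_mul ht x y
    rw [hg, hg] at h
    rw [mul_sub, map_sub, sub_eq_zero, ← mul_assoc, traceSum_mul_comm, ← mul_assoc, ← mul_assoc, h]
    rfl
  -- If `g y = 0` then `S²(y) g = 0`, so `dualIntegral` kills every `x S²(y)`; its action on `t`
  -- then gives `S(y) = 0`.
  have hinj : Function.Injective (LinearMap.mulLeft ℂ g) := by
    rw [← LinearMap.ker_eq_bot, LinearMap.ker_eq_bot']
    intro y hy
    have h1 : dualIntegral ℂ A ∘ₗ LinearMap.mulRight ℂ (antipode ℂ (antipode ℂ y)) = 0 := by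
      ext x
      rw [LinearMap.comp_apply, LinearMap.mulRight_apply, hg, mul_assoc]
      have : antipode ℂ (antipode ℂ y) * g = 0 := (hgs y).symm.trans hy
      simp [this]
    have h2 := rhit_mulRight_integral ht (antipode ℂ y)
    rw [h1] at h2
    apply (antipode_bijective ℂ A).injective
    rw [← h2, map_zero]
    simp [rhit]
  obtain ⟨g', hg'⟩ := LinearMap.injective_iff_surjective.1 hinj 1
  rw [LinearMap.mulLeft_apply] at hg'
  have hg'' : g' * g = 1 := by
    apply hinj
    simp [← mul_assoc, hg']
  have hs : ∀ y, antipodeSq ℂ A y = g * y * g' := by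
    intro y
    rw [hgs, mul_assoc, hg', mul_one]
  have htr : ∀ x, dualIntegral ℂ A x =
      ∑ i, LinearMap.trace ℂ _ (e (x * g) i) * LinearMap.trace ℂ _ (e g' i) := by
    intro x
    rw [dualIntegral_apply, ← trace_mulLeft_mulRight e]
    congr 1
    ext y
    simp only [LinearMap.comp_apply, LinearMap.mulLeft_apply, LinearMap.mulRight_apply]
    rw [← antipodeSq_apply, hs]
    simp only [mul_assoc]
  have hg1 : ∀ i, LinearMap.trace ℂ _ (e g' i) = 1 := by
    intro i
    -- Evaluate the two expressions for the integral at `eᵢ g'`, with `eᵢ` the block idempotent: one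
    -- gives `dᵢ`, the other `dᵢ tr(g'ᵢ)`.
    have h := (hg (e.symm (Pi.single i 1) * g')).symm.trans (htr (e.symm (Pi.single i 1) * g'))
    rw [mul_assoc, hg'', mul_one, traceSum_apply, e.apply_symm_apply,
      Finset.sum_eq_single i (fun j _ hj => by simp [hj]) (by simp),
      Finset.sum_eq_single i (fun j _ hj => by simp [hj]) (by simp), Pi.single_eq_same,
      LinearMap.trace_one] at h
    have hd' : ((Module.finrank ℂ (Fin (d i) → ℂ) : ℕ) : ℂ) ≠ 0 := by
      simp [(hd i).out]
    exact (mul_eq_left₀ hd').1 h.symm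
  obtain ⟨N, hN, hsN⟩ := exists_antipodeSq_iterate (k := ℂ) ht
  -- Conjugation by `gᴺ` is the `N`-th iterate of `S²`, that is the identity; hence `gᴺ` is central
  -- and scalar in each block.
  have hcomm : ∀ y, y * g ^ N = g ^ N * y := by
    have h : ∀ j y, g ^ j * y = (antipodeSq ℂ A)^[j] y * g ^ j := by
      intro j
      induction j with
      | zero => simp
      | succ j ih =>
        intro y
        rw [pow_succ, mul_assoc, hgs, ← mul_assoc, ih, Function.iterate_succ_apply, mul_assoc]
    intro y
    rw [h, hsN]
  have hc : ∀ i, ∃ c : ℂ, (e g i) ^ N = c • 1 := by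
    intro i
    have h1 : (e g i) ^ N ∈ Subalgebra.center ℂ (Module.End ℂ (Fin (d i) → ℂ)) := by
      rw [Subalgebra.mem_center_iff]
      intro b
      have h2 := congrFun (congrArg e (hcomm (e.symm (Pi.single i b)))) i
      simpa using h2
    rw [Algebra.IsCentral.center_eq_bot, Algebra.mem_bot] at h1
    obtain ⟨c, hc⟩ := h1
    exact ⟨c, by rw [← hc, Algebra.algebraMap_eq_smul_one]⟩
  choose c hc using hc
  have hpos : ∀ i, ∃ r : ℝ, 0 < r ∧ LinearMap.trace ℂ _ (e g i) = r := fun i =>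
    exists_trace_eq_of_pow (by simpa using congrFun (congrArg e hg') i) hN (hc i) (hg1 i)
  choose r hr hr' using hpos
  have : Nonempty (Fin n) := by
    by_contra hn
    rw [not_nonempty_iff] at hn
    have : Subsingleton A := e.injective.subsingleton
    have h1 := ht.counit_eq
    rw [Subsingleton.elim t 0, map_zero] at h1
    exact zero_ne_one h1
  rw [hg, one_mul, traceSum_apply, Finset.sum_congr rfl fun i _ => hr' i, ← Complex.ofReal_sum]
  exact Complex.ofReal_ne_zero.2 (Finset.sum_pos (fun i _ => hr i) Finset.univ_nonempty).ne'

end LarsonRadford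

/-! ### Characters of the regular comodule -/

section RegularTrace
variable {k : Type*} [Field k] {C D : Type*} [AddCommGroup C] [Module k C] [Coalgebra k C]
  [AddCommGroup D] [Module k D] [Coalgebra k D]

theorem lhit_dualDistrib (f : C →ₗ[k] k) (g : D →ₗ[k] k) :
    lhit (TensorProduct.dualDistrib k C D (f ⊗ₜ g)) = TensorProduct.map (lhit f) (lhit g) := by
  refine TensorProduct.ext' fun x y => ?_
  rw [TensorProduct.map_tmul, lhit_apply f (ℛ k x), lhit_apply g (ℛ k y), lhit,
    LinearMap.comp_apply, LinearMap.comp_apply, TensorProduct.comul_tmul]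
  conv_lhs => rw [← (ℛ k x).eq, ← (ℛ k y).eq]
  simp only [TensorProduct.sum_tmul, TensorProduct.tmul_sum, map_sum]
  refine Finset.sum_congr rfl fun i _ => Finset.sum_congr rfl fun j _ => ?_
  simp [TensorProduct.smul_tmul', TensorProduct.tmul_smul, smul_smul, mul_comm]

theorem rhit_dualDistrib (f : C →ₗ[k] k) (g : D →ₗ[k] k) :
    rhit (TensorProduct.dualDistrib k C D (f ⊗ₜ g)) = TensorProduct.map (rhit f) (rhit g) := by
  refine TensorProduct.ext' fun x y => ?_
  rw [TensorProduct.map_tmul, rhit_apply f (ℛ k x), rhit_apply g (ℛ k y), rhit,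
    LinearMap.comp_apply, LinearMap.comp_apply, TensorProduct.comul_tmul]
  conv_lhs => rw [← (ℛ k x).eq, ← (ℛ k y).eq]
  simp only [TensorProduct.sum_tmul, TensorProduct.tmul_sum, map_sum]
  refine Finset.sum_congr rfl fun i _ => Finset.sum_congr rfl fun j _ => ?_
  simp [TensorProduct.smul_tmul', TensorProduct.tmul_smul, smul_smul, mul_comm]

variable [FiniteDimensional k C] [FiniteDimensional k D]

theorem dualDistrib_surjective : Function.Surjective (TensorProduct.dualDistrib k C D) := by
  intro f
  obtain ⟨φ, rfl⟩ := (TensorProduct.dualDistribEquiv k C D).surjective f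
  exact ⟨φ, by simp [TensorProduct.dualDistribEquiv, TensorProduct.dualDistribEquivOfBasis]⟩

/-- Elements representing the regular trace multiply under tensor products of coalgebras. No algebra
structure enters, which is what makes this usable for the twisted product of the double. -/
theorem apply_tmul_eq_trace_lhit {c d : k} {x : C} {y : D}
    (hx : ∀ f : C →ₗ[k] k, c * f x = LinearMap.trace k C (lhit f))
    (hy : ∀ f : D →ₗ[k] k, d * f y = LinearMap.trace k D (lhit f)) (f : C ⊗[k] D →ₗ[k] k) :
    c * d * f (x ⊗ₜ y) = LinearMap.trace k (C ⊗[k] D) (lhit f) := by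
  obtain ⟨φ, rfl⟩ := dualDistrib_surjective f
  induction φ with
  | zero =>
    rw [← lhitLin_apply]
    simp
  | add f g hf hg =>
    rw [← lhitLin_apply] at hf hg ⊢
    simp only [map_add, LinearMap.add_apply, mul_add, hf, hg]
  | tmul f g =>
    rw [lhit_dualDistrib, LinearMap.trace_tensorProduct', ← hx, ← hy]
    simp only [TensorProduct.dualDistrib_apply]
    ring

theorem apply_tmul_eq_trace_rhit {x : C} {y : D}
    (hx : ∀ f : C →ₗ[k] k, f x = LinearMap.trace k C (rhit f))
    (hy : ∀ f : D →ₗ[k] k, f y = LinearMap.trace k D (rhit f)) (f : C ⊗[k] D →ₗ[k] k) :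
    f (x ⊗ₜ y) = LinearMap.trace k (C ⊗[k] D) (rhit f) := by
  obtain ⟨φ, rfl⟩ := dualDistrib_surjective f
  induction φ with
  | zero =>
    rw [← rhitLin_apply]
    simp
  | add f g hf hg =>
    rw [← rhitLin_apply] at hf hg ⊢
    simp only [map_add, LinearMap.add_apply, hf, hg]
  | tmul f g =>
    rw [rhit_dualDistrib, LinearMap.trace_tensorProduct', ← hx, ← hy]
    simp only [TensorProduct.dualDistrib_apply]

theorem exists_regularTrace : ∃ x : C, ∀ f : C →ₗ[k] k, f x = LinearMap.trace k C (rhit f) := by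
  obtain ⟨x, hx⟩ := (Module.evalEquiv k C).surjective (LinearMap.trace k C ∘ₗ rhitLin)
  exact ⟨x, fun f => LinearMap.congr_fun hx f⟩

end RegularTrace

/-! ### The regular character of the dual and its square -/

section RegularElement
variable {k A : Type*} [Field k] [Ring A] [HopfAlgebra k A]

/-- `y ⊗ z ↦ y₍₁₎ ⊗ y₍₂₎ z` -/
def twistMul : A ⊗[k] A →ₗ[k] A ⊗[k] A :=
  LinearMap.lTensor A (LinearMap.mul' k A) ∘ₗ (TensorProduct.assoc k A A A).toLinearMap ∘ₗ
    LinearMap.rTensor A comul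

theorem twistMul_tmul {ι : Type*} {y : A} (r : Coalgebra.Repr k y ι) (z : A) :
    twistMul (k := k) (y ⊗ₜ z) = ∑ i ∈ r.index, r.left i ⊗ₜ (r.right i * z) := by
  simp [twistMul, ← r.eq, TensorProduct.sum_tmul]

/-- `y ⊗ z ↦ y₍₁₎ ⊗ S(y₍₂₎) z` -/
def untwistMul : A ⊗[k] A →ₗ[k] A ⊗[k] A :=
  LinearMap.lTensor A (LinearMap.mul' k A) ∘ₗ (TensorProduct.assoc k A A A).toLinearMap ∘ₗ
    LinearMap.rTensor A (LinearMap.lTensor A (antipode k) ∘ₗ comul)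

theorem twistMul_comp_untwistMul :
    (twistMul : A ⊗[k] A →ₗ[k] A ⊗[k] A) ∘ₗ untwistMul = LinearMap.id := by
  refine TensorProduct.ext' fun y z => ?_
  let L : A ⊗[k] (A ⊗[k] A) →ₗ[k] A ⊗[k] A :=
    LinearMap.lTensor A (TensorProduct.lift ((LinearMap.mul k A).compl₂
      (LinearMap.mulRight k z ∘ₗ antipode k)))
  have h : ∀ w : A ⊗[k] A, twistMul (LinearMap.lTensor A (LinearMap.mul' k A)
      (TensorProduct.assoc k A A A (LinearMap.lTensor A (antipode k) w ⊗ₜ z))) =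
      L (TensorProduct.assoc k A A A (LinearMap.rTensor A comul w)) := by
    intro w
    induction w with
    | zero => simp
    | add x y hx hy => simp only [map_add, TensorProduct.add_tmul, hx, hy]
    | tmul p q =>
      simp only [LinearMap.lTensor_tmul, TensorProduct.assoc_tmul, LinearMap.mul'_apply,
        twistMul_tmul (ℛ k p), LinearMap.rTensor_tmul]
      conv_rhs => rw [← (ℛ k p).eq]
      simp [L, TensorProduct.sum_tmul]
  have h2 : untwistMul (k := k) (y ⊗ₜ z) = LinearMap.lTensor A (LinearMap.mul' k A)
      (TensorProduct.assoc k A A A (LinearMap.lTensor A (antipode k) (comul y) ⊗ₜ z)) := rfl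
  rw [LinearMap.comp_apply, h2, h, Coalgebra.coassoc_apply, ← (ℛ k y).eq]
  simp only [map_sum, LinearMap.lTensor_tmul, L, LinearMap.id_apply]
  have h3 : ∀ b : A, TensorProduct.lift ((LinearMap.mul k A).compl₂
      (LinearMap.mulRight k z ∘ₗ antipode k)) (comul b) = counit (R := k) b • z := by
    intro b
    have := congrArg (· * z) (sum_mul_antipode_eq_smul (ℛ k b))
    simp only [Finset.sum_mul, smul_mul_assoc, one_mul] at this
    rw [← this, ← (ℛ k b).eq]
    simp [mul_assoc]
  simp only [h3, TensorProduct.tmul_smul]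
  conv_rhs => rw [← sum_smul_counit (ℛ k y), TensorProduct.sum_tmul]
  simp [TensorProduct.smul_tmul']

/-- Both sides send `y ⊗ z` to `∑ p(y₍₃₎ z₍₂₎) y₍₁₎ ⊗ y₍₂₎ z₍₁₎`. This untwists the tensor square of
the regular comodule into `dim A` copies of it. -/
theorem twistMul_rhit (p : A →ₗ[k] k) :
    twistMul ∘ₗ rhit (p ∘ₗ LinearMap.mul' k A) = LinearMap.lTensor A (rhit p) ∘ₗ twistMul := by
  refine TensorProduct.ext' fun y z => ?_
  let L : A ⊗[k] (A ⊗[k] A) →ₗ[k] A ⊗[k] A :=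
    LinearMap.lTensor A ((TensorProduct.rid k A).toLinearMap ∘ₗ LinearMap.lTensor A p ∘ₗ
      LinearMap.mulRight k (comul z))
  have h1 : rhit (p ∘ₗ LinearMap.mul' k A) (y ⊗ₜ z) = ∑ i ∈ (ℛ k y).index, ∑ j ∈ (ℛ k z).index,
      p ((ℛ k y).right i * (ℛ k z).right j) • ((ℛ k y).left i ⊗ₜ (ℛ k z).left j) := by
    rw [rhit, LinearMap.comp_apply, LinearMap.comp_apply, TensorProduct.comul_tmul]
    conv_lhs => rw [← (ℛ k y).eq, ← (ℛ k z).eq]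
    simp only [TensorProduct.sum_tmul, TensorProduct.tmul_sum, map_sum]
    rw [Finset.sum_comm]
    rfl
  have h2 : twistMul (rhit (p ∘ₗ LinearMap.mul' k A) (y ⊗ₜ z)) =
      L (TensorProduct.assoc k A A A (LinearMap.rTensor A comul (comul y))) := by
    rw [h1]
    conv_rhs => rw [← (ℛ k y).eq]
    simp only [map_sum, map_smul, LinearMap.rTensor_tmul]
    refine Finset.sum_congr rfl fun i _ => ?_
    simp only [twistMul_tmul (ℛ k ((ℛ k y).left i))]
    conv_rhs => rw [← (ℛ k ((ℛ k y).left i)).eq]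
    simp only [TensorProduct.sum_tmul, map_sum, TensorProduct.assoc_tmul, L,
      LinearMap.lTensor_tmul, LinearMap.comp_apply, LinearMap.mulRight_apply]
    conv_rhs => rw [← (ℛ k z).eq]
    simp only [Finset.mul_sum, map_sum, Algebra.TensorProduct.tmul_mul_tmul,
      LinearMap.lTensor_tmul, LinearEquiv.coe_coe, TensorProduct.rid_tmul, Finset.smul_sum,
      TensorProduct.tmul_sum, TensorProduct.tmul_smul]
    exact Finset.sum_comm
  have h3 : LinearMap.lTensor A (rhit p) (twistMul (y ⊗ₜ z)) =
      L (LinearMap.lTensor A comul (comul y)) := by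
    rw [twistMul_tmul (ℛ k y)]
    conv_rhs => rw [← (ℛ k y).eq]
    simp only [map_sum, LinearMap.lTensor_tmul, L, rhit, LinearMap.comp_apply, Bialgebra.comul_mul,
      LinearMap.mulRight_apply]
  rw [LinearMap.comp_apply, LinearMap.comp_apply, h2, h3, Coalgebra.coassoc_apply]

variable [FiniteDimensional k A]

theorem trace_rhit_mul (p : A →ₗ[k] k) :
    LinearMap.trace k (A ⊗[k] A) (rhit (p ∘ₗ LinearMap.mul' k A)) =
      Module.finrank k A * LinearMap.trace k A (rhit p) := by
  have h1 := twistMul_comp_untwistMul (k := k) (A := A)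
  have h2 : (untwistMul : A ⊗[k] A →ₗ[k] A ⊗[k] A) ∘ₗ twistMul = LinearMap.id :=
    mul_eq_one_comm.1 h1
  have h3 : rhit (p ∘ₗ LinearMap.mul' k A) =
      untwistMul ∘ₗ LinearMap.lTensor A (rhit p) ∘ₗ twistMul := by
    rw [← twistMul_rhit, ← LinearMap.comp_assoc, h2, LinearMap.id_comp]
  rw [h3, LinearMap.trace_comp_comm', LinearMap.comp_assoc, h1, LinearMap.comp_id,
    LinearMap.lTensor, LinearMap.trace_tensorProduct', LinearMap.trace_id]

/-- The element representing the regular character of the dual is a multiple of an idempotent. -/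
theorem mul_self_of_regularTrace {x : A} (hx : ∀ f : A →ₗ[k] k, f x = LinearMap.trace k A (rhit f)) :
    x * x = (Module.finrank k A : k) • x := by
  rw [← sub_eq_zero, ← Module.forall_dual_apply_eq_zero_iff k]
  intro p
  have h := apply_tmul_eq_trace_rhit hx hx (p ∘ₗ LinearMap.mul' k A)
  rw [trace_rhit_mul, ← hx] at h
  rw [map_sub, sub_eq_zero, map_smul, smul_eq_mul, ← h]
  simp

theorem comul_antipodeSq (x : A) : comul (R := k) (antipodeSq k A x) =
    TensorProduct.map (antipodeSq k A).toLinearMap (antipodeSq k A).toLinearMap (comul x) := by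
  have h := fun q => LinearMap.congr_fun (comul_antipode (k := k) (A := A)) q
  simp only [LinearMap.comp_apply] at h
  rw [antipodeSq_apply, h, h]
  rw [← (ℛ k x).eq]
  simp [antipodeSq_apply]

end RegularElement

/-! ### Counting eigenvalues of the square of the antipode -/

section Involutive

theorem exists_trace_eq_natCast {k V : Type*} [Field k] [AddCommGroup V] [Module k V]
    [FiniteDimensional k V] {f : Module.End k V} (hf : IsIdempotentElem f) :
    ∃ r : ℕ, LinearMap.trace k V f = r :=
  ⟨_, (LinearMap.IsIdempotentElem.isProj_range f hf).trace⟩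

/-- The eigenspaces of `s` for `1` and `-1` have dimensions `r` and `q` with sum `dim V`. The trace
`r - q` is nonzero and `dim V` times an integer, since `π` commutes with `s`. So one eigenspace is
everything, and the fixed vector excludes `-1`. -/
theorem eq_one_of_trace_eq_mul {V : Type*} [AddCommGroup V] [Module ℂ V] [FiniteDimensional ℂ V]
    {s π : Module.End ℂ V} (hs : s * s = 1) (hπ : π * π = π) (hc : s * π = π * s)
    (h0 : LinearMap.trace ℂ V s ≠ 0)
    (h : LinearMap.trace ℂ V s = Module.finrank ℂ V * LinearMap.trace ℂ V (π * s))
    (hv : ∃ v ≠ 0, s v = v) : s = 1 := by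
  let a : Module.End ℂ V := (2⁻¹ : ℂ) • (1 + s)
  let b : Module.End ℂ V := (2⁻¹ : ℂ) • (1 - s)
  have h4 : (2⁻¹ * 2⁻¹ * 2 : ℂ) = 2⁻¹ := by norm_num
  have ha : a * a = a := by
    have : (1 + s) * (1 + s) = (2 : ℂ) • (1 + s) := by
      rw [mul_add, add_mul, add_mul, hs, two_smul]
      simp only [one_mul, mul_one]
      abel
    simp only [a, smul_mul_smul_comm, this, smul_smul, h4]
  have hb : b * b = b := by
    have : (1 - s) * (1 - s) = (2 : ℂ) • (1 - s) := by
      rw [mul_sub, sub_mul, sub_mul, hs, two_smul]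
      simp only [one_mul, mul_one]
      abel
    simp only [b, smul_mul_smul_comm, this, smul_smul, h4]
  have hπa : a * π = π * a := by simp [a, add_mul, mul_add, hc]
  have hπb : b * π = π * b := by simp [b, sub_mul, mul_sub, hc]
  have hi {e : Module.End ℂ V} (he : e * e = e) (heπ : e * π = π * e) :
      IsIdempotentElem (π * e) := by
    rw [IsIdempotentElem, mul_assoc, ← mul_assoc e, heπ, mul_assoc, he, ← mul_assoc, hπ]
  have hab : a + b = 1 := by
    simp only [a, b, ← smul_add]
    rw [add_add_sub_cancel, ← two_smul ℂ, smul_smul, inv_mul_cancel₀ two_ne_zero, one_smul]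
  have hab' : a - b = s := by
    simp only [a, b, ← smul_sub]
    rw [add_sub_sub_cancel, ← two_smul ℂ, smul_smul, inv_mul_cancel₀ two_ne_zero, one_smul]
  obtain ⟨r, hr⟩ := exists_trace_eq_natCast ha
  obtain ⟨q, hq⟩ := exists_trace_eq_natCast hb
  obtain ⟨r', hr'⟩ := exists_trace_eq_natCast (hi ha hπa)
  obtain ⟨q', hq'⟩ := exists_trace_eq_natCast (hi hb hπb)
  -- From here on, traces of idempotents are natural numbers, and the hypotheses become integer
  -- equations.
  have hn : r + q = Module.finrank ℂ V := by
    have := congrArg (LinearMap.trace ℂ V) hab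
    rw [map_add, hr, hq, LinearMap.trace_one] at this
    exact_mod_cast this
  have h1 : (r : ℤ) - q = Module.finrank ℂ V * (r' - q') := by
    rw [← hab', mul_sub, map_sub, map_sub, hr, hq, hr', hq'] at h
    exact_mod_cast h
  have h2 : (r : ℤ) - q ≠ 0 := by
    rw [← hab', map_sub, hr, hq] at h0
    exact_mod_cast h0
  have h3 : r ≠ 0 := by
    rintro rfl
    have h5 : a = 0 := (LinearMap.IsIdempotentElem.trace_eq_zero_iff ha).1 (by simpa using hr)
    obtain ⟨v, hv0, hv⟩ := hv
    have := LinearMap.congr_fun h5 v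
    simp [a, hv, ← two_smul ℂ, hv0] at this
  have h5 : q = 0 := by
    have h6 := Int.le_of_dvd (a := Module.finrank ℂ V) (b := |(r : ℤ) - q|) (abs_pos.2 h2)
      ((dvd_abs _ _).2 ⟨_, h1⟩)
    rw [le_abs] at h6
    omega
  have h6 : b = 0 := (LinearMap.IsIdempotentElem.trace_eq_zero_iff hb).1 (by simpa [h5] using hq)
  rw [← hab', ← hab, h6, sub_zero, add_zero]

variable {A : Type*} [Ring A] [HopfAlgebra ℂ A] [FiniteDimensional ℂ A] [IsSemisimpleRing A]

/-- The antipode of a semisimple complex Hopf algebra is an involution. -/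
theorem antipode_antipode (x : A) : antipode ℂ (antipode ℂ x) = x := by
  obtain ⟨t, ht⟩ := exists_isNormalizedIntegral ℂ A
  have h0 := dualIntegral_one_ne_zero (A := A)
  have hss := antipodeSq_antipodeSq ht h0
  let s : Module.End ℂ A := (antipodeSq ℂ A).toLinearMap
  have hs : s * s = 1 := LinearMap.ext hss
  have : Nontrivial A := by
    refine ⟨1, 0, fun h => ?_⟩
    have := congrArg (counit (R := ℂ)) h
    simp at this
  have hn : (Module.finrank ℂ A : ℂ) ≠ 0 := Nat.cast_ne_zero.2 Module.finrank_pos.ne'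
  obtain ⟨z, hz⟩ := exists_regularTrace (k := ℂ) (C := A)
  have hzz := mul_self_of_regularTrace hz
  -- `S²` is a coalgebra automorphism, so it fixes the element representing the regular trace.
  have hsz : antipodeSq ℂ A z = z := by
    rw [← sub_eq_zero, ← Module.forall_dual_apply_eq_zero_iff ℂ]
    intro p
    have h1 : s ∘ₗ rhit (p ∘ₗ s) = rhit p ∘ₗ s := by
      ext y
      simp only [LinearMap.comp_apply, rhit, s, AlgHom.toLinearMap_apply, comul_antipodeSq]
      rw [← (ℛ ℂ y).eq]
      simp
    have h2 : rhit (p ∘ₗ s) = s ∘ₗ rhit p ∘ₗ s := by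
      rw [← h1, ← LinearMap.comp_assoc]
      change _ = (s * s) ∘ₗ _
      rw [hs]
      rfl
    have h3 : rhit p ∘ₗ s ∘ₗ s = rhit p := by
      change _ ∘ₗ (s * s) = _
      rw [hs]
      rfl
    have h4 := hz (p ∘ₗ s)
    rw [h2, LinearMap.trace_comp_comm', LinearMap.comp_assoc, h3, ← hz] at h4
    rw [map_sub, sub_eq_zero]
    exact h4
  have hl : ∀ y, dualIntegral ℂ A y = LinearMap.trace ℂ A (LinearMap.mulLeft ℂ y * s) :=
    dualIntegral_apply
  have hs1 : dualIntegral ℂ A 1 = LinearMap.trace ℂ A s := by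
    rw [hl, LinearMap.mulLeft_one]
    rfl
  -- `rhit` of the integral has rank one, with image spanned by `1`. Hence `tr(L_z S²) = tr(S²)`,
  -- and with `π = L_z / dim A` this is the trace identity needed below.
  have hlz : dualIntegral ℂ A z = dualIntegral ℂ A 1 := by
    have h1 : rhit (dualIntegral ℂ A) = (dualIntegral ℂ A).smulRight (1 : A) :=
      LinearMap.ext rhit_dualIntegral
    rw [hz, h1, LinearMap.trace_smulRight]
  let π : Module.End ℂ A := (Module.finrank ℂ A : ℂ)⁻¹ • LinearMap.mulLeft ℂ z
  have h := eq_one_of_trace_eq_mul (s := s) (π := π) hs ?_ ?_ ?_ ?_ ⟨1, one_ne_zero, map_one (antipodeSq ℂ A)⟩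
  · exact LinearMap.congr_fun h x
  · ext y
    simp [π, ← mul_assoc, hzz, smul_smul, hn]
  · ext y
    simp [π, s, hsz]
  · rwa [← hs1]
  · rw [← hs1, ← hlz, hl, smul_mul_assoc, map_smul, smul_eq_mul, mul_inv_cancel_left₀ hn]

end Involutive

/-! ### The regular bimodule of a semisimple algebra -/

section Irreducibles
variable {k : Type*} [Field k] {K : Type u} [Ring K] [Algebra k K]
  {ι : Type*} [Fintype ι] (W : ι → Type*) [∀ i, AddCommGroup (W i)] [∀ i, Module k (W i)]
  [∀ i, Module K (W i)] [∀ i, IsScalarTower k K (W i)]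

/-- The action on a family of modules. -/
def actionPi (k : Type*) [Field k] {K : Type u} [Ring K] [Algebra k K]
    {ι : Type*} (W : ι → Type*) [∀ i, AddCommGroup (W i)] [∀ i, Module k (W i)]
    [∀ i, Module K (W i)] [∀ i, IsScalarTower k K (W i)] : K →ₐ[k] ∀ i, Module.End k (W i) :=
  AlgHom.pi fun i => Algebra.lsmul k k (W i)

theorem actionPi_apply (x : K) (i : ι) (w : W i) : actionPi k W x i w = x • w := rfl

/-- An element killing all the `W i` kills every simple left ideal, and these span `K`. Only simple
left ideals of `K` are tested, so simple modules in the universe of `K` suffice. -/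
theorem actionPi_injective [IsSemisimpleRing K]
    (hW : ∀ (U : Type u) [AddCommGroup U] [Module K U] [IsSimpleModule K U],
      ∃ i, Nonempty (U ≃ₗ[K] W i)) : Function.Injective (actionPi k W : K → _) := by
  rw [injective_iff_map_eq_zero]
  intro a ha
  have h (b : K) (U : Submodule K K) [IsSimpleModule K U] (m : K) (hm : m ∈ U) : a * (b * m) = 0 := by
    obtain ⟨i, ⟨e⟩⟩ := hW U
    have h1 : e (a • b • ⟨m, hm⟩) = 0 := by
      rw [map_smul, ← actionPi_apply (k := k) W a, ha]
      rfl
    rw [LinearEquiv.map_eq_zero_iff] at h1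
    exact congrArg Subtype.val h1
  let N : Submodule K K :=
    { carrier := {m | ∀ b, a * (b * m) = 0}
      add_mem' := fun hx hy b => by rw [mul_add, mul_add, hx, hy, add_zero]
      zero_mem' := fun b => by simp
      smul_mem' := fun c x hx b => by rw [smul_eq_mul, ← mul_assoc b, hx] }
  have hN : (⊤ : Submodule K K) ≤ N := by
    rw [← IsSemisimpleModule.sSup_simples_eq_top]
    refine sSup_le fun U hU m hm b => ?_
    have : IsSimpleModule K U := hU
    exact h b U m hm
  simpa using hN (Submodule.mem_top (x := 1)) 1

variable [∀ i, IsSimpleModule K (W i)] [IsAlgClosed k] [FiniteDimensional k K]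

theorem finiteDimensional_of_isSimpleModule (U : Type*) [AddCommGroup U] [Module k U]
    [Module K U] [IsScalarTower k K U] [IsSimpleModule K U] : FiniteDimensional k U := by
  have := IsSimpleModule.nontrivial K U
  obtain ⟨w, hw⟩ := exists_ne (0 : U)
  exact Module.Finite.of_surjective ((LinearMap.toSpanSingleton K U w).restrictScalars k)
    (IsSimpleModule.toSpanSingleton_surjective K hw)

/-- By Schur's lemma the endomorphisms of the product of the pairwise nonisomorphic `W i` are
families of scalars. Every family of linear maps commutes with them, and Jacobson density on a
finite spanning set realizes it by an element of `K`. -/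
theorem actionPi_surjective (hW : ∀ i j, Nonempty (W i ≃ₗ[K] W j) → i = j) :
    Function.Surjective (actionPi k W : K → _) := by
  classical
  intro f
  have (i : ι) : FiniteDimensional k (W i) := finiteDimensional_of_isSimpleModule (K := K) (W i)
  have hφ (φ : Module.End K (∀ i, W i)) : ∃ c : ι → k, ∀ w i, φ w i = c i • w i := by
    have h0 (i j : ι) (hij : i ≠ j) (x : W j) : φ (Pi.single j x) i = 0 := by
      rcases LinearMap.bijective_or_eq_zero
        (LinearMap.proj i ∘ₗ φ ∘ₗ LinearMap.single K W j : W j →ₗ[K] W i) with h | h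
      · exact absurd (hW _ _ ⟨LinearEquiv.ofBijective _ h⟩).symm hij
      · exact LinearMap.congr_fun h x
    have h1 (i : ι) : ∃ c : k, ∀ x : W i, φ (Pi.single i x) i = c • x := by
      obtain ⟨c, hc⟩ := (IsSimpleModule.algebraMap_end_bijective_of_isAlgClosed (A := K) k).2
        (LinearMap.proj i ∘ₗ φ ∘ₗ LinearMap.single K W i : W i →ₗ[K] W i)
      exact ⟨c, fun x => (LinearMap.congr_fun hc x).symm⟩
    choose c hc using h1
    refine ⟨c, fun w i => ?_⟩
    conv_lhs => rw [← Finset.univ_sum_single w]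
    rw [map_sum, Finset.sum_apply, Finset.sum_eq_single i (fun j _ hj => h0 i j hj.symm _) (by simp),
      hc]
  let F : Module.End (Module.End K (∀ i, W i)) (∀ i, W i) :=
    { toFun := fun w i => f i (w i)
      map_add' := fun x y => by
        funext i
        simp
      map_smul' := fun φ w => by
        obtain ⟨c, hc⟩ := hφ φ
        funext i
        simp only [Module.End.smul_def, hc, map_smul, RingHom.id_apply] }
  obtain ⟨s, hs⟩ := (inferInstance : Module.Finite k (∀ i, W i)).fg_top
  obtain ⟨r, hr⟩ := jacobson_density F s
  refine ⟨r, ?_⟩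
  have h2 : (LinearMap.pi fun i => f i ∘ₗ LinearMap.proj i) =
      (LinearMap.pi fun i => actionPi k W r i ∘ₗ LinearMap.proj i) := by
    refine LinearMap.ext_on hs fun m hm => ?_
    exact hr m hm
  funext i
  ext w
  have h3 := congrFun (LinearMap.congr_fun h2 (Pi.single i w)) i
  simpa using h3.symm

theorem sum_trace_mul_trace [IsSemisimpleRing K]
    (hW_inj : ∀ i j, Nonempty (W i ≃ₗ[K] W j) → i = j)
    (hW_surj : ∀ (U : Type u) [AddCommGroup U] [Module K U] [IsSimpleModule K U],
      ∃ i, Nonempty (U ≃ₗ[K] W i)) (x z : K) :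
    ∑ i, LinearMap.trace k (W i) (Algebra.lsmul k k (W i) x) *
      LinearMap.trace k (W i) (Algebra.lsmul k k (W i) z) =
      LinearMap.trace k K (LinearMap.mulLeft k x ∘ₗ LinearMap.mulRight k z) := by
  have (i : ι) : FiniteDimensional k (W i) := finiteDimensional_of_isSimpleModule (K := K) (W i)
  exact (trace_mulLeft_mulRight (AlgEquiv.ofBijective (actionPi k W)
    ⟨actionPi_injective W hW_surj, actionPi_surjective W hW_inj⟩) x z).symm

end Irreducibles

/-! ### Endomorphisms of `K ⊗ K` -/

section Points
variable {k K : Type*} [Field k] [Ring K] [HopfAlgebra k K]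

/-- `b ⊗ x ↦ x₍₁₎ b ⊗ x₍₂₎` -/
def comulMul : K ⊗[k] K →ₗ[k] K ⊗[k] K :=
  TensorProduct.lift (LinearMap.lcomp k _ comul ∘ₗ LinearMap.rTensorHom K ∘ₗ
    (LinearMap.mul k K).flip)

theorem comulMul_tmul (b x : K) : comulMul (k := k) (b ⊗ₜ x) =
    LinearMap.rTensor K (LinearMap.mulRight k b) (comul x) := rfl

/-- `b ⊗ x ↦ b₍₂₎ ⊗ x b₍₁₎` -/
def transfer : K ⊗[k] K →ₗ[k] K ⊗[k] K :=
  (TensorProduct.comm k K K).toLinearMap ∘ₗ TensorProduct.lift (LinearMap.lcomp k _ comul ∘ₗ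
    LinearMap.rTensorHom K ∘ₗ LinearMap.mul k K) ∘ₗ (TensorProduct.comm k K K).toLinearMap

theorem transfer_tmul (b x : K) : transfer (k := k) (b ⊗ₜ x) =
    TensorProduct.comm k K K (LinearMap.rTensor K (LinearMap.mulLeft k x) (comul b)) := rfl

/-- `b ⊗ x ↦ b g(x₍₂₎) ⊗ x₍₁₎` -/
def mulComul (g : K →ₗ[k] K) : K ⊗[k] K →ₗ[k] K ⊗[k] K :=
  (TensorProduct.comm k K K).toLinearMap ∘ₗ TensorProduct.lift (LinearMap.lcomp k _ comul ∘ₗ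
    LinearMap.lTensorHom K ∘ₗ LinearMap.lcomp k K g ∘ₗ LinearMap.mul k K)

theorem mulComul_tmul (g : K →ₗ[k] K) (b x : K) : mulComul g (b ⊗ₜ x) =
    TensorProduct.comm k K K (LinearMap.lTensor K (LinearMap.mulLeft k b ∘ₗ g) (comul x)) := rfl

theorem untwistMul_tmul (b x : K) : untwistMul (k := k) (b ⊗ₜ x) =
    LinearMap.lTensor K (LinearMap.mulRight k x ∘ₗ antipode k) (comul b) := by
  have h : ∀ w : K ⊗[k] K, LinearMap.lTensor K (LinearMap.mul' k K)
      (TensorProduct.assoc k K K K (LinearMap.lTensor K (antipode k) w ⊗ₜ x)) =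
      LinearMap.lTensor K (LinearMap.mulRight k x ∘ₗ antipode k) w := by
    intro w
    induction w with
    | zero => simp
    | add x y hx hy => simp only [map_add, TensorProduct.add_tmul, hx, hy]
    | tmul p q => simp
  exact h _

theorem comul_antipode_apply (x : K) : comul (R := k) (antipode k x) =
    ∑ i ∈ (ℛ k x).index, antipode k ((ℛ k x).right i) ⊗ₜ antipode k ((ℛ k x).left i) := by
  have h := LinearMap.congr_fun (comul_antipode (k := k) (A := K)) x
  rw [LinearMap.comp_apply, LinearMap.comp_apply, LinearMap.comp_apply, ← (ℛ k x).eq] at h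
  simpa using h

/-- Apply `S` to the antipode axiom. It is through this identity that `S² = id` enters the
computations on `K ⊗ K`. -/
theorem sum_right_mul_antipode_left (hS : ∀ a : K, antipode k (antipode k a) = a) (x : K) :
    ∑ i ∈ (ℛ k x).index, (ℛ k x).right i * antipode k ((ℛ k x).left i) =
      counit (R := k) x • 1 := by
  have h := congrArg (antipode k) (sum_mul_antipode_eq_smul (ℛ k x))
  simpa [HopfAlgebra.antipode_mul_antidistrib, hS] using h

/-- Rebracketing of an iterated coproduct under a linear map. -/
theorem sum_coassoc {M : Type*} [AddCommGroup M] [Module k M] (L : K ⊗[k] (K ⊗[k] K) →ₗ[k] M)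
    (x : K) : ∑ i ∈ (ℛ k x).index, ∑ j ∈ (ℛ k ((ℛ k x).left i)).index,
      L ((ℛ k ((ℛ k x).left i)).left j ⊗ₜ ((ℛ k ((ℛ k x).left i)).right j ⊗ₜ (ℛ k x).right i)) =
    ∑ i ∈ (ℛ k x).index, ∑ j ∈ (ℛ k ((ℛ k x).right i)).index,
      L ((ℛ k x).left i ⊗ₜ ((ℛ k ((ℛ k x).right i)).left j ⊗ₜ (ℛ k ((ℛ k x).right i)).right j)) := by
  have h := congrArg L (sum_tmul_tmul_eq (R := k) (ℛ k x) (fun i => ℛ k ((ℛ k x).left i))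
    (fun i => ℛ k ((ℛ k x).right i)))
  simpa only [map_sum] using h

theorem sum_coassoc_cancel_right {M : Type*} [AddCommGroup M] [Module k M]
    {m : K →ₗ[k] K →ₗ[k] K}
    (hm : ∀ y, ∑ j ∈ (ℛ k y).index, m ((ℛ k y).left j) ((ℛ k y).right j) = counit (R := k) y • 1)
    (f : K →ₗ[k] K →ₗ[k] M) (x : K) :
    ∑ i ∈ (ℛ k x).index, ∑ j ∈ (ℛ k ((ℛ k x).left i)).index,
      f ((ℛ k ((ℛ k x).left i)).left j) (m ((ℛ k ((ℛ k x).left i)).right j) ((ℛ k x).right i)) =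
    f x 1 := by
  have h := sum_coassoc (TensorProduct.lift (f.compr₂ (LinearMap.id)) ∘ₗ
    LinearMap.lTensor K (TensorProduct.lift m)) x
  simp only [LinearMap.comp_apply, LinearMap.lTensor_tmul, TensorProduct.lift.tmul,
    LinearMap.compr₂_apply, LinearMap.id_apply] at h
  rw [h]
  simp_rw [← map_sum, hm]
  conv_rhs => rw [← sum_smul_counit (ℛ k x)]
  simp

theorem sum_coassoc_cancel_left {M : Type*} [AddCommGroup M] [Module k M]
    {m : K →ₗ[k] K →ₗ[k] K}
    (hm : ∀ y, ∑ j ∈ (ℛ k y).index, m ((ℛ k y).left j) ((ℛ k y).right j) = counit (R := k) y • 1)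
    (f : K →ₗ[k] K →ₗ[k] M) (x : K) :
    ∑ i ∈ (ℛ k x).index, ∑ j ∈ (ℛ k ((ℛ k x).right i)).index,
      f (m ((ℛ k x).left i) ((ℛ k ((ℛ k x).right i)).left j)) ((ℛ k ((ℛ k x).right i)).right j) =
    f 1 x := by
  have h := sum_coassoc (TensorProduct.lift f ∘ₗ LinearMap.rTensor K (TensorProduct.lift m) ∘ₗ
    (TensorProduct.assoc k K K K).symm.toLinearMap) x
  simp only [LinearMap.comp_apply, LinearEquiv.coe_coe, TensorProduct.assoc_symm_tmul,
    LinearMap.rTensor_tmul, TensorProduct.lift.tmul] at h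
  rw [← h]
  have h2 : ∀ i, ∑ j ∈ (ℛ k ((ℛ k x).left i)).index,
      f (m ((ℛ k ((ℛ k x).left i)).left j) ((ℛ k ((ℛ k x).left i)).right j)) ((ℛ k x).right i) =
      counit (R := k) ((ℛ k x).left i) • f 1 ((ℛ k x).right i) := by
    intro i
    rw [← LinearMap.sum_apply, ← map_sum, hm, map_smul, LinearMap.smul_apply]
  rw [Finset.sum_congr rfl fun i _ => h2 i]
  conv_rhs => rw [← sum_counit_smul (ℛ k x)]
  simp

/-- `b ⊗ x ↦ x₍₂₎ ⊗ S(b) x₍₁₎` -/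
def flipMul : K ⊗[k] K →ₗ[k] K ⊗[k] K :=
  (TensorProduct.comm k K K).toLinearMap ∘ₗ TensorProduct.lift (LinearMap.lcomp k _ comul ∘ₗ
    LinearMap.rTensorHom K ∘ₗ LinearMap.mul k K ∘ₗ antipode k)

theorem flipMul_tmul (b x : K) : flipMul (k := k) (b ⊗ₜ x) = TensorProduct.comm k K K
    (LinearMap.rTensor K (LinearMap.mulLeft k (antipode k b)) (comul x)) := rfl

/-- In Sweedler notation, `x₍₁₎ b₍₁₎ ⊗ S(x₍₂₎ b₍₂₎) x₍₃₎ = x b₍₁₎ ⊗ S(b₍₂₎)`. -/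
theorem untwistMul_comulMul (b x : K) : untwistMul (k := k) (comulMul (k := k) (b ⊗ₜ x)) =
    TensorProduct.map (LinearMap.mulLeft k x) (antipode k) (comul (R := k) b) := by
  have h : ∀ w : K ⊗[k] K, ∑ i ∈ (ℛ k x).index,
      LinearMap.lTensor K (LinearMap.mulRight k ((ℛ k x).right i) ∘ₗ antipode k)
        (comul ((ℛ k x).left i) * w) =
      TensorProduct.map (LinearMap.mulLeft k x) (antipode k) w := by
    intro w
    induction w with
    | zero => simp
    | add y z hy hz => simp only [map_add, mul_add, Finset.sum_add_distrib, hy, hz]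
    | tmul p q =>
      have h := sum_coassoc_cancel_right (m := LinearMap.mul k K ∘ₗ antipode k)
        (fun y => sum_antipode_mul_eq_smul (ℛ k y))
        ((TensorProduct.mk k K K).compl₁₂ (LinearMap.mulRight k p)
          (LinearMap.mulLeft k (antipode k q))) x
      simp only [LinearMap.compl₁₂_apply, LinearMap.comp_apply, TensorProduct.mk_apply,
        LinearMap.mulRight_apply, LinearMap.mulLeft_apply, LinearMap.mul_apply', mul_one] at h
      rw [TensorProduct.map_tmul, LinearMap.mulLeft_apply, ← h]
      refine Finset.sum_congr rfl fun i _ => ?_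
      rw [← (ℛ k ((ℛ k x).left i)).eq]
      simp [Finset.sum_mul, HopfAlgebra.antipode_mul_antidistrib, mul_assoc]
  rw [← h, comulMul_tmul, ← (ℛ k x).eq]
  simp [untwistMul_tmul]

theorem mulComul_untwistMul (b x : K) :
    mulComul LinearMap.id (untwistMul (k := k) (b ⊗ₜ x)) = flipMul (k := k) (b ⊗ₜ x) := by
  have h : ∀ w : K ⊗[k] K, ∑ i ∈ (ℛ k b).index, LinearMap.lTensor K
      (LinearMap.mulLeft k ((ℛ k b).left i)) (comul (antipode k ((ℛ k b).right i)) * w) =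
      LinearMap.rTensor K (LinearMap.mulLeft k (antipode k b)) w := by
    intro w
    induction w with
    | zero => simp
    | add y z hy hz => simp only [map_add, mul_add, Finset.sum_add_distrib, hy, hz]
    | tmul p q =>
      have h := sum_coassoc_cancel_left (m := (LinearMap.mul k K).compl₂ (antipode k))
        (fun y => sum_mul_antipode_eq_smul (ℛ k y))
        ((TensorProduct.mk k K K).flip.compl₁₂ (LinearMap.mulRight k q)
          (LinearMap.mulRight k p ∘ₗ antipode k)) b
      simp only [LinearMap.compl₁₂_apply, LinearMap.comp_apply, TensorProduct.mk_apply,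
        LinearMap.mulRight_apply, LinearMap.compl₂_apply, LinearMap.flip_apply,
        LinearMap.mul_apply', one_mul] at h
      rw [LinearMap.rTensor_tmul, LinearMap.mulLeft_apply, ← h]
      refine Finset.sum_congr rfl fun i _ => ?_
      rw [comul_antipode_apply]
      simp [Finset.sum_mul, mul_assoc]
  rw [flipMul_tmul, ← h, untwistMul_tmul, ← (ℛ k b).eq]
  simp [mulComul_tmul]

/-- Both composites are `b ⊗ x ↦ b₍₂₎ ⊗ S(b₍₃₎) x b₍₁₎`. -/
theorem untwistMul_transfer :
    (untwistMul : K ⊗[k] K →ₗ[k] _) ∘ₗ transfer = transfer ∘ₗ untwistMul := by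
  refine TensorProduct.ext' fun b x => ?_
  have h := sum_coassoc (TensorProduct.map LinearMap.id (TensorProduct.lift
    ((LinearMap.mul k K).flip.compl₁₂ (LinearMap.mulLeft k x) (antipode k))) ∘ₗ
    (TensorProduct.leftComm k K K K).toLinearMap) b
  simp only [LinearMap.comp_apply, LinearEquiv.coe_coe, TensorProduct.leftComm_tmul,
    TensorProduct.map_tmul, LinearMap.id_apply, TensorProduct.lift.tmul, LinearMap.compl₁₂_apply,
    LinearMap.flip_apply, LinearMap.mul_apply', LinearMap.mulLeft_apply] at h
  rw [LinearMap.comp_apply, LinearMap.comp_apply, transfer_tmul, untwistMul_tmul, ← (ℛ k b).eq]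
  simp only [map_sum, LinearMap.rTensor_tmul, LinearMap.lTensor_tmul, TensorProduct.comm_tmul,
    untwistMul_tmul, transfer_tmul, LinearMap.comp_apply, LinearMap.mulLeft_apply,
    LinearMap.mulRight_apply]
  refine Eq.trans (Finset.sum_congr rfl fun i _ => ?_)
    (h.symm.trans (Finset.sum_congr rfl fun i _ => ?_))
  · rw [← (ℛ k ((ℛ k b).right i)).eq]
    simp [mul_assoc]
  · rw [← (ℛ k ((ℛ k b).left i)).eq]
    simp

theorem transfer_flip (b x : K) : transfer (k := k)
    (TensorProduct.map (LinearMap.mulLeft k x) (antipode k) (comul (R := k) b)) =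
    flipMul (transfer (k := k) (b ⊗ₜ x)) := by
  rw [transfer_tmul, ← (ℛ k b).eq]
  simp [transfer_tmul, flipMul_tmul]

/-- The two commuting maps `untwistMul` and `transfer` are applied one at a time. Past `untwistMul`,
`comulMul` becomes `b ⊗ x ↦ x b₍₁₎ ⊗ S(b₍₂₎)`. Composing this with `transfer` gives `flipMul ∘ₗ
transfer`, and `flipMul` is `mulComul LinearMap.id ∘ₗ untwistMul`. -/
theorem theta_comulMul : (untwistMul ∘ₗ transfer) ∘ₗ comulMul =
    mulComul (k := k) LinearMap.id ∘ₗ (untwistMul ∘ₗ (transfer : K ⊗[k] K →ₗ[k] _)) := by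
  have h : mulComul (k := k) LinearMap.id ∘ₗ untwistMul = (flipMul : K ⊗[k] K →ₗ[k] _) :=
    TensorProduct.ext' mulComul_untwistMul
  rw [← LinearMap.comp_assoc, h, untwistMul_transfer, LinearMap.comp_assoc]
  refine TensorProduct.ext' fun b x => ?_
  rw [LinearMap.comp_apply, LinearMap.comp_apply, LinearMap.comp_apply, untwistMul_comulMul,
    transfer_flip]

/-- `b ⊗ x ↦ b₍₂₎ ⊗ x S(b₍₁₎)` -/
def untransfer : K ⊗[k] K →ₗ[k] K ⊗[k] K :=
  (TensorProduct.comm k K K).toLinearMap ∘ₗ TensorProduct.lift (LinearMap.lcomp k _ comul ∘ₗ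
    LinearMap.rTensorHom K ∘ₗ LinearMap.lcomp k K (antipode k) ∘ₗ LinearMap.mul k K) ∘ₗ
      (TensorProduct.comm k K K).toLinearMap

theorem untransfer_tmul (b x : K) : untransfer (k := k) (b ⊗ₜ x) =
    TensorProduct.comm k K K
      (LinearMap.rTensor K (LinearMap.mulLeft k x ∘ₗ antipode k) (comul b)) := rfl

theorem untransfer_transfer : (untransfer : K ⊗[k] K →ₗ[k] _) ∘ₗ transfer = LinearMap.id := by
  refine TensorProduct.ext' fun b x => ?_
  have h := sum_coassoc_cancel_left (m := (LinearMap.mul k K).compl₂ (antipode k))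
    (fun y => sum_mul_antipode_eq_smul (ℛ k y))
    ((TensorProduct.mk k K K).flip.compl₁₂ (LinearMap.mulLeft k x) LinearMap.id) b
  simp only [LinearMap.compl₁₂_apply, TensorProduct.mk_apply, LinearMap.id_apply,
    LinearMap.mulLeft_apply, LinearMap.compl₂_apply, LinearMap.flip_apply, LinearMap.mul_apply',
    mul_one] at h
  refine Eq.trans ?_ h
  rw [LinearMap.comp_apply, transfer_tmul, ← (ℛ k b).eq]
  simp only [map_sum, LinearMap.rTensor_tmul, TensorProduct.comm_tmul, untransfer_tmul]
  refine Finset.sum_congr rfl fun i _ => ?_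
  rw [← (ℛ k ((ℛ k b).right i)).eq]
  simp

theorem comulMul_lTensor (g : K) :
    comulMul ∘ₗ LinearMap.lTensor K (LinearMap.mulLeft k (antipode k g)) =
      ∑ i ∈ (ℛ k g).index, LinearMap.rTensor K (LinearMap.mulLeft k (antipode k ((ℛ k g).right i))) ∘ₗ
        LinearMap.lTensor K (LinearMap.mulLeft k (antipode k ((ℛ k g).left i))) ∘ₗ comulMul := by
  refine TensorProduct.ext' fun b x => ?_
  have h : ∀ w : K ⊗[k] K, LinearMap.rTensor K (LinearMap.mulRight k b)
      (comul (antipode k g) * w) = ∑ i ∈ (ℛ k g).index,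
      LinearMap.rTensor K (LinearMap.mulLeft k (antipode k ((ℛ k g).right i)))
        (LinearMap.lTensor K (LinearMap.mulLeft k (antipode k ((ℛ k g).left i)))
          (LinearMap.rTensor K (LinearMap.mulRight k b) w)) := by
    intro w
    induction w with
    | zero => simp
    | add y z hy hz => simp only [map_add, mul_add, Finset.sum_add_distrib, hy, hz]
    | tmul p q =>
      rw [comul_antipode_apply]
      simp [Finset.sum_mul, mul_assoc]
  simpa [comulMul_tmul] using h (comul x)

theorem transfer_lTensor (g : K) :
    transfer ∘ₗ LinearMap.lTensor K (LinearMap.mulLeft k g) =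
      LinearMap.lTensor K (LinearMap.mulLeft k g) ∘ₗ transfer := by
  refine TensorProduct.ext' fun b x => ?_
  simp only [LinearMap.comp_apply, LinearMap.lTensor_tmul, transfer_tmul]
  rw [← (ℛ k b).eq]
  simp

variable (hS : ∀ a : K, antipode k (antipode k a) = a)
include hS

theorem transfer_rTensor (g : K) :
    ∑ i ∈ (ℛ k g).index, transfer ∘ₗ LinearMap.lTensor K (LinearMap.mulRight k ((ℛ k g).right i)) ∘ₗ
      LinearMap.rTensor K (LinearMap.mulLeft k (antipode k ((ℛ k g).left i))) =
    LinearMap.rTensor K (LinearMap.mulLeft k (antipode k g)) ∘ₗ transfer := by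
  refine TensorProduct.ext' fun b x => ?_
  have h : ∀ w : K ⊗[k] K, ∑ i ∈ (ℛ k g).index, LinearMap.rTensor K
      (LinearMap.mulLeft k (x * (ℛ k g).right i)) (comul (antipode k ((ℛ k g).left i)) * w) =
      TensorProduct.map (LinearMap.mulLeft k x) (LinearMap.mulLeft k (antipode k g)) w := by
    intro w
    induction w with
    | zero => simp
    | add y z hy hz => simp only [map_add, mul_add, Finset.sum_add_distrib, hy, hz]
    | tmul p q =>
      have h := sum_coassoc_cancel_right (m := (LinearMap.mul k K).flip ∘ₗ antipode k)
        (sum_right_mul_antipode_left hS)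
        ((TensorProduct.mk k K K).flip.compl₁₂ (LinearMap.mulRight k q ∘ₗ antipode k)
          (LinearMap.mulLeft k x ∘ₗ LinearMap.mulRight k p)) g
      simp only [LinearMap.compl₁₂_apply, LinearMap.comp_apply, TensorProduct.mk_apply,
        LinearMap.mulRight_apply, LinearMap.flip_apply, LinearMap.mulLeft_apply,
        LinearMap.mul_apply', one_mul] at h
      rw [TensorProduct.map_tmul, LinearMap.mulLeft_apply, LinearMap.mulLeft_apply, ← h]
      refine Finset.sum_congr rfl fun i _ => ?_
      rw [comul_antipode_apply]
      simp [Finset.sum_mul, mul_assoc]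
  have h2 := congrArg (TensorProduct.comm k K K) (h (comul b))
  simp only [LinearMap.sum_apply, LinearMap.comp_apply, LinearMap.rTensor_tmul,
    LinearMap.lTensor_tmul, transfer_tmul, LinearMap.mulLeft_apply, LinearMap.mulRight_apply,
    Bialgebra.comul_mul]
  rw [map_sum] at h2
  rw [h2, ← (ℛ k b).eq]
  simp

theorem untwistMul_rTensor (g : K) :
    ∑ i ∈ (ℛ k g).index, untwistMul ∘ₗ
      LinearMap.rTensor K (LinearMap.mulLeft k (antipode k ((ℛ k g).right i))) ∘ₗ
      LinearMap.lTensor K (LinearMap.mulLeft k (antipode k ((ℛ k g).left i))) =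
    LinearMap.rTensor K (LinearMap.mulLeft k (antipode k g)) ∘ₗ untwistMul := by
  refine TensorProduct.ext' fun b x => ?_
  have h : ∀ w : K ⊗[k] K, ∑ i ∈ (ℛ k g).index, LinearMap.lTensor K
      (LinearMap.mulRight k (antipode k ((ℛ k g).left i) * x) ∘ₗ antipode k)
      (comul (antipode k ((ℛ k g).right i)) * w) =
      TensorProduct.map (LinearMap.mulLeft k (antipode k g))
        (LinearMap.mulRight k x ∘ₗ antipode k) w := by
    intro w
    induction w with
    | zero => simp
    | add y z hy hz => simp only [map_add, mul_add, Finset.sum_add_distrib, hy, hz]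
    | tmul p q =>
      have h := sum_coassoc_cancel_left (m := (LinearMap.mul k K).flip ∘ₗ antipode k)
        (sum_right_mul_antipode_left hS)
        ((TensorProduct.mk k K K).flip.compl₁₂
          (LinearMap.mulLeft k (antipode k q) ∘ₗ LinearMap.mulRight k x)
          (LinearMap.mulRight k p ∘ₗ antipode k)) g
      simp only [LinearMap.compl₁₂_apply, LinearMap.comp_apply, TensorProduct.mk_apply,
        LinearMap.mulRight_apply, LinearMap.flip_apply, LinearMap.mulLeft_apply,
        LinearMap.mul_apply', one_mul] at h
      rw [TensorProduct.map_tmul, LinearMap.mulLeft_apply, LinearMap.comp_apply,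
        LinearMap.mulRight_apply, ← h]
      refine Finset.sum_congr rfl fun i _ => ?_
      rw [comul_antipode_apply]
      simp [Finset.sum_mul, mul_assoc, HopfAlgebra.antipode_mul_antidistrib, hS]
  simp only [LinearMap.sum_apply, LinearMap.comp_apply, LinearMap.rTensor_tmul,
    LinearMap.lTensor_tmul, untwistMul_tmul, LinearMap.mulLeft_apply,
    Bialgebra.comul_mul]
  rw [h, ← (ℛ k b).eq]
  simp

end Points

/-! ### Convolution operators and cyclicity of the trace -/

section Conv
variable {k C B : Type*} [Field k] [AddCommGroup C] [Module k C] [Coalgebra k C] [Ring B]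
  [Algebra k B]

/-- The constant convolution element with value `T`. -/
def cst (T : B) : WithConv (C →ₗ[k] B) := toConv ((counit : C →ₗ[k] k).smulRight T)

theorem cst_mul_apply (T : B) (F : WithConv (C →ₗ[k] B)) (x : C) : (cst T * F).ofConv x = T * F.ofConv x := by
  have h := congrArg F.ofConv (sum_counit_smul (ℛ k x))
  rw [(ℛ k x).convMul_apply]
  rw [map_sum] at h
  rw [← h]
  simp [cst, Finset.mul_sum]

theorem mul_cst_apply (T : B) (F : WithConv (C →ₗ[k] B)) (x : C) : (F * cst T).ofConv x = F.ofConv x * T := by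
  have h := congrArg F.ofConv (sum_smul_counit (ℛ k x))
  rw [(ℛ k x).convMul_apply]
  rw [map_sum] at h
  rw [← h]
  simp [cst, Finset.sum_mul]

theorem cst_one : (cst 1 : WithConv (C →ₗ[k] B)) = 1 := by
  ext x
  simp [cst, Algebra.algebraMap_eq_smul_one, LinearMap.convOne_def]

theorem cst_mul_cst (T U : B) : (cst T * cst U : WithConv (C →ₗ[k] B)) = cst (T * U) := by
  ext x
  rw [cst_mul_apply]
  simp [cst]

theorem cst_pow (T : B) (n : ℕ) : (cst T : WithConv (C →ₗ[k] B)) ^ n = cst (T ^ n) := by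
  induction n with
  | zero => rw [pow_zero, pow_zero, cst_one]
  | succ n ih => rw [pow_succ, ih, cst_mul_cst, pow_succ]

theorem cst_commute {T : B} {F : WithConv (C →ₗ[k] B)} (h : ∀ x, T * F.ofConv x = F.ofConv x * T) :
    Commute (cst T) F := by
  ext x
  rw [cst_mul_apply, mul_cst_apply, h]


/-- A positive power of `X Y` is `X ((Y X)ⁿ Y)`, so moving `X` to the end produces a power of `Y X`.
-/
theorem tracial_pow {A : Type*} [Monoid A] {M : Type*} {τ : A → M} (hτ : ∀ F G, τ (F * G) = τ (G * F))
    (X Y : A) (n : ℕ) : τ ((X * Y) ^ n) = τ ((Y * X) ^ n) := by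
  cases n with
  | zero => simp
  | succ n =>
    have h : ∀ n : ℕ, (X * Y) ^ (n + 1) = X * ((Y * X) ^ n * Y) := by
      intro n
      induction n with
      | zero => simp
      | succ n ih => rw [pow_succ', ih, pow_succ' (Y * X)]; simp only [mul_assoc]
    rw [h, hτ, mul_assoc, ← pow_succ]

theorem tracial_conj_pow {A : Type*} [Monoid A] {M : Type*} {τ : A → M}
    (hτ : ∀ F G, τ (F * G) = τ (G * F)) {X Y θ θ' : A} (h : X * θ = θ * Y) (h1 : θ * θ' = 1)
    (h2 : θ' * θ = 1) (n : ℕ) : τ (X ^ n) = τ (Y ^ n) := by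
  have h3 : X = (θ * Y) * θ' := by rw [← h, mul_assoc, h1, mul_one]
  rw [h3, tracial_pow hτ, ← mul_assoc, h2, one_mul]

end Conv

/-! ### Traces at a cocommutative element -/

section Trace
variable {k C M : Type*} [Field k] [AddCommGroup C] [Module k C] [Coalgebra k C] [AddCommGroup M]
  [Module k M]

/-- Evaluation at a cocommutative element followed by the trace is tracial. -/
theorem trace_conv_comm {t : C} (ht : TensorProduct.comm k C C (comul t) = comul t)
    (F G : WithConv (C →ₗ[k] Module.End k M)) :
    LinearMap.trace k M ((F * G).ofConv t) = LinearMap.trace k M ((G * F).ofConv t) := by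
  let L (F G : WithConv (C →ₗ[k] Module.End k M)) : C ⊗[k] C →ₗ[k] k :=
    LinearMap.trace k M ∘ₗ LinearMap.mul' k _ ∘ₗ TensorProduct.map F.ofConv G.ofConv
  have h (F G) : LinearMap.trace k M ((F * G).ofConv t) = L F G (comul t) := by
    rw [LinearMap.convMul_apply]
    rfl
  rw [h, h]
  conv_rhs => rw [← ht]
  have h2 : L F G = L G F ∘ₗ (TensorProduct.comm k C C).toLinearMap :=
    TensorProduct.ext' fun x y => by
      simp [L, LinearMap.trace_mul_comm k (F.ofConv x)]
  rw [h2]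
  rfl

end Trace

/-! ### Operators on functions of two variables -/

section Operators
variable {k K V : Type*} [Field k] [Ring K] [HopfAlgebra k K] [AddCommGroup V] [Module k V]

/-- Precomposition. -/
def pre (V : Type*) [AddCommGroup V] [Module k V] :
    Module.End k (K ⊗[k] K) →ₗ[k] Module.End k (K ⊗[k] K →ₗ[k] V) :=
  (LinearMap.llcomp k (K ⊗[k] K) (K ⊗[k] K) V).flip

theorem pre_apply (T : Module.End k (K ⊗[k] K)) (φ : K ⊗[k] K →ₗ[k] V) : pre V T φ = φ ∘ₗ T := rfl

theorem pre_mul_pre (T U : Module.End k (K ⊗[k] K)) : pre V T * pre V U = pre V (U ∘ₗ T) := rfl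

theorem pre_id : pre V (LinearMap.id : Module.End k (K ⊗[k] K)) = 1 := rfl

/-- `(g φ)(b, x) = φ(b, S(g) x)` -/
def actJ (k K V : Type*) [Field k] [Ring K] [HopfAlgebra k K] [AddCommGroup V] [Module k V] :
    K →ₗ[k] Module.End k (K ⊗[k] K →ₗ[k] V) :=
  pre V ∘ₗ LinearMap.lTensorHom K ∘ₗ LinearMap.mul k K ∘ₗ antipode k

/-- `(g φ)(b, x) = φ(b, x g)` -/
def actX (k K V : Type*) [Field k] [Ring K] [HopfAlgebra k K] [AddCommGroup V] [Module k V] :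
    K →ₗ[k] Module.End k (K ⊗[k] K →ₗ[k] V) :=
  pre V ∘ₗ LinearMap.lTensorHom K ∘ₗ (LinearMap.mul k K).flip

/-- `(g φ)(b, x) = φ(S(g) b, x)` -/
def actB (k K V : Type*) [Field k] [Ring K] [HopfAlgebra k K] [AddCommGroup V] [Module k V] :
    K →ₗ[k] Module.End k (K ⊗[k] K →ₗ[k] V) :=
  pre V ∘ₗ LinearMap.rTensorHom K ∘ₗ LinearMap.mul k K ∘ₗ antipode k

theorem actJ_apply (g : K) : actJ k K V g =
    pre V (LinearMap.lTensor K (LinearMap.mulLeft k (antipode k g))) := rfl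

theorem actX_apply (g : K) : actX k K V g =
    pre V (LinearMap.lTensor K (LinearMap.mulRight k g)) := rfl

theorem actB_apply (g : K) : actB k K V g =
    pre V (LinearMap.rTensor K (LinearMap.mulLeft k (antipode k g))) := rfl

variable (k K V) in
/-- The operator exchanging the two descriptions of the double. -/
def theta : Module.End k (K ⊗[k] K →ₗ[k] V) := pre V (untwistMul ∘ₗ transfer)

theorem exists_theta_inv [FiniteDimensional k K] :
    ∃ θ, theta k K V * θ = 1 ∧ θ * theta k K V = 1 := by
  have h1 : (untwistMul : K ⊗[k] K →ₗ[k] K ⊗[k] K) ∘ₗ twistMul = LinearMap.id :=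
    mul_eq_one_comm.1 twistMul_comp_untwistMul
  have h2 : (transfer : K ⊗[k] K →ₗ[k] K ⊗[k] K) ∘ₗ untransfer = LinearMap.id :=
    mul_eq_one_comm.1 untransfer_transfer
  refine ⟨pre V (untransfer ∘ₗ twistMul), ?_, ?_⟩
  · rw [theta, pre_mul_pre, LinearMap.comp_assoc, ← LinearMap.comp_assoc _ _ twistMul,
      twistMul_comp_untwistMul, LinearMap.id_comp, untransfer_transfer, pre_id]
  · rw [theta, pre_mul_pre, LinearMap.comp_assoc, ← LinearMap.comp_assoc _ _ transfer, h2,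
      LinearMap.id_comp, h1, pre_id]

/-- Precomposition reverses composites, so the identities on `K ⊗ K` reappear here as exchange rules
read in the opposite order. -/
theorem actJ_mul_cst : (toConv (actJ k K V) * cst (pre V comulMul) : WithConv (K →ₗ[k] _)) =
    cst (pre V comulMul) * (toConv (actJ k K V) * toConv (actB k K V)) := by
  ext1
  refine LinearMap.ext fun g => ?_
  rw [cst_mul_apply, mul_cst_apply, (ℛ k g).convMul_apply]
  simp only [actJ_apply, actB_apply, pre_mul_pre, Finset.mul_sum]
  rw [comulMul_lTensor, map_sum]
  simp only [LinearMap.comp_assoc]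

theorem actJ_commute_cst : Commute (cst (pre V transfer)) (toConv (actJ k K V)) := by
  refine cst_commute fun g => ?_
  simp only [actJ_apply, pre_mul_pre, transfer_lTensor]

variable (hS : ∀ a : K, antipode k (antipode k a) = a)
include hS

theorem actB_mul_actX_mul_cst :
    (toConv (actB k K V) * toConv (actX k K V) * cst (pre V transfer) : WithConv (K →ₗ[k] _)) =
    cst (pre V transfer) * toConv (actB k K V) := by
  ext1
  refine LinearMap.ext fun g => ?_
  rw [cst_mul_apply, mul_cst_apply, (ℛ k g).convMul_apply]
  simp only [actX_apply, actB_apply, pre_mul_pre, Finset.sum_mul]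
  rw [← transfer_rTensor hS, map_sum]

theorem actJ_mul_actB_mul_cst :
    (toConv (actJ k K V) * toConv (actB k K V) * cst (pre V untwistMul) : WithConv (K →ₗ[k] _)) =
    cst (pre V untwistMul) * toConv (actB k K V) := by
  ext1
  refine LinearMap.ext fun g => ?_
  rw [cst_mul_apply, mul_cst_apply, (ℛ k g).convMul_apply]
  simp only [actJ_apply, actB_apply, pre_mul_pre, Finset.sum_mul]
  rw [← untwistMul_rTensor hS, map_sum]

/-- Write `J, X, B` for the three actions, `C, T, U` for precomposition with `comulMul`, `transfer`,
`untwistMul`, and `N` for that with `mulComul LinearMap.id`. The rules are `J C = C J B`, `B X T = T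
B`, `J T = T J`, `J B U = U B` and `C T U = T U N`. Then `J C X T U = C J T B U = C T U B = T U N
B`. This removes the dependence on `X` and `J` and leaves a constant operator beside a single
action. -/
theorem link : (toConv (actJ k K V) * cst (pre V comulMul) * toConv (actX k K V) *
      cst (theta k K V) : WithConv (K →ₗ[k] _)) =
    cst (theta k K V) * (cst (pre V (mulComul LinearMap.id)) * toConv (actB k K V)) := by
  have h0 : (cst (theta k K V) : WithConv (K →ₗ[k] _)) =
      cst (pre V transfer) * cst (pre V untwistMul) := by
    rw [cst_mul_cst, pre_mul_pre, theta]
  have h1 : (cst (theta k K V) : WithConv (K →ₗ[k] _)) * cst (pre V (mulComul LinearMap.id)) =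
      cst (pre V comulMul) * cst (theta k K V) := by
    rw [cst_mul_cst, cst_mul_cst, theta, pre_mul_pre, pre_mul_pre, theta_comulMul]
  calc _ = cst (pre V comulMul) * (toConv (actJ k K V) *
        (toConv (actB k K V) * toConv (actX k K V) * cst (pre V transfer)) *
        cst (pre V untwistMul)) := by
        rw [actJ_mul_cst, h0]
        simp only [mul_assoc]
    _ = cst (pre V comulMul) * (cst (pre V transfer) *
        (toConv (actJ k K V) * toConv (actB k K V) * cst (pre V untwistMul))) := by
        rw [actB_mul_actX_mul_cst hS, ← mul_assoc (toConv (actJ k K V)),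
          ← (actJ_commute_cst (k := k) (K := K) (V := V)).eq]
        simp only [mul_assoc]
    _ = _ := by
        rw [actJ_mul_actB_mul_cst hS, ← mul_assoc (cst (theta k K V)), h1, h0]
        simp only [mul_assoc]

end Operators

/-! ### Pulling convolution elements back along coalgebra maps -/

section Pullback
variable {k C D B : Type*} [Field k] [AddCommGroup C] [Module k C] [Coalgebra k C]
  [AddCommGroup D] [Module k D] [Coalgebra k D] [Ring B] [Algebra k B]

/-- Pullback of convolution elements along a coalgebra map. -/
def pullback (r : D →ₗc[k] C) (F : WithConv (C →ₗ[k] B)) : WithConv (D →ₗ[k] B) :=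
  toConv (F.ofConv ∘ₗ r.toLinearMap)

theorem pullback_mul (r : D →ₗc[k] C) (F G : WithConv (C →ₗ[k] B)) :
    pullback r (F * G) = pullback r F * pullback r G := by
  ext1
  exact LinearMap.convMul_comp_coalgHom_distrib F G r

theorem pullback_cst (r : D →ₗc[k] C) (T : B) : pullback r (cst T) = cst T := by
  ext x
  simp [pullback, cst]

end Pullback

/-! ### Sweedler powers as convolution powers -/

section SweedlerPow
variable {k A B : Type*} [Field k] [Ring A] [Bialgebra k A] [Ring B] [Algebra k B]

theorem toConv_algHom_pow (u : A →ₐ[k] B) (n : ℕ) :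
    (toConv u.toLinearMap : WithConv (A →ₗ[k] B)) ^ n =
      toConv (u.toLinearMap ∘ₗ sweedlerPow k n) := by
  induction n with
  | zero =>
    ext x
    simp [sweedlerPow, LinearMap.convOne_def]
  | succ n ih =>
    have h := LinearMap.algHom_comp_convMul_distrib u
      ((toConv LinearMap.id : WithConv (A →ₗ[k] A)) ^ n) (toConv LinearMap.id)
    rw [pow_succ, ih]
    ext1
    rw [sweedlerPow, sweedlerPow, pow_succ, ofConv_toConv, h]
    rfl

theorem sweedlerPow_succ_apply {ι : Type*} (n : ℕ) {x : A} (r : Coalgebra.Repr k x ι) :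
    sweedlerPow k (n + 1) x = ∑ i ∈ r.index, sweedlerPow k n (r.left i) * r.right i := by
  rw [sweedlerPow, pow_succ, r.convMul_apply]
  rfl

/-- The antipode reverses products and coproducts, and the two reversals cancel. The induction
therefore peels off the first factor on one side and the last on the other. -/
theorem antipode_sweedlerPow {A : Type*} [Ring A] [HopfAlgebra k A] (n : ℕ) (x : A) :
    antipode k (sweedlerPow k n x) = sweedlerPow k n (antipode k x) := by
  induction n generalizing x with
  | zero =>
    simp [sweedlerPow, LinearMap.convOne_def, Algebra.algebraMap_eq_smul_one]
  | succ n ih =>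
    have h : ∀ w : A ⊗[k] A, LinearMap.mul' k A (TensorProduct.map LinearMap.id (sweedlerPow k n)
        (TensorProduct.map (antipode k) (antipode k) (TensorProduct.comm k A A w))) =
        antipode k (LinearMap.mul' k A (TensorProduct.map (sweedlerPow k n) LinearMap.id w)) := by
      intro w
      induction w with
      | zero => simp
      | add x y hx hy => simp only [map_add, hx, hy]
      | tmul p q => simp [HopfAlgebra.antipode_mul_antidistrib, ih]
    have h2 : ∀ x : A, sweedlerPow k (n + 1) x =
        LinearMap.mul' k A (TensorProduct.map (sweedlerPow k n) LinearMap.id (comul x)) := by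
      intro x
      rw [sweedlerPow, pow_succ, LinearMap.convMul_apply]
      rfl
    have h3 : ∀ x : A, sweedlerPow k (n + 1) x =
        LinearMap.mul' k A (TensorProduct.map LinearMap.id (sweedlerPow k n) (comul x)) := by
      intro x
      rw [sweedlerPow, pow_succ', LinearMap.convMul_apply]
      rfl
    have h4 := LinearMap.congr_fun (comul_antipode (k := k) (A := A)) x
    simp only [LinearMap.comp_apply, LinearEquiv.coe_coe] at h4
    rw [h2, h3, h4, h]

end SweedlerPow

/-! ### Rotation and conjugation of the convolution power -/

section Link
variable {k K H V : Type*} [Field k] [Ring K] [HopfAlgebra k K] [Ring H] [HopfAlgebra k H]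
  [AddCommGroup V] [Module k V] [Module H V] [IsScalarTower k H V]

/-- `(h φ)(b, x) = h φ(b, x)` -/
def actV (k K H V : Type*) [Field k] [Ring K] [HopfAlgebra k K] [Ring H] [HopfAlgebra k H]
    [AddCommGroup V] [Module k V] [Module H V] [IsScalarTower k H V] :
    H →ₐ[k] Module.End k (K ⊗[k] K →ₗ[k] V) :=
  AlgHom.ofLinearMap (LinearMap.llcomp k (K ⊗[k] K) V V ∘ₗ (Algebra.lsmul k k V).toLinearMap)
    (by
      ext
      simp)
    (fun x y => by
      ext
      simp)

theorem actV_commute_pre (h : H) (T : Module.End k (K ⊗[k] K)) :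
    pre V T * actV k K H V h = actV k K H V h * pre V T := rfl

theorem actB_one : actB k K V 1 = 1 := by
  rw [actB_apply]
  simp [pre_id, LinearMap.mulLeft_one, LinearMap.rTensor_id]

theorem actB_mul (g g' : K) : actB k K V (g * g') = actB k K V g * actB k K V g' := by
  rw [actB_apply, actB_apply, actB_apply, pre_mul_pre, ← LinearMap.rTensor_comp,
    HopfAlgebra.antipode_mul_antidistrib, LinearMap.mulLeft_mul]

variable (r : H →ₐc[k] K)

/-- The action of `H` by `actB`. -/
def actBHom (V : Type*) [AddCommGroup V] [Module k V] :
    H →ₐ[k] Module.End k (K ⊗[k] K →ₗ[k] V) :=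
  (AlgHom.ofLinearMap (actB k K V) actB_one actB_mul).comp (r : H →ₐ[k] K)

theorem actV_commute_actBHom (x y : H) : Commute (actV k K H V x) (actBHom r V y) := rfl

/-- The diagonal action of `H`. -/
def actVB (V : Type*) [AddCommGroup V] [Module k V] [Module H V] [IsScalarTower k H V] :
    H →ₐ[k] Module.End k (K ⊗[k] K →ₗ[k] V) :=
  convAlg (actV k K H V) (actBHom r V) (actV_commute_actBHom r)

theorem actVB_apply (h : H) : actVB r V h = ∑ i ∈ (ℛ k h).index,
    actV k K H V ((ℛ k h).left i) * actB k K V (r ((ℛ k h).right i)) :=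
  convAlg_apply _ _ (actV_commute_actBHom r) (ℛ k h)

theorem toConv_actVB : (toConv (actVB r V).toLinearMap : WithConv (H →ₗ[k] _)) =
    toConv (actV k K H V).toLinearMap * pullback (r : H →ₗc[k] K) (toConv (actB k K V)) := by
  ext1
  refine LinearMap.ext fun h => ?_
  rw [(ℛ k h).convMul_apply]
  exact actVB_apply r h

variable [FiniteDimensional k K] (hS : ∀ a : K, antipode k (antipode k a) = a) {t : H}
  (ht : TensorProduct.comm k H H (comul t) = comul t)
include hS ht

/-- The trace at a cocommutative `t` does not see cyclic rotation or conjugation by an invertible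
constant. Rotation brings the factors into the order required by `link`. Afterwards the constant
commutes with the diagonal action, so the power separates. -/
theorem trace_pow_eq (n : ℕ) :
    LinearMap.trace k _ (((cst (pre V comulMul) * (pullback (r : H →ₗc[k] K) (toConv (actX k K V)) *
      (toConv (actV k K H V).toLinearMap * pullback (r : H →ₗc[k] K) (toConv (actJ k K V)))) :
      WithConv (H →ₗ[k] _)) ^ n).ofConv t) =
    LinearMap.trace k _ ((pre V (mulComul LinearMap.id) ^ n : Module.End k _) *
      actVB r V (sweedlerPow k n t)) := by
  let τ (F : WithConv (H →ₗ[k] Module.End k (K ⊗[k] K →ₗ[k] V))) : k :=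
    LinearMap.trace k _ (F.ofConv t)
  have hτ : ∀ F G, τ (F * G) = τ (G * F) := trace_conv_comm ht
  set J := pullback (B := Module.End k (K ⊗[k] K →ₗ[k] V)) (r : H →ₗc[k] K) (toConv (actJ k K V))
  set X := pullback (B := Module.End k (K ⊗[k] K →ₗ[k] V)) (r : H →ₗc[k] K) (toConv (actX k K V))
  set Y := pullback (B := Module.End k (K ⊗[k] K →ₗ[k] V)) (r : H →ₗc[k] K) (toConv (actB k K V))
  set v : WithConv (H →ₗ[k] Module.End k (K ⊗[k] K →ₗ[k] V)) :=
    toConv (actV k K H V).toLinearMap with hv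
  have hlink : J * cst (pre V comulMul) * X * cst (theta k K V) =
      cst (theta k K V) * (cst (pre V (mulComul LinearMap.id)) * Y) := by
    have := congrArg (pullback (r : H →ₗc[k] K)) (link (V := V) hS)
    simpa only [pullback_mul, pullback_cst] using this
  obtain ⟨θ, h1, h2⟩ := exists_theta_inv (k := k) (K := K) (V := V)
  have hvθ : ∀ T, cst (pre V T) * v = v * cst (pre V T) := fun T =>
    (cst_commute fun h => actV_commute_pre h T).eq
  have e1 : τ ((cst (pre V comulMul) * (X * (v * J))) ^ n) =
      τ ((J * cst (pre V comulMul) * X * v) ^ n) := by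
    have := tracial_pow hτ (cst (pre V comulMul) * X * v) J n
    simpa only [mul_assoc] using this
  have e2 : τ ((J * cst (pre V comulMul) * X * v) ^ n) =
      τ ((cst (pre V (mulComul LinearMap.id)) * Y * v) ^ n) := by
    -- `theta` commutes with the action on `V`, so conjugating by it affects only the factors in
    -- `link`.
    refine tracial_conj_pow hτ (θ := cst (theta k K V)) (θ' := cst θ) ?_ ?_ ?_ n
    · rw [mul_assoc _ v, theta, ← hvθ, ← theta, ← mul_assoc, hlink]
      simp only [mul_assoc]
    · rw [cst_mul_cst, h1, cst_one]
    · rw [cst_mul_cst, h2, cst_one]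
  have e3 : τ ((cst (pre V (mulComul LinearMap.id)) * Y * v) ^ n) =
      τ ((cst (pre V (mulComul LinearMap.id)) * (v * Y)) ^ n) := by
    rw [tracial_pow hτ, ← mul_assoc, ← hvθ, mul_assoc]
  have e4 : (cst (pre V (mulComul LinearMap.id)) * (v * Y)) ^ n =
      cst (pre V (mulComul LinearMap.id) ^ n) *
        toConv ((actVB r V).toLinearMap ∘ₗ sweedlerPow k n) := by
    -- The constant multiplies the first variable on the right by a leg of `x`, while `actB`
    -- multiplies it on the left.
    have hc : Commute (cst (pre V (mulComul LinearMap.id))) (v * Y) := by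
      rw [hv, ← toConv_actVB]
      refine cst_commute fun h => ?_
      change pre V (mulComul LinearMap.id) * actVB r V h = actVB r V h * _
      rw [actVB_apply, Finset.mul_sum, Finset.sum_mul]
      refine Finset.sum_congr rfl fun i _ => ?_
      rw [← mul_assoc, actV_commute_pre, mul_assoc, mul_assoc]
      congr 1
      rw [actB_apply, pre_mul_pre, pre_mul_pre]
      congr 1
      refine TensorProduct.ext' fun b x => ?_
      simp only [LinearMap.comp_apply, mulComul_tmul, LinearMap.rTensor_tmul]
      rw [← (ℛ k x).eq]
      simp
    rw [hc.mul_pow, cst_pow, hv, ← toConv_actVB, toConv_algHom_pow]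
  have e5 := e1.trans (e2.trans e3)
  rw [e4] at e5
  refine e5.trans ?_
  simp only [τ]
  rw [cst_mul_apply]
  rfl

end Link

/-! ### Evaluating the rotated trace -/

section Evaluate
variable {k K : Type*} [Field k] [Ring K] [HopfAlgebra k K]

/-- `b ⊗ x ↦ Q(x₍₂₎) b ⊗ x₍₁₎` -/
def twistBy (Q : K →ₗ[k] Module.End k K) : K ⊗[k] K →ₗ[k] K ⊗[k] K :=
  (TensorProduct.comm k K K).toLinearMap ∘ₗ
    TensorProduct.lift (LinearMap.lcomp k _ comul ∘ₗ LinearMap.lTensorHom K ∘ₗ Q.flip)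

theorem twistBy_tmul (Q : K →ₗ[k] Module.End k K) (b x : K) : twistBy Q (b ⊗ₜ x) =
    ∑ i ∈ (ℛ k x).index, Q ((ℛ k x).right i) b ⊗ₜ (ℛ k x).left i := by
  change TensorProduct.comm k K K (LinearMap.lTensor K (Q.flip b) (comul x)) = _
  conv_lhs => rw [← (ℛ k x).eq]
  simp

variable [FiniteDimensional k K]

theorem trace_rhit_eq (hS : ∀ a : K, antipode k (antipode k a) = a) (f : K →ₗ[k] k) :
    LinearMap.trace k K (rhit f) = LinearMap.trace k K (lhit (f ∘ₗ antipode k)) := by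
  have h1 : antipode k ∘ₗ rhit f = lhit (f ∘ₗ antipode k) ∘ₗ antipode k (A := K) := by
    refine LinearMap.ext fun x => ?_
    have h := LinearMap.congr_fun (comul_antipode (k := k) (A := K)) x
    simp only [LinearMap.comp_apply] at h
    simp only [LinearMap.comp_apply, rhit, lhit, h]
    rw [← (ℛ k x).eq]
    simp [hS]
  have h2 : antipode k ∘ₗ antipode k = (LinearMap.id : K →ₗ[k] K) := LinearMap.ext hS
  have h3 : rhit f = antipode k ∘ₗ lhit (f ∘ₗ antipode k) ∘ₗ antipode k (A := K) := by
    rw [← h1, ← LinearMap.comp_assoc, h2, LinearMap.id_comp]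
  rw [h3, LinearMap.trace_comp_comm', LinearMap.comp_assoc, h2, LinearMap.comp_id]

variable {t : K} (ht : IsNormalizedIntegral k t)
  (hS : ∀ a : K, antipode k (antipode k a) = a)
  (htr : ∀ f : K →ₗ[k] k, (Module.finrank k K : k) * f t = LinearMap.trace k K (lhit f))
include ht hS htr

/-- By linearity take `Q = f ⊗ T`. Then the operator is `T ⊗ rhit f`, and the trace of `rhit f` is
`dim K · f(t)` because `S(t) = t`. -/
theorem trace_twistBy (Q : K →ₗ[k] Module.End k K) :
    LinearMap.trace k _ (twistBy Q) = Module.finrank k K * LinearMap.trace k K (Q t) := by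
  obtain ⟨Q, rfl⟩ := (dualTensorHomEquiv k K (Module.End k K)).surjective Q
  induction Q with
  | zero =>
    have : twistBy (0 : K →ₗ[k] Module.End k K) = 0 :=
      TensorProduct.ext' fun b x => by simp [twistBy_tmul]
    simp [this]
  | add Q Q' h h' =>
    have : ∀ Q Q' : K →ₗ[k] Module.End k K, twistBy (Q + Q') = twistBy Q + twistBy Q' :=
      fun Q Q' => TensorProduct.ext' fun b x => by
        simp [twistBy_tmul, TensorProduct.add_tmul, Finset.sum_add_distrib]
    rw [map_add, this, map_add, h, h', LinearMap.add_apply, map_add, mul_add]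
  | tmul f T =>
    have : twistBy (dualTensorHomEquiv k K (Module.End k K) (f ⊗ₜ T)) =
        TensorProduct.map T (rhit f) := TensorProduct.ext' fun b x => by
      rw [twistBy_tmul, TensorProduct.map_tmul, rhit_apply f (ℛ k x), TensorProduct.tmul_sum]
      simp [dualTensorHomEquiv, TensorProduct.smul_tmul]
    rw [this, LinearMap.trace_tensorProduct', trace_rhit_eq hS, ← htr, LinearMap.comp_apply,
      antipode_eq_self_of_integral ht.mul_left ht.counit_eq]
    simp [dualTensorHomEquiv]
    ring

omit ht hS htr

/-- The Sweedler power for the opposite coproduct. -/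
def copPow (k : Type*) {K : Type*} [Field k] [Ring K] [HopfAlgebra k K] [FiniteDimensional k K]
    (n : ℕ) : K →ₗ[k] K :=
  (toCop k K).symm.toLinearMap ∘ₗ sweedlerPow k n ∘ₗ (toCop k K).toLinearMap

theorem copPow_zero (x : K) : copPow k 0 x = counit (R := k) x • 1 := by
  simp [copPow, sweedlerPow, LinearMap.convOne_def, Algebra.algebraMap_eq_smul_one]

theorem copPow_succ (n : ℕ) (x : K) : copPow k (n + 1) x =
    ∑ i ∈ (ℛ k x).index, copPow k n ((ℛ k x).right i) * (ℛ k x).left i := by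
  simp only [copPow, LinearMap.comp_apply, AlgEquiv.toLinearMap_apply]
  rw [sweedlerPow_succ_apply n (copRepr (ℛ k x)), map_sum]
  simp [copRepr]

/-- Each further application multiplies by the next leg to the left, so iteration builds Sweedler
powers for the opposite coproduct: `b ⊗ x ↦ b c(x₍₃₎) x₍₂₎ ⊗ x₍₁₎`, with `c = copPow k n`. -/
theorem mulComul_copPow (n : ℕ) : mulComul (k := k) (K := K) LinearMap.id ∘ₗ
    mulComul (copPow k n) = mulComul (copPow k (n + 1)) := by
  refine TensorProduct.ext' fun b x => ?_
  have h := sum_coassoc ((TensorProduct.comm k K K).toLinearMap ∘ₗ LinearMap.lTensor K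
    (LinearMap.mulLeft k b ∘ₗ TensorProduct.lift
      ((LinearMap.mul k K).flip.compl₁₂ LinearMap.id (copPow k n)))) x
  simp only [LinearMap.comp_apply, LinearEquiv.coe_coe, LinearMap.lTensor_tmul,
    TensorProduct.comm_tmul, TensorProduct.lift.tmul, LinearMap.compl₁₂_apply,
    LinearMap.flip_apply, LinearMap.mul_apply', LinearMap.id_apply, LinearMap.mulLeft_apply] at h
  rw [LinearMap.comp_apply, mulComul_tmul, mulComul_tmul, ← (ℛ k x).eq]
  simp only [map_sum, LinearMap.lTensor_tmul, TensorProduct.comm_tmul, mulComul_tmul,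
    LinearMap.comp_apply, LinearMap.mulLeft_apply, copPow_succ]
  refine Eq.trans (Finset.sum_congr rfl fun i _ => ?_)
    (h.trans (Finset.sum_congr rfl fun i _ => ?_))
  · rw [← (ℛ k ((ℛ k x).left i)).eq]
    simp
  · rw [TensorProduct.sum_tmul]

theorem pre_mulComul_pow (V : Type*) [AddCommGroup V] [Module k V] (n : ℕ) :
    pre V (mulComul (k := k) (K := K) LinearMap.id) ^ n = pre V (mulComul (copPow k n)) := by
  induction n with
  | zero =>
    have : mulComul (copPow k 0) = (LinearMap.id : K ⊗[k] K →ₗ[k] _) :=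
      TensorProduct.ext' fun b x => by
        rw [mulComul_tmul, ← (ℛ k x).eq]
        simp only [map_sum, LinearMap.lTensor_tmul, LinearMap.comp_apply, copPow_zero, map_smul,
          LinearMap.mulLeft_apply, mul_one, TensorProduct.comm_tmul, TensorProduct.smul_tmul,
          LinearMap.id_apply]
        rw [← TensorProduct.tmul_sum, sum_smul_counit]
    rw [pow_zero, this, pre_id]
  | succ n ih => rw [pow_succ, ih, pre_mul_pre, mulComul_copPow]

include ht in
theorem antipode_copPow (n : ℕ) (hS : ∀ a : K, antipode k (antipode k a) = a) :
    antipode k (copPow k n t) = copPow k n t := by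
  have h : ∀ a : K, toCop k K (antipode k a) = antipode k (toCop k K a) := by
    intro a
    rw [Cop.antipode_apply]
    congr 1
    apply (antipode_bijective k K).injective
    rw [hS, antipode_antipodeInv]
  apply (toCop k K).injective
  rw [h]
  simp only [copPow, LinearMap.comp_apply, AlgEquiv.toLinearMap_apply, AlgEquiv.apply_symm_apply]
  rw [antipode_sweedlerPow, ← h, antipode_eq_self_of_integral ht.mul_left ht.counit_eq]

variable {H : Type*} [Ring H] [HopfAlgebra k H] (r : H →ₐc[k] K)
  {V : Type*} [AddCommGroup V] [Module k V] [Module H V] [IsScalarTower k H V]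
  [FiniteDimensional k V]

theorem trace_pre_mul_actV (T : Module.End k (K ⊗[k] K)) (h : H) :
    LinearMap.trace k _ (pre V T * actV k K H V h) =
      LinearMap.trace k V (Algebra.lsmul k k V h) * LinearMap.trace k _ T :=
  trace_hom _ _

include ht hS htr

/-- Conjugation by the antipode swaps left and right multiplications, and the Sweedler power of the
integral is fixed by it. -/
theorem trace_mulLeft_antipode (n : ℕ) (g : K) :
    LinearMap.trace k K (LinearMap.mulLeft k (antipode k g) ∘ₗ
      LinearMap.mulRight k (copPow k n t)) =
    LinearMap.trace k K (LinearMap.mulLeft k (copPow k n t) ∘ₗ LinearMap.mulRight k g) := by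
  have h2 : antipode k ∘ₗ antipode k = (LinearMap.id : K →ₗ[k] K) := LinearMap.ext hS
  have h : LinearMap.mulLeft k (antipode k g) ∘ₗ LinearMap.mulRight k (copPow k n t) =
      antipode k ∘ₗ (LinearMap.mulLeft k (copPow k n t) ∘ₗ LinearMap.mulRight k g) ∘ₗ
        antipode k (A := K) := by
    ext b
    simp [HopfAlgebra.antipode_mul_antidistrib, hS, antipode_copPow ht n hS, mul_assoc]
  rw [h, LinearMap.trace_comp_comm', LinearMap.comp_assoc, h2, LinearMap.comp_id]

theorem trace_pre_pow_mul_actVB (n : ℕ) (h : H) :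
    LinearMap.trace k _ ((pre V (mulComul LinearMap.id) ^ n : Module.End k _) * actVB r V h) =
    Module.finrank k K * ∑ i ∈ (ℛ k h).index,
      LinearMap.trace k V (Algebra.lsmul k k V ((ℛ k h).left i)) * LinearMap.trace k K
        (LinearMap.mulLeft k (copPow k n t) ∘ₗ LinearMap.mulRight k (r ((ℛ k h).right i))) := by
  rw [pre_mulComul_pow, actVB_apply, Finset.mul_sum, map_sum, Finset.mul_sum]
  refine Finset.sum_congr rfl fun i _ => ?_
  have h1 : ∀ (T U : Module.End k (K ⊗[k] K)) (h : H),
      pre V T * (actV k K H V h * pre V U) = pre V (U ∘ₗ T) * actV k K H V h := fun _ _ _ => rfl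
  rw [actB_apply, h1, trace_pre_mul_actV, ← trace_mulLeft_antipode ht hS htr, mul_left_comm]
  congr 1
  -- `Q(y)` is `b ↦ S(r(h₍₂₎)) b c(y)` with `c = copPow k n`. Written as `twistBy Q`, the operator
  -- has a trace that evaluates `y` at the integral.
  let Q : K →ₗ[k] Module.End k K :=
    LinearMap.llcomp k K K K (LinearMap.mulLeft k (antipode k (r ((ℛ k h).right i)))) ∘ₗ
      (LinearMap.mul k K).flip ∘ₗ copPow k n
  have h2 : LinearMap.rTensor K (LinearMap.mulLeft k (antipode k (r ((ℛ k h).right i)))) ∘ₗ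
      mulComul (copPow k n) = twistBy Q := by
    refine TensorProduct.ext' fun b x => ?_
    rw [LinearMap.comp_apply, mulComul_tmul, twistBy_tmul]
    conv_lhs => rw [← (ℛ k x).eq]
    simp [Q]
  rw [h2, trace_twistBy ht hS htr]
  rfl

end Evaluate

/-! ### From the double to functions of two variables -/

section Gamma
variable {k K : Type*} [Field k] [Ring K] [HopfAlgebra k K] [FiniteDimensional k K]

/-- Evaluation at `y` as a functional on `K^{*cop}`. -/
def evalDual (k : Type*) {K : Type*} [Field k] [Ring K] [HopfAlgebra k K] [FiniteDimensional k K]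
    (y : K) : Cop (HopfDual k K) →ₗ[k] k :=
  Module.Dual.eval k K y ∘ₗ (HopfDual.toDual k K).toLinearMap ∘ₗ
    (toCop k (HopfDual k K)).symm.toLinearMap

theorem evalDual_apply (y : K) (f : HopfDual k K) : evalDual k y (toCop k _ f) = f y := rfl

theorem exists_eq_evalDual (f : Cop (HopfDual k K) →ₗ[k] k) : ∃ y : K, f = evalDual k y := by
  obtain ⟨y, hy⟩ := (Module.evalEquiv k K).surjective
    (f ∘ₗ (toCop k (HopfDual k K)).toLinearMap ∘ₗ (HopfDual.toDual k K).symm.toLinearMap)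
  refine ⟨y, LinearMap.ext fun p => ?_⟩
  have := LinearMap.congr_fun hy (HopfDual.toDual k K ((toCop k (HopfDual k K)).symm p))
  simp only [LinearMap.comp_apply, LinearEquiv.coe_coe, AlgEquiv.toLinearMap_apply,
    LinearEquiv.symm_apply_apply, AlgEquiv.apply_symm_apply] at this
  exact this.symm

theorem evalDual_one : evalDual k (1 : K) = counit := rfl

/-- The order of `y` and `z` is reversed because the coproduct is that of `K^{*cop}`. -/
theorem map_evalDual_comul (y z : K) (p : Cop (HopfDual k K)) :
    LinearMap.mul' k k (TensorProduct.map (evalDual k y) (evalDual k z) (comul p)) =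
      evalDual k (z * y) p := by
  obtain ⟨f, rfl⟩ := (toCop k _).surjective p
  have h : ∀ w : HopfDual k K ⊗[k] HopfDual k K,
      LinearMap.mul' k k (TensorProduct.map (evalDual k y) (evalDual k z)
        (TensorProduct.map (toCop k _).toLinearMap (toCop k _).toLinearMap
          (TensorProduct.comm k _ _ w))) = HopfDual.tensorEquiv k K w (z ⊗ₜ y) := by
    intro w
    induction w with
    | zero => simp
    | add x y hx hy => simp only [map_add, HopfDual.add_apply, hx, hy]
    | tmul a b => simp [evalDual_apply, mul_comm]
  rw [Cop.comul_apply, h, HopfDual.tensorEquiv_comul, evalDual_apply]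

/-- The functional of the basis dual to `Module.finBasis`. -/
def dualBasisCop (k K : Type*) [Field k] [Ring K] [HopfAlgebra k K] [FiniteDimensional k K]
    (i : Fin (Module.finrank k K)) : Cop (HopfDual k K) :=
  toCop k _ ((HopfDual.toDual k K).symm ((Module.finBasis k K).coord i))

theorem sum_evalDual_dualBasisCop (y : K) :
    ∑ i, evalDual k y (dualBasisCop k K i) • Module.finBasis k K i = y :=
  (Module.finBasis k K).sum_repr y

variable {M : Type*} [AddCommGroup M] [Module k M]

/-- Functions on `K^{*cop}` with values in `End M` act on `Hom(K, M)`: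
`(F φ)(b) = ∑ F(eⁱ) φ(eᵢ b)` for dual bases `eⁱ` and `eᵢ`. -/
def dualAct (k K M : Type*) [Field k] [Ring K] [HopfAlgebra k K] [FiniteDimensional k K]
    [AddCommGroup M] [Module k M] :
    (Cop (HopfDual k K) →ₗ[k] Module.End k M) →ₗ[k] Module.End k (K →ₗ[k] M) where
  toFun F := ∑ i, LinearMap.lcomp k M (LinearMap.mulLeft k (Module.finBasis k K i)) ∘ₗ
    LinearMap.llcomp k K M M (F (dualBasisCop k K i))
  map_add' F G := by
    ext
    simp [Finset.sum_add_distrib]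
  map_smul' c F := by
    ext
    simp [Finset.smul_sum]

theorem dualAct_apply (F : Cop (HopfDual k K) →ₗ[k] Module.End k M) (φ : K →ₗ[k] M) (b : K) :
    dualAct k K M F φ b =
      ∑ i, F (dualBasisCop k K i) (φ (Module.finBasis k K i * b)) := by
  simp [dualAct]

/-- This is the basis-free description. By `smulRight_induction` such functions span, because every
functional on `K^{*cop}` is evaluation at some element of `K`. -/
theorem dualAct_smulRight (y : K) (T : Module.End k M) :
    dualAct k K M ((evalDual k y).smulRight T) =
      LinearMap.lcomp k M (LinearMap.mulLeft k y) ∘ₗ LinearMap.llcomp k K M M T := by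
  ext φ b
  rw [dualAct_apply]
  conv_rhs => rw [← sum_evalDual_dualBasisCop (k := k) y]
  simp only [LinearMap.smulRight_apply, LinearMap.smul_apply, LinearMap.comp_apply,
    LinearMap.lcomp_apply, LinearMap.mulLeft_apply, LinearMap.llcomp_apply, Finset.sum_mul,
    map_sum, smul_mul_assoc, map_smul]

theorem smulRight_induction {p : (Cop (HopfDual k K) →ₗ[k] M) → Prop}
    (h : ∀ y T, p ((evalDual k y).smulRight T)) (h0 : p 0) (hadd : ∀ F G, p F → p G → p (F + G))
    (F : Cop (HopfDual k K) →ₗ[k] M) : p F := by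
  obtain ⟨F, rfl⟩ := (dualTensorHomEquiv k (Cop (HopfDual k K)) M).surjective F
  induction F with
  | zero => rwa [map_zero]
  | add F G hF hG => rw [map_add]; exact hadd _ _ hF hG
  | tmul f T =>
    obtain ⟨y, rfl⟩ := exists_eq_evalDual f
    convert h y T using 1
    ext x
    simp [dualTensorHomEquiv]

/-- On spanning functions, the reversed product of evaluation points in the convolution matches the
reversal caused by precomposition with left multiplications. -/
theorem dualAct_mul (F G : WithConv (Cop (HopfDual k K) →ₗ[k] Module.End k M)) :
    dualAct k K M (F * G).ofConv = dualAct k K M F.ofConv * dualAct k K M G.ofConv := by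
  obtain ⟨F⟩ := F
  obtain ⟨G⟩ := G
  induction F using smulRight_induction with
  | h0 => simp
  | hadd F F' hF hF' =>
    simp only [toConv_add, add_mul, ofConv_add, map_add] at hF hF' ⊢
    rw [hF, hF']
  | h y T =>
    induction G using smulRight_induction with
    | h0 => simp
    | hadd G G' hG hG' =>
      simp only [toConv_add, mul_add, ofConv_add, map_add] at hG hG' ⊢
      rw [hG, hG']
    | h z U =>
      have h1 : (toConv ((evalDual k y).smulRight T) * toConv ((evalDual k z).smulRight U) :
          WithConv (Cop (HopfDual k K) →ₗ[k] Module.End k M)).ofConv =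
          (evalDual k (z * y)).smulRight (T * U) := by
        refine LinearMap.ext fun p => ?_
        rw [(ℛ k p).convMul_apply, LinearMap.smulRight_apply, ← map_evalDual_comul]
        conv_rhs => rw [← (ℛ k p).eq]
        simp [Finset.sum_smul, smul_smul, mul_comm]
      rw [h1, dualAct_smulRight]
      simp only [dualAct_smulRight]
      ext φ b
      simp

theorem trace_rhit_evalDual (y : K) : LinearMap.trace k _ (rhit (evalDual k y)) =
    LinearMap.trace k K (LinearMap.mulLeft k y) := by
  let e : Cop (HopfDual k K) ≃ₗ[k] Module.Dual k K :=
    (toCop k (HopfDual k K)).symm.toLinearEquiv ≪≫ₗ HopfDual.toDual k K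
  have h : e.conj (rhit (evalDual k y)) =
      Module.Dual.transpose (R := k) (LinearMap.mulLeft k y) := by
    refine LinearMap.ext fun f => ?_
    obtain ⟨p, rfl⟩ := e.surjective f
    rw [LinearEquiv.conj_apply_apply, LinearEquiv.symm_apply_apply]
    ext x
    have h1 : ∀ (p : Cop (HopfDual k K)) (x : K), e p x = evalDual k x p := fun _ _ => rfl
    rw [h1, Module.Dual.transpose_apply, LinearMap.comp_apply, LinearMap.mulLeft_apply, h1,
      ← map_evalDual_comul, rhit_apply _ (ℛ k p)]
    conv_rhs => rw [← (ℛ k p).eq]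
    simp [mul_comm]
  rw [← LinearMap.trace_conj' _ e, h, LinearMap.trace_transpose']

theorem antipode_antipode_dual (hS : ∀ a : K, antipode k (antipode k a) = a)
    (p : Cop (HopfDual k K)) : antipode k (antipode k p) = p := by
  have h2 : ∀ q : HopfDual k K, antipode k (antipode k q) = q := by
    intro q
    ext z
    exact congrArg q (hS z)
  obtain ⟨f, rfl⟩ := (toCop k _).surjective p
  rw [Cop.antipode_apply, Cop.antipode_apply]
  congr 1
  apply (antipode_bijective k (HopfDual k K)).injective
  rw [antipode_antipodeInv]
  apply (antipode_bijective k (HopfDual k K)).injective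
  rw [antipode_antipodeInv, h2]

/-- For `F = evalDual y ⊗ T` both sides are `tr(T) tr(L_y)`. Evaluation at the integral of
`K^{*cop}` thereby becomes a trace over a larger space, at the cost of a dimension factor. -/
theorem trace_dualAct [FiniteDimensional k M] (hS : ∀ a : K, antipode k (antipode k a) = a)
    {l : Cop (HopfDual k K)} (hl : IsNormalizedIntegral k l)
    (htr : ∀ f : Cop (HopfDual k K) →ₗ[k] k,
      (Module.finrank k (Cop (HopfDual k K)) : k) * f l = LinearMap.trace k _ (lhit f))
    (F : Cop (HopfDual k K) →ₗ[k] Module.End k M) :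
    LinearMap.trace k _ (dualAct k K M F) =
      Module.finrank k (Cop (HopfDual k K)) * LinearMap.trace k M (F l) := by
  induction F using smulRight_induction with
  | h0 => simp
  | hadd F G hF hG => rw [map_add, map_add, hF, hG, LinearMap.add_apply, map_add, mul_add]
  | h y T =>
    rw [dualAct_smulRight, trace_hom, ← trace_rhit_evalDual,
      trace_rhit_eq (antipode_antipode_dual hS), ← htr, LinearMap.comp_apply,
      antipode_eq_self_of_integral hl.mul_left hl.counit_eq, LinearMap.smulRight_apply, map_smul,
      smul_eq_mul]
    ring

end Gamma

/-! ### The action of the double on functions of two variables -/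

section Transport
variable {k K H V : Type*} [Field k] [Ring K] [HopfAlgebra k K] [FiniteDimensional k K]
  [Ring H] [HopfAlgebra k H] [AddCommGroup V] [Module k V] [Module H V] [IsScalarTower k H V]

/-- `K^{*cop} ⊗ V` as the space of linear maps `K → V`. -/
def dualTensor (k K V : Type*) [Field k] [Ring K] [HopfAlgebra k K] [FiniteDimensional k K]
    [AddCommGroup V] [Module k V] : Cop (HopfDual k K) ⊗[k] V ≃ₗ[k] (K →ₗ[k] V) :=
  TensorProduct.congr ((toCop k (HopfDual k K)).symm.toLinearEquiv ≪≫ₗ HopfDual.toDual k K)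
    (LinearEquiv.refl k V) ≪≫ₗ dualTensorHomEquiv k K V

theorem dualTensor_tmul (p : Cop (HopfDual k K)) (v : V) (x : K) :
    dualTensor k K V (p ⊗ₜ v) x = evalDual k x p • v := by
  simp only [dualTensor, LinearEquiv.trans_apply, TensorProduct.congr_tmul, LinearEquiv.refl_apply,
    dualTensorHomEquiv]
  rfl

/-- `Hom(K, K^{*cop} ⊗ V)` as the space of functions of two variables. -/
def homDualTensor (k K V : Type*) [Field k] [Ring K] [HopfAlgebra k K] [FiniteDimensional k K]
    [AddCommGroup V] [Module k V] :
    (K →ₗ[k] Cop (HopfDual k K) ⊗[k] V) ≃ₗ[k] (K ⊗[k] K →ₗ[k] V) :=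
  LinearEquiv.congrRight (dualTensor k K V) ≪≫ₗ TensorProduct.lift.equiv (.id k) K K V

theorem homDualTensor_apply (φ : K →ₗ[k] Cop (HopfDual k K) ⊗[k] V) (b x : K) :
    homDualTensor k K V φ (b ⊗ₜ x) = dualTensor k K V (φ b) x := rfl

/-- Endomorphisms of `K^{*cop} ⊗ V` acting on functions of two variables. -/
def postHom (k K V : Type*) [Field k] [Ring K] [HopfAlgebra k K] [FiniteDimensional k K]
    [AddCommGroup V] [Module k V] : Module.End k (Cop (HopfDual k K) ⊗[k] V) →ₐ[k]
      Module.End k (K ⊗[k] K →ₗ[k] V) :=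
  AlgHom.ofLinearMap ((homDualTensor k K V).conj.toLinearMap ∘ₗ LinearMap.llcomp k K _ _)
    (by
      refine LinearMap.ext fun φ => ?_
      exact (homDualTensor k K V).apply_symm_apply φ)
    (fun S T => by
      refine LinearMap.ext fun φ => ?_
      simp [LinearEquiv.conj_apply_apply, LinearMap.ext_iff])

/-- A criterion for identifying the operator induced by an endomorphism. -/
theorem conj_homDualTensor_eq {S : Module.End k (K →ₗ[k] Cop (HopfDual k K) ⊗[k] V)}
    {T : Module.End k (K ⊗[k] K →ₗ[k] V)}
    (h : ∀ ψ b x, dualTensor k K V (S ψ b) x = T (homDualTensor k K V ψ) (b ⊗ₜ x)) :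
    (homDualTensor k K V).conj S = T := by
  refine LinearMap.ext fun φ => ?_
  obtain ⟨ψ, rfl⟩ := (homDualTensor k K V).surjective φ
  rw [LinearEquiv.conj_apply_apply, LinearEquiv.symm_apply_apply]
  exact TensorProduct.ext' fun b x => h ψ b x

theorem dualTensor_actL (p : Cop (HopfDual k K)) (m : Cop (HopfDual k K) ⊗[k] V) (x : K) :
    dualTensor k K V (SkewPairing.actL (k := k) V p m) x =
      ∑ i ∈ (ℛ k x).index, evalDual k ((ℛ k x).left i) p • dualTensor k K V m ((ℛ k x).right i) := by
  induction m with
  | zero => simp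
  | add m m' h h' => simp only [map_add, LinearMap.add_apply, h, h', smul_add, Finset.sum_add_distrib]
  | tmul q v =>
    obtain ⟨f, rfl⟩ := (toCop k _).surjective p
    obtain ⟨g, rfl⟩ := (toCop k _).surjective q
    simp only [SkewPairing.actL_tmul, dualTensor_tmul, ← map_mul, evalDual_apply,
      HopfDual.mul_apply _ _ (ℛ k x), Finset.sum_smul, smul_smul]

/-- Left multiplication by a dual basis vector reads off `x₍₁₎`, and the sum over the basis
reassembles it in the first variable as `x₍₁₎ b`. -/
theorem conj_dualAct_actL : (homDualTensor k K V).conj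
    (dualAct k K _ (SkewPairing.actL (k := k) (P := Cop (HopfDual k K)) V).toLinearMap) =
      pre V comulMul := by
  refine conj_homDualTensor_eq fun ψ b x => ?_
  rw [dualAct_apply, map_sum, LinearMap.sum_apply]
  simp only [AlgHom.toLinearMap_apply, dualTensor_actL]
  rw [Finset.sum_comm, pre_apply, LinearMap.comp_apply, comulMul_tmul]
  conv_rhs => rw [← (ℛ k x).eq]
  simp only [map_sum, LinearMap.rTensor_tmul, LinearMap.mulRight_apply, homDualTensor_apply]
  refine Finset.sum_congr rfl fun i _ => ?_
  conv_rhs => rw [← sum_evalDual_dualBasisCop (k := k) ((ℛ k x).left i)]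
  simp only [Finset.sum_mul, smul_mul_assoc, map_sum, map_smul, LinearMap.sum_apply,
    LinearMap.smul_apply]

variable (σ : HopfPairing k (HopfDual k K) H)

theorem dualTensor_leftHit (h : H) (m : Cop (HopfDual k K) ⊗[k] V) (x : K) :
    dualTensor k K V (SkewPairing.onLeft V (σ.toSkew.leftHit h) m) x =
      dualTensor k K V m (x * σ.right h) := by
  induction m with
  | zero => simp
  | add m m' h h' => simp only [map_add, LinearMap.add_apply, h, h']
  | tmul q v =>
    have h1 : σ.toSkew.toLin.flip h = evalDual k (σ.right h) := by
      ext p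
      obtain ⟨f, rfl⟩ := (toCop k _).surjective p
      rw [evalDual_apply, σ.apply_right]
      rfl
    have h2 : σ.toSkew.leftHit h q = lhit (σ.toSkew.toLin.flip h) q := rfl
    rw [SkewPairing.onLeft_tmul, dualTensor_tmul, dualTensor_tmul, h2, h1, lhit_apply _ (ℛ k q),
      ← map_evalDual_comul]
    conv_rhs => rw [← (ℛ k q).eq]
    simp

theorem dualTensor_rightHit (hS : ∀ a : K, antipode k (antipode k a) = a) (h : H)
    (m : Cop (HopfDual k K) ⊗[k] V) (x : K) :
    dualTensor k K V (SkewPairing.onLeft V (σ.toSkew.rightHit h) m) x =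
      dualTensor k K V m (antipode k (σ.right h) * x) := by
  induction m with
  | zero => simp
  | add m m' h h' => simp only [map_add, LinearMap.add_apply, h, h']
  | tmul q v =>
    have h1 : σ.toSkew.toLin.flip h ∘ₗ antipode k = evalDual k (antipode k (σ.right h)) := by
      ext p
      obtain ⟨f, rfl⟩ := (toCop k _).surjective p
      rw [evalDual_apply, LinearMap.comp_apply, Cop.antipode_apply]
      -- The antipode of `K^{*cop}` is the inverse of that of `K*`; the two agree since `S² = id`.
      have h3 : antipodeInv k _ f = antipode k f := by
        apply (antipode_bijective k (HopfDual k K)).injective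
        rw [antipode_antipodeInv]
        ext z
        exact (congrArg f (hS z)).symm
      rw [h3]
      exact (σ.apply_right (antipode k f) h).symm
    have h2 : σ.toSkew.rightHit h q = rhit (σ.toSkew.toLin.flip h ∘ₗ antipode k) q := rfl
    rw [SkewPairing.onLeft_tmul, dualTensor_tmul, dualTensor_tmul, h2, h1, rhit_apply _ (ℛ k q),
      ← map_evalDual_comul]
    conv_rhs => rw [← (ℛ k q).eq]
    simp [mul_comm]

theorem dualTensor_onRight (T : Module.End k V) (m : Cop (HopfDual k K) ⊗[k] V) (x : K) :
    dualTensor k K V (SkewPairing.onRight V T m) x = T (dualTensor k K V m x) := by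
  induction m with
  | zero => simp
  | add m m' h h' => simp only [map_add, LinearMap.add_apply, h, h']
  | tmul q v => simp [SkewPairing.onRight_tmul, dualTensor_tmul]

/-- Tested on pairs of functionals, this is the multiplicativity of `σ` in its first argument. -/
theorem comul_right (h : H) : comul (R := k) (σ.right h) =
    TensorProduct.map σ.right.toLinearMap σ.right.toLinearMap (comul h) := by
  rw [← sub_eq_zero, ← Module.forall_dual_apply_eq_zero_iff k]
  intro φ
  obtain ⟨φ, rfl⟩ := dualDistrib_surjective φ
  rw [map_sub, sub_eq_zero]
  induction φ with
  | zero => simp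
  | add x y hx hy => simp only [map_add, LinearMap.add_apply, hx, hy]
  | tmul f g =>
    obtain ⟨f, rfl⟩ := (HopfDual.toDual k K).surjective f
    obtain ⟨g, rfl⟩ := (HopfDual.toDual k K).surjective g
    have h1 := σ.map_mul_left f g h
    rw [← σ.apply_right, HopfDual.mul_apply f g (ℛ k (σ.right h))] at h1
    conv_lhs => rw [← (ℛ k (σ.right h)).eq]
    rw [← (ℛ k h).eq] at h1 ⊢
    simpa [← σ.apply_right] using h1

/-- The map `σ_r` as a map of bialgebras. -/
def rightHom : H →ₐc[k] K :=
  BialgHom.ofAlgHom σ.right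
    (AlgHom.ext fun h => by
      change counit (R := k) (σ.right h) = counit h
      rw [← HopfDual.one_apply, σ.apply_right, σ.map_one_left])
    (AlgHom.ext fun h => (comul_right σ h).symm)

theorem postHom_leftHit (h : H) : postHom k K V (SkewPairing.onLeft V (σ.toSkew.leftHit h)) =
    actX k K V (σ.right h) :=
  conj_homDualTensor_eq fun ψ b x => dualTensor_leftHit σ h (ψ b) x

theorem postHom_rightHit (hS : ∀ a : K, antipode k (antipode k a) = a) (h : H) :
    postHom k K V (SkewPairing.onLeft V (σ.toSkew.rightHit h)) = actJ k K V (σ.right h) :=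
  conj_homDualTensor_eq fun ψ b x => dualTensor_rightHit σ hS h (ψ b) x

theorem postHom_lsmul (h : H) :
    postHom k K V (SkewPairing.onRight V (Algebra.lsmul k k V h)) = actV k K H V h :=
  conj_homDualTensor_eq fun ψ b x => dualTensor_onRight _ (ψ b) x

/-- The three commuting actions that make up `actR` become translation of `x` on the right, the
action on `V`, and translation of `x` on the left through the antipode. -/
theorem toConv_postHom_actR (hS : ∀ a : K, antipode k (antipode k a) = a) :
    (toConv ((postHom k K V).toLinearMap ∘ₗ (σ.toSkew.actR V).toLinearMap) :
      WithConv (H →ₗ[k] _)) =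
    pullback (rightHom σ : H →ₗc[k] K) (toConv (actX k K V)) *
      (toConv (actV k K H V).toLinearMap *
        pullback (rightHom σ : H →ₗc[k] K) (toConv (actJ k K V))) := by
  have h1 : pullback (rightHom σ : H →ₗc[k] K) (toConv (actX k K V)) =
      toConv ((postHom k K V).toLinearMap ∘ₗ (SkewPairing.onLeft V).toLinearMap ∘ₗ
        σ.toSkew.leftHit.toLinearMap) := by
    ext1
    exact LinearMap.ext fun h => (postHom_leftHit σ h).symm
  have h2 : pullback (rightHom σ : H →ₗc[k] K) (toConv (actJ k K V)) =
      toConv ((postHom k K V).toLinearMap ∘ₗ (SkewPairing.onLeft V).toLinearMap ∘ₗ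
        σ.toSkew.rightHit.toLinearMap) := by
    ext1
    exact LinearMap.ext fun h => (postHom_rightHit σ hS h).symm
  have h3 : (toConv (actV k K H V).toLinearMap : WithConv (H →ₗ[k] _)) =
      toConv ((postHom k K V).toLinearMap ∘ₗ (SkewPairing.onRight V).toLinearMap ∘ₗ
        (Algebra.lsmul k k V).toLinearMap) := by
    ext1
    exact LinearMap.ext fun h => (postHom_lsmul h).symm
  rw [h1, h2, h3]
  have h4 := σ.toSkew.toConv_actR V
  ext1
  have h5 := congrArg (fun F => (postHom k K V).toLinearMap ∘ₗ WithConv.ofConv F) h4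
  simp only [LinearMap.algHom_comp_convMul_distrib] at h5
  exact h5

end Transport

/-! ### From convolution on `K^{*cop} ⊗ H` to convolution on `H` -/

section Curry
variable {k K H V : Type*} [Field k] [Ring K] [HopfAlgebra k K] [FiniteDimensional k K]
  [Ring H] [HopfAlgebra k H] [AddCommGroup V] [Module k V]

/-- Convolution elements on `K^{*cop} ⊗ H` as convolution elements on `H`. -/
def gamma (F : WithConv (Cop (HopfDual k K) ⊗[k] H →ₗ[k]
    Module.End k (Cop (HopfDual k K) ⊗[k] V))) :
    WithConv (H →ₗ[k] Module.End k (K ⊗[k] K →ₗ[k] V)) :=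
  toConv ((homDualTensor k K V).conj.toLinearMap ∘ₗ dualAct k K _ ∘ₗ
    (TensorProduct.curry F.ofConv).flip)

theorem gamma_apply (F : WithConv (Cop (HopfDual k K) ⊗[k] H →ₗ[k]
    Module.End k (Cop (HopfDual k K) ⊗[k] V))) (h : H) : (gamma F).ofConv h =
    (homDualTensor k K V).conj (dualAct k K _ ((TensorProduct.curry F.ofConv).flip h)) := rfl

theorem curry_flip_mul {P B : Type*} [Ring P] [HopfAlgebra k P] [Ring B] [Algebra k B]
    (F G : WithConv (P ⊗[k] H →ₗ[k] B)) (h : H) :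
    (TensorProduct.curry (F * G).ofConv).flip h = ∑ i ∈ (ℛ k h).index,
      (toConv ((TensorProduct.curry F.ofConv).flip ((ℛ k h).left i)) *
        toConv ((TensorProduct.curry G.ofConv).flip ((ℛ k h).right i)) :
        WithConv (P →ₗ[k] B)).ofConv := by
  refine LinearMap.ext fun p => ?_
  rw [LinearMap.flip_apply, TensorProduct.curry_apply, LinearMap.convMul_apply,
    TensorProduct.comul_tmul, LinearMap.sum_apply]
  simp only [(ℛ k p).convMul_apply]
  conv_lhs => rw [← (ℛ k p).eq, ← (ℛ k h).eq]
  simp only [TensorProduct.sum_tmul, TensorProduct.tmul_sum, map_sum]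
  rfl

/-- The coproduct of `K^{*cop} ⊗ H` is componentwise, so currying preserves convolution in `H`,
while `dualAct` turns convolution in `K^{*cop}` into composition. -/
theorem gamma_mul (F G : WithConv (Cop (HopfDual k K) ⊗[k] H →ₗ[k]
    Module.End k (Cop (HopfDual k K) ⊗[k] V))) : gamma (F * G) = gamma F * gamma G := by
  ext1
  refine LinearMap.ext fun h => ?_
  rw [(ℛ k h).convMul_apply]
  have h1 := congrArg (fun c => (homDualTensor k K V).conj (dualAct k K _ c))
    (curry_flip_mul (k := k) (P := Cop (HopfDual k K))
      (B := Module.End k (Cop (HopfDual k K) ⊗[k] V)) F G h)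
  refine h1.trans ?_
  simp only [map_sum]
  refine Finset.sum_congr rfl fun i _ => ?_
  refine (congrArg (homDualTensor k K V).conj (dualAct_mul _ _)).trans ?_
  exact LinearEquiv.conj_comp _ _ _

theorem gamma_convL (c : Cop (HopfDual k K) →ₗ[k] Module.End k (Cop (HopfDual k K) ⊗[k] V)) :
    gamma (convL c : WithConv (_ ⊗[k] H →ₗ[k] _)) =
      cst ((homDualTensor k K V).conj (dualAct k K _ c)) := by
  ext1
  refine LinearMap.ext fun h => ?_
  have h1 : (TensorProduct.curry (convL c : WithConv (_ ⊗[k] H →ₗ[k] _)).ofConv).flip h =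
      counit (R := k) h • c := by
    ext1 p
    simp [convL]
  rw [gamma_apply, h1, map_smul, map_smul]
  rfl

/-- The counit of `K^{*cop}` is evaluation at `1`, so `dualAct` reduces to postcomposition. -/
theorem gamma_convR (u : H →ₗ[k] Module.End k (Cop (HopfDual k K) ⊗[k] V)) :
    gamma (convR u : WithConv (_ ⊗[k] H →ₗ[k] _)) =
      toConv ((postHom k K V).toLinearMap ∘ₗ u) := by
  ext1
  refine LinearMap.ext fun h => ?_
  have h1 : (TensorProduct.curry
      (convR u : WithConv (Cop (HopfDual k K) ⊗[k] H →ₗ[k] _)).ofConv).flip h =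
      (evalDual k (1 : K)).smulRight (u h) := by
    ext1 p
    simp [convR, evalDual_one]
  rw [gamma_apply, h1, dualAct_smulRight, LinearMap.mulLeft_one]
  rfl

theorem gamma_one : gamma (1 : WithConv (Cop (HopfDual k K) ⊗[k] H →ₗ[k]
    Module.End k (Cop (HopfDual k K) ⊗[k] V))) = 1 := by
  rw [← convR_one, gamma_convR]
  ext1
  refine LinearMap.ext fun h => ?_
  simp [LinearMap.convOne_def]

theorem gamma_pow (F : WithConv (Cop (HopfDual k K) ⊗[k] H →ₗ[k]
    Module.End k (Cop (HopfDual k K) ⊗[k] V))) (n : ℕ) : gamma (F ^ n) = gamma F ^ n := by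
  induction n with
  | zero => rw [pow_zero, pow_zero, gamma_one]
  | succ n ih => rw [pow_succ, gamma_mul, ih, pow_succ]

end Curry

/-! ### The integral of the double -/

section Double
variable {k P H : Type*} [Field k] [Ring P] [HopfAlgebra k P] [Ring H] [HopfAlgebra k H]
  (τ : SkewPairing k P H)

namespace SkewPairing.Double

theorem of_tmul (b : P) (h : H) : of τ (b ⊗ₜ h) = inclP τ b * inclH τ h :=
  (LinearMap.congr_fun (glue_incl τ) (b ⊗ₜ h)).symm

theorem antipode_inclP (b : P) : antipode k (inclP τ b) = inclP τ (antipode k b) := by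
  have h := convR_mul_convL_apply (k := k) ((inclP τ).toLinearMap ∘ₗ antipode k)
    ((inclH τ).toLinearMap ∘ₗ antipode k) b (1 : H)
  refine h.trans ?_
  simp

theorem antipode_inclH (h : H) : antipode k (inclH τ h) = inclH τ (antipode k h) := by
  have h := convR_mul_convL_apply (k := k) ((inclP τ).toLinearMap ∘ₗ antipode k)
    ((inclH τ).toLinearMap ∘ₗ antipode k) (1 : P) h
  refine h.trans ?_
  simp

theorem antipode_antipode_double (hP : ∀ b : P, antipode k (antipode k b) = b)
    (hH : ∀ h : H, antipode k (antipode k h) = h) (x : τ.Double) :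
    antipode k (antipode k x) = x := by
  obtain ⟨x, rfl⟩ := (of τ).surjective x
  induction x with
  | zero => simp
  | add x y hx hy => simp only [map_add, hx, hy]
  | tmul b h =>
    rw [of_tmul, HopfAlgebra.antipode_mul_antidistrib, HopfAlgebra.antipode_mul_antidistrib,
      antipode_inclP, antipode_inclP, antipode_inclH, antipode_inclH, hP, hH]

/-- The double also has `S² = id`, so its integral is the element representing the regular trace of
its coalgebra. That coalgebra is `P ⊗ H`, and `l ⊗ t` represents the same trace. -/
theorem isNormalizedIntegral_double [CharZero k] [FiniteDimensional k P] [FiniteDimensional k H]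
    (hP : ∀ b : P, antipode k (antipode k b) = b) (hH : ∀ h : H, antipode k (antipode k h) = h)
    {l : P} (hl : ∀ f : P →ₗ[k] k, (Module.finrank k P : k) * f l = LinearMap.trace k P (lhit f))
    {t : H} (ht : ∀ f : H →ₗ[k] k, (Module.finrank k H : k) * f t = LinearMap.trace k H (lhit f)) :
    IsNormalizedIntegral k (of τ (l ⊗ₜ t)) := by
  obtain ⟨d, hd, hdtr⟩ := exists_isNormalizedIntegral_of_involutive
    (antipode_antipode_double τ hP hH)
  have hn : (Module.finrank k τ.Double : k) = Module.finrank k P * Module.finrank k H := by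
    rw [← (of τ).finrank_eq, Module.finrank_tensorProduct, Nat.cast_mul]
  have h0 : (Module.finrank k τ.Double : k) ≠ 0 := by
    have : Nontrivial τ.Double := by
      refine ⟨1, 0, fun h => ?_⟩
      have := congrArg (counit (R := k)) h
      simp at this
    exact Nat.cast_ne_zero.2 Module.finrank_pos.ne'
  have he : d = of τ (l ⊗ₜ t) := by
    rw [← sub_eq_zero, ← Module.forall_dual_apply_eq_zero_iff k]
    intro f
    rw [map_sub, sub_eq_zero]
    apply mul_left_cancel₀ h0
    rw [hdtr, hn]
    exact (apply_tmul_eq_trace_lhit hl ht f).symm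
  rwa [← he]

/-- The identification of coalgebras underlying the double. -/
def ofHom : P ⊗[k] H →ₗc[k] τ.Double where
  toLinearMap := (of τ).toLinearMap
  counit_comp := rfl
  map_comp_comul := by
    have h : TensorProduct.map (of τ).toLinearMap (of τ).toLinearMap =
        (LinearMap.id : (P ⊗[k] H) ⊗[k] (P ⊗[k] H) →ₗ[k] _) :=
      TensorProduct.map_id
    exact (congrArg (· ∘ₗ comul) h).trans rfl

end SkewPairing.Double

end Double

section Pullback
variable {k C D B : Type*} [Field k] [AddCommGroup C] [Module k C] [Coalgebra k C]
  [AddCommGroup D] [Module k D] [Coalgebra k D] [Ring B] [Algebra k B]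

theorem pullback_pow (r : D →ₗc[k] C) (F : WithConv (C →ₗ[k] B)) (n : ℕ) :
    pullback r (F ^ n) = pullback r F ^ n := by
  induction n with
  | zero => rw [pow_zero, pow_zero, ← cst_one, pullback_cst, cst_one]
  | succ n ih => rw [pow_succ, pullback_mul, ih, pow_succ]

end Pullback

theorem trace_conj_homDualTensor {k K V : Type*} [Field k] [Ring K] [HopfAlgebra k K]
    [FiniteDimensional k K] [AddCommGroup V] [Module k V] [FiniteDimensional k V]
    (S : Module.End k (K →ₗ[k] Cop (HopfDual k K) ⊗[k] V)) :
    LinearMap.trace k _ ((homDualTensor k K V).conj S) = LinearMap.trace k _ S := by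
  generalize homDualTensor k K V = e
  exact LinearMap.trace_conj' (R := k) (M := K →ₗ[k] Cop (HopfDual k K) ⊗[k] V)
    (N := K ⊗[k] K →ₗ[k] V) S e

/-! ### The trace of the double and the trace of a tensor product -/

section Final
variable {k K H V : Type*} [Field k] [Ring K] [HopfAlgebra k K] [FiniteDimensional k K]
  [Ring H] [HopfAlgebra k H] [AddCommGroup V] [Module k V] [Module H V] [IsScalarTower k H V]
  [FiniteDimensional k V] (σ : HopfPairing k (HopfDual k K) H)

theorem doubleRep_sweedlerPow (n : ℕ) (x : Cop (HopfDual k K) ⊗[k] H) :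
    σ.doubleRep V (sweedlerPow k n (SkewPairing.Double.of σ.toSkew x)) =
      ((convL (SkewPairing.actL V).toLinearMap * convR (σ.toSkew.actR V).toLinearMap :
        WithConv (Cop (HopfDual k K) ⊗[k] H →ₗ[k] _)) ^ n).ofConv x := by
  have h1 := toConv_algHom_pow (k := k) (A := σ.toSkew.Double)
    (B := Module.End k (Cop (HopfDual k K) ⊗[k] V)) (σ.doubleRep V) n
  have h2 : pullback (B := Module.End k (Cop (HopfDual k K) ⊗[k] V))
      (SkewPairing.Double.ofHom σ.toSkew) (toConv (σ.doubleRep V).toLinearMap) =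
      convL (SkewPairing.actL V).toLinearMap * convR (σ.toSkew.actR V).toLinearMap := by
    rw [SkewPairing.convL_mul_convR]
    rfl
  rw [← h2, ← pullback_pow, h1]
  rfl

/-- The factor `dim K` comes from trading evaluation at `l` for a trace on `Hom(K, M)`, where `M =
K^{*cop} ⊗ V`. After `gamma` the power is the one treated by `trace_pow_eq`. -/
theorem trace_doubleRep (hS : ∀ a : K, antipode k (antipode k a) = a)
    {l : Cop (HopfDual k K)} (hl : IsNormalizedIntegral k l)
    (htr : ∀ f : Cop (HopfDual k K) →ₗ[k] k,
      (Module.finrank k (Cop (HopfDual k K)) : k) * f l = LinearMap.trace k _ (lhit f))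
    {t : H} (ht : TensorProduct.comm k H H (comul t) = comul t) (n : ℕ) :
    Module.finrank k K * LinearMap.trace k _
      (σ.doubleRep V (sweedlerPow k n (SkewPairing.Double.of σ.toSkew (l ⊗ₜ t)))) =
    LinearMap.trace k _ ((pre V (mulComul LinearMap.id) ^ n : Module.End k _) *
      actVB (rightHom σ) V (sweedlerPow k n t)) := by
  have hd : Module.finrank k (Cop (HopfDual k K)) = Module.finrank k K := by
    rw [((toCop k (HopfDual k K)).symm.toLinearEquiv ≪≫ₗ HopfDual.toDual k K).finrank_eq,
      Subspace.dual_finrank_eq]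
  rw [← trace_pow_eq (rightHom σ) hS ht, ← toConv_postHom_actR σ hS, ← conj_dualAct_actL,
    ← gamma_convL, ← gamma_convR, ← gamma_mul, ← gamma_pow, gamma_apply, trace_conj_homDualTensor,
    trace_dualAct hS hl htr, hd, doubleRep_sweedlerPow]
  rfl

theorem trace_tensorRep (W : Type*) [AddCommGroup W] [Module k W] [Module K W]
    [IsScalarTower k K W] [FiniteDimensional k W] (h : H) :
    LinearMap.trace k _ (σ.tensorRep V W h) = ∑ i ∈ (ℛ k h).index,
      LinearMap.trace k V (Algebra.lsmul k k V ((ℛ k h).left i)) *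
        LinearMap.trace k W (Algebra.lsmul k k W (σ.right ((ℛ k h).right i))) := by
  have h1 : σ.tensorRep V W h = ∑ i ∈ (ℛ k h).index,
      TensorProduct.map (Algebra.lsmul k k V ((ℛ k h).left i))
        (Algebra.lsmul k k W (σ.right ((ℛ k h).right i))) :=
    TensorProduct.ext' fun v w => by
      rw [σ.tensorRep_tmul V W (ℛ k h)]
      simp
  rw [h1, map_sum]
  simp_rw [LinearMap.trace_tensorProduct']

end Final

end
end HopfDouble

theorem proposition5p21
    (H : Type*) [Ring H] [HopfAlgebra ℂ H] [FiniteDimensional ℂ H] [IsSemisimpleRing H]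
    (K : Type u) [Ring K] [HopfAlgebra ℂ K] [FiniteDimensional ℂ K] [IsSemisimpleRing K]
    (σ : HopfDouble.HopfPairing ℂ (HopfDouble.HopfDual ℂ K) H)
    (V : Type*) [AddCommGroup V] [Module ℂ V] [Module H V] [IsScalarTower ℂ H V]
    [FiniteDimensional ℂ V]
    -- a complete list of representatives of the irreducible `K`-modules
    {ι : Type*} [Fintype ι] (W : ι → Type*) [∀ i, AddCommGroup (W i)] [∀ i, Module ℂ (W i)]
    [∀ i, Module K (W i)] [∀ i, IsScalarTower ℂ K (W i)] [∀ i, IsSimpleModule K (W i)]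
    (hW_inj : ∀ i j, Nonempty (W i ≃ₗ[K] W j) → i = j)
    (hW_surj : ∀ (U : Type u) [AddCommGroup U] [Module K U] [IsSimpleModule K U],
      ∃ i, Nonempty (U ≃ₗ[K] W i))
    (n : ℕ) (hn : 1 ≤ n) :
    IsSemisimpleRing σ.QuantumDouble ∧
      HopfDouble.indicator n (σ.doubleRep V) =
        ∑ i, HopfDouble.indicator n (σ.tensorRep V (W i)) *
          HopfDouble.indicator n (HopfDouble.copRep ℂ K (W i)) := by
  open HopfDouble Coalgebra HopfAlgebra in
  have hSK := antipode_antipode (A := K)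
  have hSH := antipode_antipode (A := H)
  have hSP := antipode_antipode_dual (k := ℂ) hSK
  obtain ⟨t, ht, httr⟩ := exists_isNormalizedIntegral_of_involutive hSH
  obtain ⟨l, hl, hltr⟩ := exists_isNormalizedIntegral_of_involutive hSP
  obtain ⟨s, hs, hstr⟩ := exists_isNormalizedIntegral_of_involutive hSK
  have hD := SkewPairing.Double.isNormalizedIntegral_double σ.toSkew hSP hSH hltr httr
  refine ⟨hD.isSemisimpleRing, ?_⟩
  -- Integrals involve only the product and the counit, which `K` and `K^cop` share.
  have hs' : IsNormalizedIntegral ℂ (toCop ℂ K s) :=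
    ⟨fun a => hs.mul_left a, fun a => hs.mul_right a, hs.counit_eq⟩
  have (i : ι) : FiniteDimensional ℂ (W i) := finiteDimensional_of_isSimpleModule (K := K) (W i)
  have hn0 : (Module.finrank ℂ K : ℂ) ≠ 0 := by
    have : Nontrivial K := by
      refine ⟨1, 0, fun h => ?_⟩
      have := congrArg (counit (R := ℂ)) h
      simp at this
    exact Nat.cast_ne_zero.2 Module.finrank_pos.ne'
  -- Both sides acquire the factor `dim K`: the left from the trace on `Hom(K, K^{*cop} ⊗ V)`, the
  -- right from the integral of `K` in `trace_twistBy`.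
  apply mul_left_cancel₀ hn0
  rw [indicator_eq n _ hD, trace_doubleRep σ hSK hl hltr (comm_comul_of_trace httr),
    trace_pre_pow_mul_actVB hs hSK hstr]
  congr 1
  simp_rw [indicator_eq n _ ht, indicator_eq n _ hs', trace_tensorRep, Finset.sum_mul]
  rw [Finset.sum_comm]
  refine Finset.sum_congr rfl fun j _ => ?_
  -- The trace of a left times a right multiplication on `K` splits over the irreducibles, giving
  -- one factor for the indicator of `K^cop` and one for the character of `V ⊗ W`.
  rw [← sum_trace_mul_trace W hW_inj hW_surj, Finset.mul_sum]
  refine Finset.sum_congr rfl fun i _ => ?_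
  rw [mul_assoc, mul_comm (LinearMap.trace ℂ (W i) _)]
  rfl
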